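/- Let $N\cong\mathbb{Z}^n$ be a lattice and let $X$ be a smooth toric Fano variety of dimension $n$ over $\mathbb{C}$ with fan $\Sigma_X$ in $N_{\mathbb{Q}}=N\otimes_{\mathbb{Z}}\mathbb{Q}$; that is, $\Sigma_X$ is a complete fan whose cones are generated by parts of bases of $N$, and every cone of $\Sigma_X$ is the cone over a face of the convex hull of $G(\Sigma_X)$, the vertices of this face being the generators of the cone, where $G(\Sigma_X)\subset N$ denotes the set of primitive generators of the rays of $\Sigma_X$ (equivalently, the anticanonical divisor of $X$ is ample). Let $H\subseteq N_{\mathbb{Q}}$ be the linear subspace spanned by all pairs $\{x,-x\}$ with $x\in G(\Sigma_X)$ and $-x\in G(\Sigma_X)$. For an even integer $h>0$, let $e_1,\dots,e_h$ be the standard basis of $\mathbb{Z}^h$ and $e_0=-e_1-\cdots-e_h$. The Del Pezzo variety $V^h$ is the smooth toric Fano variety of dimension $h$ whose fan in $\mathbb{Q}^h$ has the set of generators $\{e_0,-e_0,e_1,-e_1,\dots,e_h,-e_h\}$; the pseudo Del Pezzo variety $\widetilde V^h$ is the smooth toric Fano variety of dimension $h$ whose fan has the set of generators $\{e_0,e_1,-e_1,\dots,e_h,-e_h\}$.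 (1) If $\dim H=n$, then $X$ is isomorphic, as a toric variety, to a product of (finitely many, possibly zero) Del Pezzo varieties $V^{h_i}$, pseudo Del Pezzo varieties $\widetilde V^{\tilde h_j}$ and a power $(\mathbb{P}^1)^l$, $l\ge 0$. (2) If $\dim H=n-1$, then there exists a smooth complete toric variety $X'$, with fan $\Sigma_{X'}$ in $N_{\mathbb{Q}}$, such that $G(\Sigma_{X'})=G(\Sigma_X)$ (so that the identity of the torus extends to an equivariant birational map between $X'$ and $X$ which is an isomorphism in codimension $1$), and such that $X'$ is a toric bundle over $\mathbb{P}^1$ whose fiber $F$ is a product of Del Pezzo varieties, pseudo Del Pezzo varieties and a power of $\mathbb{P}^1$. Here a toric bundle over a toric variety $Z$ with fiber $F$ is an equivariant morphism $X'\to Z$ such that for every affine invariant open subset $U\subseteq Z$ the preimage of $U$ is isomorphic to $F\times U$ as a toric variety over $U$. -/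

import Mathlib

open CategoryTheory CategoryTheory.Limits AlgebraicGeometry
open scoped TensorProduct

noncomputable section

namespace Toric

/-! ### Lattices, cones, fans -/

section Fans

/-- The rational vector space `N_ℚ = N ⊗ ℚ` of a lattice `N`. -/
abbrev NQ (N : Type) [AddCommGroup N] : Type := ℚ ⊗[ℤ] N

/-- The canonical map `N → N_ℚ`. -/
def toNQ (N : Type) [AddCommGroup N] : N →ₗ[ℤ] NQ N := TensorProduct.mk ℤ ℚ N 1

/-- The convex cone `⟨s⟩` in `N_ℚ` spanned by a set `s` of lattice vectors. -/
def cone {N : Type} [AddCommGroup N] (s : Set N) : PointedCone ℚ (NQ N) :=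
  PointedCone.hull ℚ (toNQ N '' s)

/-- A (finite) fan in `N_ℚ` all of whose cones are generated by part of a basis of the lattice
`N`, i.e. the fan of a smooth toric variety. Such a cone has a unique set of primitive
generators, and its faces are the cones over the subsets of this set; so a cone of the fan is
recorded by the finite set of its primitive generators. -/
structure SmoothFan (N : Type) [AddCommGroup N] where
  /-- the sets of primitive generators of the cones of the fan -/
  cones : Set (Finset N)
  finite_cones : cones.Finite
  empty_mem : ∅ ∈ cones
  face_mem : ∀ {s t : Finset N}, s ∈ cones → t ⊆ s → t ∈ cones
  unimodular : ∀ {s : Finset N}, s ∈ cones →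
    ∃ (ι : Type) (b : Module.Basis ι ℤ N), (s : Set N) ⊆ Set.range b
  inter : ∀ {s t : Finset N}, s ∈ cones → t ∈ cones →
    cone (s : Set N) ⊓ cone (t : Set N) = cone ((s : Set N) ∩ (t : Set N))

variable {N : Type} [AddCommGroup N]

/-- The set `G(Σ)` of generators of the fan: the primitive vectors of its rays. -/
def SmoothFan.gens (X : SmoothFan N) : Set N := {x | {x} ∈ X.cones}

/-- The fan is complete: its cones cover `N_ℚ`. -/
def SmoothFan.IsComplete (X : SmoothFan N) : Prop :=
  ∀ v : NQ N, ∃ s ∈ X.cones, v ∈ cone (s : Set N)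

/-- The fan of a smooth toric Fano variety: it is complete, and every cone of the fan is
the cone over a face of the convex hull of `G(Σ)`, the vertices of that face being exactly
the generators of the cone (`f = 1` is a supporting hyperplane that cuts out the face).
Equivalently, the support function of the anticanonical divisor, the sum of all invariant prime
divisors, is strictly convex, i.e. the anticanonical divisor is ample. -/
def SmoothFan.IsFano (X : SmoothFan N) : Prop :=
  X.IsComplete ∧ ∀ s ∈ X.cones, ∃ f : Module.Dual ℚ (NQ N),
    (∀ x ∈ s, f (toNQ N x) = 1) ∧ ∀ x ∈ X.gens, x ∉ s → f (toNQ N x) < 1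

/-- The linear subspace `H` of `N_ℚ` spanned by all pairs `x, -x` of centrally symmetric
generators. -/
def SmoothFan.symmSpan (X : SmoothFan N) : Submodule ℚ (NQ N) :=
  Submodule.span ℚ (toNQ N '' {x | x ∈ X.gens ∧ -x ∈ X.gens})

/-- The linear map `φ` maps the cone `⟨s⟩` into the cone `⟨s'⟩`. -/
def MapsCone {N' : Type} [AddCommGroup N'] (φ : N →ₗ[ℤ] N') (s : Finset N) (s' : Finset N') :
    Prop :=
  ∀ x ∈ s, toNQ N' (φ x) ∈ cone (s' : Set N')

/-- The subfan of the cones that `π` maps into the cone `⟨τ⟩`; if `π` induces a toric morphism to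
a toric variety with `⟨τ⟩` in its fan, this is the fan of the preimage of the affine invariant
open subset `U_τ`. -/
def SmoothFan.preimage {N' : Type} [AddCommGroup N'] (X : SmoothFan N) (π : N →ₗ[ℤ] N')
    (τ : Finset N') : SmoothFan N where
  cones := {s | s ∈ X.cones ∧ MapsCone π s τ}
  finite_cones := X.finite_cones.subset fun _ hs => hs.1
  empty_mem := ⟨X.empty_mem, fun x hx => by simp at hx⟩
  face_mem := fun hs ht => ⟨X.face_mem hs.1 ht, fun x hx => hs.2 x (ht hx)⟩
  unimodular := fun hs => X.unimodular hs.1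
  inter := fun hs ht => X.inter hs.1 ht.1

end Fans

/-! ### The toric variety of a fan, as a scheme over `ℂ` -/

section Varieties

variable {N N' N'' : Type} [AddCommGroup N] [AddCommGroup N'] [AddCommGroup N'']

/-- The monoid `⟨s⟩^∨ ∩ M` of the linear forms `N → ℤ` that are nonnegative on `⟨s⟩`. -/
def dualMonoid (s : Finset N) : AddSubmonoid (Module.Dual ℤ N) where
  carrier := {u | ∀ x ∈ s, 0 ≤ u x}
  zero_mem' := fun _ _ => le_rfl
  add_mem' := fun ha hb x hx => add_nonneg (ha x hx) (hb x hx)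

lemma nonneg_of_mem_cone {s : Finset N} {u : Module.Dual ℤ N} (hu : u ∈ dualMonoid s) {x : N}
    (hx : toNQ N x ∈ cone (s : Set N)) : 0 ≤ u x := by
  let g : NQ N →ₗ[ℚ] ℚ := LinearMap.liftBaseChange ℚ ((Algebra.linearMap ℤ ℚ).comp u)
  have hg : ∀ y : N, g (toNQ N y) = (u y : ℚ) := fun y => by
    change g ((1 : ℚ) ⊗ₜ[ℤ] y) = _
    simp [g]
  have key : ∀ v ∈ cone (s : Set N), 0 ≤ g v := by
    intro v hv
    refine Submodule.span_induction (p := fun v _ => 0 ≤ g v) ?_ ?_ ?_ ?_ hv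
    · rintro _ ⟨y, hy, rfl⟩
      rw [hg]
      exact_mod_cast hu y hy
    · simp
    · intro a b _ _ ha hb
      rw [map_add]
      exact add_nonneg ha hb
    · intro c a _ ha
      have : g (c • a) = (c : ℚ) * g a := map_smul g (c : ℚ) a
      rw [this]
      exact mul_nonneg c.2 ha
  have := key _ hx
  rw [hg] at this
  exact_mod_cast this

/-- Pull-back of linear forms along `φ`, if `φ` maps `⟨s⟩` into `⟨s'⟩`. -/
def dualMap (φ : N →ₗ[ℤ] N') {s : Finset N} {s' : Finset N'} (h : MapsCone φ s s') :
    dualMonoid s' →+ dualMonoid s where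
  toFun u := ⟨u.1.comp φ, fun x hx => nonneg_of_mem_cone u.2 (h x hx)⟩
  map_zero' := rfl
  map_add' := fun _ _ => rfl

/-- The base scheme `Spec ℂ`. -/
abbrev base : Scheme.{0} := Spec (CommRingCat.of ℂ)

/-- The coordinate ring `ℂ[⟨s⟩^∨ ∩ M]`. -/
abbrev chartRing (s : Finset N) : CommRingCat.{0} :=
  CommRingCat.of (AddMonoidAlgebra ℂ (dualMonoid s))

/-- The affine toric variety `U_s = Spec ℂ[⟨s⟩^∨ ∩ M]`, over `ℂ`. -/
abbrev chart (s : Finset N) : Over base :=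
  Over.mk (Spec.map (CommRingCat.ofHom (algebraMap ℂ (AddMonoidAlgebra ℂ (dualMonoid s)))))

/-- The ring map `χ^u ↦ χ^(u ∘ φ)`, if `φ` maps `⟨s⟩` into `⟨s'⟩`. -/
def chartRingMap (φ : N →ₗ[ℤ] N') {s : Finset N} {s' : Finset N'} (h : MapsCone φ s s') :
    chartRing s' ⟶ chartRing s :=
  CommRingCat.ofHom (AddMonoidAlgebra.mapDomainRingHom ℂ (dualMap φ h))

lemma chartRingMap_w (φ : N →ₗ[ℤ] N') {s : Finset N} {s' : Finset N'} (h : MapsCone φ s s') :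
    Spec.map (chartRingMap φ h) ≫ (chart s').hom = (chart s).hom := by
  simp only [chartRingMap, Over.mk_hom]
  rw [← Spec.map_comp, ← CommRingCat.ofHom_comp]
  congr 2
  ext c
  simp [AddMonoidAlgebra.coe_algebraMap]

/-- The toric morphism `U_s ⟶ U_s'` induced by `φ`, if `φ` maps `⟨s⟩` into `⟨s'⟩`. -/
def chartMap (φ : N →ₗ[ℤ] N') {s : Finset N} {s' : Finset N'} (h : MapsCone φ s s') :
    chart s ⟶ chart s' :=
  Over.homMk (Spec.map (chartRingMap φ h)) (chartRingMap_w φ h)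

lemma chartMap_left (φ : N →ₗ[ℤ] N') {s : Finset N} {s' : Finset N'} (h : MapsCone φ s s') :
    (chartMap φ h).left = Spec.map (chartRingMap φ h) := rfl

lemma chartMap_comp (φ : N →ₗ[ℤ] N') (ψ : N' →ₗ[ℤ] N'') {s : Finset N} {s' : Finset N'}
    {s'' : Finset N''} (h : MapsCone φ s s') (h' : MapsCone ψ s' s'')
    (h'' : MapsCone (ψ.comp φ) s s'') :
    chartMap φ h ≫ chartMap ψ h' = chartMap (ψ.comp φ) h'' := by
  have : chartRingMap ψ h' ≫ chartRingMap φ h = chartRingMap (ψ.comp φ) h'' := by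
    simp only [chartRingMap]
    rw [← CommRingCat.ofHom_comp, ← AddMonoidAlgebra.mapDomainRingHom_comp]
    rfl
  ext1
  rw [Over.comp_left, chartMap_left, chartMap_left, chartMap_left, ← Spec.map_comp, this]

lemma chartMap_id {s : Finset N} (h : MapsCone LinearMap.id s s) :
    chartMap LinearMap.id h = 𝟙 (chart s) := by
  have h1 : dualMap LinearMap.id h = AddMonoidHom.id _ := rfl
  have : chartRingMap LinearMap.id h = 𝟙 _ := by
    simp only [chartRingMap]
    rw [h1, AddMonoidAlgebra.mapDomainRingHom_id]
    rfl
  ext1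
  rw [chartMap_left, this, Spec.map_id]
  rfl

lemma mapsCone_of_subset {t s : Finset N} (h : t ⊆ s) :
    MapsCone (LinearMap.id : N →ₗ[ℤ] N) t s :=
  fun x hx => Submodule.subset_span ⟨x, h hx, rfl⟩

/-- A face of a cone is cut out by a lattice point of the dual cone. -/
lemma exists_face_form {s t : Finset N} {ι : Type} (b : Module.Basis ι ℤ N)
    (hs : (s : Set N) ⊆ Set.range b) :
    ∃ m : Module.Dual ℤ N, (∀ x ∈ s, x ∈ t → m x = 0) ∧ ∀ x ∈ s, x ∉ t → m x = 1 := by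
  classical
  refine ⟨b.constr ℤ fun i => if b i ∈ t then 0 else 1, ?_, ?_⟩
  · intro x hx ht
    obtain ⟨i, rfl⟩ := hs hx
    simp [Module.Basis.constr_basis, ht]
  · intro x hx ht
    obtain ⟨i, rfl⟩ := hs hx
    simp [Module.Basis.constr_basis, ht]

/-- The inclusion `U_t ⟶ U_s` for a face `t` of a cone `s` of a smooth fan. -/
abbrev faceMap {s t : Finset N} (h : t ⊆ s) : chart t ⟶ chart s :=
  chartMap LinearMap.id (mapsCone_of_subset h)

lemma faceMap_self (s : Finset N) : faceMap (subset_refl s) = 𝟙 (chart s) :=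
  chartMap_id _

lemma faceMap_comp {u t s : Finset N} (h : u ⊆ t) (h' : t ⊆ s) :
    faceMap (h.trans h') = faceMap h ≫ faceMap h' :=
  (chartMap_comp LinearMap.id LinearMap.id _ _ (mapsCone_of_subset (h.trans h'))).symm

/-- If `m` cuts out the face `t` of `s`, then `ℂ[U_t]` is the localization of `ℂ[U_s]`
at `χ^m`. -/
lemma isLocalization_face {s t : Finset N} (hts : t ⊆ s) (m : dualMonoid s)
    (h0 : ∀ x ∈ t, m.1 x = 0) (h1 : ∀ x ∈ s, x ∉ t → 0 < m.1 x) :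
    let := (chartRingMap (LinearMap.id : N →ₗ[ℤ] N) (mapsCone_of_subset hts)).hom.toAlgebra
    IsLocalization.Away (AddMonoidAlgebra.single m (1 : ℂ))
      (AddMonoidAlgebra ℂ (dualMonoid t)) := by
  let := (chartRingMap (LinearMap.id : N →ₗ[ℤ] N) (mapsCone_of_subset hts)).hom.toAlgebra
  have hmap : ∀ z : AddMonoidAlgebra ℂ (dualMonoid s),
      algebraMap _ (AddMonoidAlgebra ℂ (dualMonoid t)) z =
        AddMonoidAlgebra.mapDomain (dualMap LinearMap.id (mapsCone_of_subset hts)) z :=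
    fun _ => rfl
  have hinj : Function.Injective (dualMap (LinearMap.id : N →ₗ[ℤ] N) (mapsCone_of_subset hts)) := by
    intro u v huv
    have h2 : u.1.comp LinearMap.id = v.1.comp LinearMap.id := congrArg (fun w : dualMonoid t => w.1) huv
    exact Subtype.ext h2
  have hm : -m.1 ∈ dualMonoid t := fun x hx => by simp [h0 x hx]
  have hone : AddMonoidAlgebra.single (dualMap LinearMap.id (mapsCone_of_subset hts) m) (1 : ℂ) *
      AddMonoidAlgebra.single (⟨-m.1, hm⟩ : dualMonoid t) 1 = 1 := by
    rw [AddMonoidAlgebra.single_mul_single, AddMonoidAlgebra.one_def, mul_one]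
    congr 1
    ext x
    simp [dualMap]
  refine IsLocalization.Away.mk _ ?_ ?_ ?_
  · rw [hmap, AddMonoidAlgebra.mapDomain_single]
    exact IsUnit.of_mul_eq_one _ hone
  · intro z
    induction z using AddMonoidAlgebra.induction_linear with
    | zero => exact ⟨0, 0, by simp⟩
    | add f g hf hg =>
      obtain ⟨k, a, ha⟩ := hf
      obtain ⟨l, b, hb⟩ := hg
      refine ⟨k + l, a * AddMonoidAlgebra.single m 1 ^ l + b * AddMonoidAlgebra.single m 1 ^ k, ?_⟩
      rw [map_add, map_mul, map_mul, ← ha, ← hb, map_pow, map_pow]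
      ring
    | single u c =>
      obtain ⟨k, hk⟩ : ∃ k : ℕ, ∀ x ∈ s, 0 ≤ u.1 x + k * m.1 x := by
        refine ⟨∑ x ∈ s, (u.1 x).natAbs, fun x hx => ?_⟩
        by_cases hxt : x ∈ t
        · have := u.2 x hxt
          rw [h0 x hxt]; simpa using this
        · have h2 := h1 x hx hxt
          have h3 : (u.1 x).natAbs ≤ ∑ x ∈ s, (u.1 x).natAbs :=
            Finset.single_le_sum (f := fun x => (u.1 x).natAbs) (fun _ _ => Nat.zero_le _) hx
          have h4 : ((u.1 x).natAbs : ℤ) ≤ ((∑ x ∈ s, (u.1 x).natAbs : ℕ) : ℤ) := by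
            exact_mod_cast h3
          have h5 : -(u.1 x) ≤ ((u.1 x).natAbs : ℤ) := by omega
          nlinarith
      refine ⟨k, AddMonoidAlgebra.single ⟨u.1 + k • m.1, fun x hx => ?_⟩ c, ?_⟩
      · simpa using hk x hx
      · rw [hmap, hmap, AddMonoidAlgebra.mapDomain_single, AddMonoidAlgebra.mapDomain_single,
          AddMonoidAlgebra.single_pow, AddMonoidAlgebra.single_mul_single, one_pow, mul_one]
        congr 1
  · intro a b hab
    refine ⟨0, ?_⟩
    rw [hmap, hmap] at hab
    rw [AddMonoidAlgebra.mapDomain_injective hinj hab]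

lemma isOpenImmersion_face {s t : Finset N} (hts : t ⊆ s) (m : dualMonoid s)
    (h0 : ∀ x ∈ t, m.1 x = 0) (h1 : ∀ x ∈ s, x ∉ t → 0 < m.1 x) :
    IsOpenImmersion (faceMap hts).left ∧
      Set.range (faceMap hts).left =
        (PrimeSpectrum.basicOpen (AddMonoidAlgebra.single m (1 : ℂ)) : Set (PrimeSpectrum _)) := by
  let := (chartRingMap (LinearMap.id : N →ₗ[ℤ] N) (mapsCone_of_subset hts)).hom.toAlgebra
  have := isLocalization_face hts m h0 h1
  refine ⟨IsOpenImmersion.of_isLocalization (AddMonoidAlgebra.single m (1 : ℂ)), ?_⟩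
  exact PrimeSpectrum.localization_away_comap_range (AddMonoidAlgebra ℂ (dualMonoid t))
    (AddMonoidAlgebra.single m (1 : ℂ))

/-- The affine toric varieties of the cones of the fan, with the inclusions of faces. -/
def SmoothFan.diagram (X : SmoothFan N) : X.cones ⥤ Over base where
  obj s := chart s.1
  map f := faceMap (leOfHom f)
  map_id s := faceMap_self s.1
  map_comp f g := faceMap_comp (leOfHom f) (leOfHom g)

instance (X : SmoothFan N) {s t : X.cones} (f : t ⟶ s) :
    IsOpenImmersion (X.diagram.map f).left := by
  obtain ⟨ι, b, hb⟩ := X.unimodular s.2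
  obtain ⟨m, h0, h1⟩ := exists_face_form (t := t.1) b hb
  have hts : t.1 ⊆ s.1 := leOfHom f
  refine (isOpenImmersion_face hts ⟨m, fun x hx => ?_⟩ (fun x hx => h0 x (hts hx) hx)
    (fun x hx hxt => ?_)).1
  · by_cases hxt : x ∈ t.1
    · rw [h0 x hx hxt]
    · rw [h1 x hx hxt]; exact zero_le_one
  · rw [h1 x hx hxt]; exact zero_lt_one

instance (X : SmoothFan N) :
    (X.diagram ⋙ Over.forget base ⋙ Scheme.forget).IsLocallyDirected where
  cond := by
    classical
    intro i j k fi fj xi xj hx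
    obtain ⟨ι, b, hb⟩ := X.unimodular k.2
    obtain ⟨mi, hi0, hi1⟩ := exists_face_form (t := i.1) b hb
    obtain ⟨mj, hj0, hj1⟩ := exists_face_form (t := j.1) b hb
    have hik : i.1 ⊆ k.1 := leOfHom fi
    have hjk : j.1 ⊆ k.1 := leOfHom fj
    have hmi : mi ∈ dualMonoid k.1 := fun x hx => by
      by_cases hxt : x ∈ i.1
      · rw [hi0 x hx hxt]
      · rw [hi1 x hx hxt]; exact zero_le_one
    have hmj : mj ∈ dualMonoid k.1 := fun x hx => by
      by_cases hxt : x ∈ j.1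
      · rw [hj0 x hx hxt]
      · rw [hj1 x hx hxt]; exact zero_le_one
    let l : X.cones := ⟨i.1 ∩ j.1, X.face_mem i.2 Finset.inter_subset_left⟩
    let li : l ⟶ i := homOfLE (show i.1 ∩ j.1 ⊆ i.1 from Finset.inter_subset_left)
    let lj : l ⟶ j := homOfLE (show i.1 ∩ j.1 ⊆ j.1 from Finset.inter_subset_right)
    have hlk : i.1 ∩ j.1 ⊆ k.1 := Finset.inter_subset_left.trans hik
    obtain ⟨-, hri⟩ := isOpenImmersion_face hik ⟨mi, hmi⟩ (fun x hx => hi0 x (hik hx) hx)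
      (fun x hx hxt => by simp [hi1 x hx hxt])
    obtain ⟨-, hrj⟩ := isOpenImmersion_face hjk ⟨mj, hmj⟩ (fun x hx => hj0 x (hjk hx) hx)
      (fun x hx hxt => by simp [hj1 x hx hxt])
    obtain ⟨-, hrl⟩ := isOpenImmersion_face hlk (⟨mi, hmi⟩ + ⟨mj, hmj⟩)
      (fun x hx => by
        have h := Finset.mem_inter.1 hx
        simp [hi0 x (hlk hx) h.1, hj0 x (hlk hx) h.2])
      (fun x hx hxt => by
        have a1 := hmi x hx
        have a2 := hmj x hx
        by_cases hxi : x ∈ i.1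
        · have hxj : x ∉ j.1 := fun h => hxt (Finset.mem_inter.2 ⟨hxi, h⟩)
          have := hj1 x hx hxj
          change 0 < mi x + mj x
          omega
        · have := hi1 x hx hxi
          change 0 < mi x + mj x
          omega)
    have hx' : (faceMap hik).left xi = (faceMap hjk).left xj := hx
    have hmem : (faceMap hik).left xi ∈ Set.range (faceMap hlk).left := by
      have e1 : (faceMap hik).left xi ∈ Set.range (faceMap hik).left := ⟨xi, rfl⟩
      have e2 : (faceMap hik).left xi ∈ Set.range (faceMap hjk).left := ⟨xj, hx'.symm⟩
      rw [hri] at e1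
      rw [hrj] at e2
      rw [hrl, show (AddMonoidAlgebra.single (⟨mi, hmi⟩ + ⟨mj, hmj⟩ : dualMonoid k.1) (1 : ℂ)) =
        AddMonoidAlgebra.single ⟨mi, hmi⟩ 1 * AddMonoidAlgebra.single ⟨mj, hmj⟩ 1 by
          rw [AddMonoidAlgebra.single_mul_single, mul_one], PrimeSpectrum.basicOpen_mul]
      exact ⟨e1, e2⟩
    obtain ⟨y, hy⟩ := hmem
    have hI : IsOpenImmersion (X.diagram.map fi).left := inferInstance
    have hJ : IsOpenImmersion (X.diagram.map fj).left := inferInstance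
    refine ⟨l, li, lj, y, ?_, ?_⟩
    · refine hI.base_open.injective ?_
      have : X.diagram.map li ≫ X.diagram.map fi = faceMap hlk := by
        rw [← X.diagram.map_comp]; rfl
      have h2 := congrArg (fun q => q.left y) this
      exact h2.trans hy
    · refine hJ.base_open.injective ?_
      have : X.diagram.map lj ≫ X.diagram.map fj = faceMap hlk := by
        rw [← X.diagram.map_comp]; rfl
      have h2 := congrArg (fun q => q.left y) this
      exact h2.trans (hy.trans hx')

/-- The toric variety of a smooth fan: the affine toric varieties `U_s`, `s` a cone of the fan,
glued along the open subvarieties given by the common faces. -/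
def SmoothFan.variety (X : SmoothFan N) : Over base := colimit X.diagram

/-- The inclusion of the affine invariant open subset `U_s`. -/
def SmoothFan.ι (X : SmoothFan N) (s : Finset N) (hs : s ∈ X.cones) : chart s ⟶ X.variety :=
  colimit.ι X.diagram ⟨s, hs⟩

/-- `f` is the toric (equivariant) morphism induced by the lattice map `φ`. -/
structure IsToricMorphism (X : SmoothFan N) (Y : SmoothFan N') (φ : N →ₗ[ℤ] N')
    (f : X.variety ⟶ Y.variety) : Prop where
  exists_mapsCone : ∀ s ∈ X.cones, ∃ s' ∈ Y.cones, MapsCone φ s s'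
  comp_eq : ∀ (s : Finset N) (hs : s ∈ X.cones) (s' : Finset N') (hs' : s' ∈ Y.cones)
    (h : MapsCone φ s s'), X.ι s hs ≫ f = chartMap φ h ≫ Y.ι s' hs'

end Varieties

/-! ### Isomorphisms in codimension 1, products, bundles -/

section Structures

variable {N : Type} [AddCommGroup N]

/-- The two toric varieties (of fans in the same lattice) contain a common open subscheme that
contains the torus of both and whose complement has codimension at least two in both: the identity
of the torus extends to an equivariant birational map that is an isomorphism in codimension 1. -/
def IsoInCodimOne (X X' : SmoothFan N) : Prop :=
  ∃ (U : Over base) (i : U ⟶ X.variety) (i' : U ⟶ X'.variety) (t : chart (∅ : Finset N) ⟶ U),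
    IsOpenImmersion i.left ∧ IsOpenImmersion i'.left ∧
    t ≫ i = X.ι ∅ X.empty_mem ∧ t ≫ i' = X'.ι ∅ X'.empty_mem ∧
    (∀ x : X.variety.left, x ∉ Set.range i.left →
      2 ≤ ringKrullDim (X.variety.left.presheaf.stalk x)) ∧
    (∀ x : X'.variety.left, x ∉ Set.range i'.left →
      2 ≤ ringKrullDim (X'.variety.left.presheaf.stalk x))

/-- The toric variety of `X` is the product of the toric varieties of the `F i`, as a toric
variety: there is a lattice isomorphism `N ≃ ∏ᵢ ℤ^(d i)` that identifies the cones of `X` with the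
products of cones of the `F i`, and the toric morphisms `p i` induced by the projections make the
variety of `X` the product of the varieties of the `F i` over `ℂ`. -/
def IsToricProduct (X : SmoothFan N) {k : ℕ} {d : Fin k → ℕ}
    (F : ∀ i, SmoothFan (Fin (d i) → ℤ)) : Prop :=
  ∃ e : N ≃ₗ[ℤ] (∀ i, Fin (d i) → ℤ),
    (∀ s : Finset N, s ∈ X.cones ↔
      ∃ t : ∀ i, Finset (Fin (d i) → ℤ), (∀ i, t i ∈ (F i).cones) ∧
        e '' (s : Set N) =
          ⋃ i, LinearMap.single ℤ (fun i => Fin (d i) → ℤ) i '' (t i : Set (Fin (d i) → ℤ))) ∧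
    ∃ p : ∀ i, X.variety ⟶ (F i).variety,
      (∀ i, IsToricMorphism X (F i) (LinearMap.proj i ∘ₗ e.toLinearMap) (p i)) ∧
      Nonempty (IsLimit (Limits.Fan.mk X.variety p))

/-- The toric variety of `X` is a toric bundle over the toric variety of `Z` with fiber the
toric variety of `F`: there is an equivariant morphism `f` from `X` to `Z`, induced by a lattice map
`π`, such that for every affine invariant open subset `U_τ` of `Z` the toric variety `f⁻¹(U_τ)` is
isomorphic to `F × U_τ` as a toric variety over `U_τ`. -/
def IsToricBundle {NZ NF : Type} [AddCommGroup NZ] [AddCommGroup NF]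
    (X : SmoothFan N) (Z : SmoothFan NZ) (F : SmoothFan NF) : Prop :=
  ∃ (π : N →ₗ[ℤ] NZ) (f : X.variety ⟶ Z.variety), IsToricMorphism X Z π f ∧
    ∀ (τ : Finset NZ) (hτ : τ ∈ Z.cones),
      ∃ e : N ≃ₗ[ℤ] NF × NZ, LinearMap.snd ℤ NF NZ ∘ₗ e.toLinearMap = π ∧
        (∀ s : Finset N, s ∈ (X.preimage π τ).cones ↔
          ∃ t ∈ F.cones, ∃ τ' ⊆ τ, e '' (s : Set N) =
            LinearMap.inl ℤ NF NZ '' (t : Set NF) ∪ LinearMap.inr ℤ NF NZ '' (τ' : Set NZ)) ∧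
        ∃ (j : (X.preimage π τ).variety ⟶ X.variety) (q : (X.preimage π τ).variety ⟶ F.variety)
          (r : (X.preimage π τ).variety ⟶ chart τ),
          IsToricMorphism (X.preimage π τ) X LinearMap.id j ∧
          IsToricMorphism (X.preimage π τ) F (LinearMap.fst ℤ NF NZ ∘ₗ e.toLinearMap) q ∧
          IsPullback j r f (Z.ι τ hτ) ∧
          Nonempty (IsLimit (BinaryFan.mk q r))

end Structures

/-! ### Del Pezzo varieties, pseudo Del Pezzo varieties, the projective line -/

section Factors

variable {h : ℕ}

/-- The fan, in the lattice `ℤ^h`, `h > 0` even, of the Del Pezzo variety `V^h`: the smooth toric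
Fano variety with generators `x_i = e_i`, `x_0 = -e_1-⋯-e_h`, and their negatives `y_i`. -/
def IsDelPezzo (F : SmoothFan (Fin h → ℤ)) : Prop :=
  0 < h ∧ Even h ∧ F.IsFano ∧
    F.gens = {v | ∃ i, v = Pi.single i 1 ∨ v = -Pi.single i 1} ∪
      {-∑ i, Pi.single i 1, ∑ i, Pi.single i 1}

/-- The fan, in the lattice `ℤ^h`, `h > 0` even, of the pseudo Del Pezzo variety `Ṽ^h`: the smooth
toric Fano variety with generators `x_i = e_i`, their negatives `y_i`, and
`x_0 = -e_1-⋯-e_h`. -/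
def IsPseudoDelPezzo (F : SmoothFan (Fin h → ℤ)) : Prop :=
  0 < h ∧ Even h ∧ F.IsFano ∧
    F.gens = {v | ∃ i, v = Pi.single i 1 ∨ v = -Pi.single i 1} ∪ {-∑ i, Pi.single i 1}

/-- The fan of the projective line `ℙ¹`: the complete fan in `ℤ` with generators `1`, `-1`. -/
def IsProjectiveLine (F : SmoothFan (Fin h → ℤ)) : Prop :=
  h = 1 ∧ F.IsComplete ∧ F.gens = {1, -1}

/-- The toric variety of `X` is a product of Del Pezzo varieties, pseudo Del Pezzo varieties and a
power of `ℙ¹` (any number of factors of each kind, possibly none). -/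
def IsProductOfStandardFactors {N : Type} [AddCommGroup N] (X : SmoothFan N) : Prop :=
  ∃ (k : ℕ) (d : Fin k → ℕ) (F : ∀ i, SmoothFan (Fin (d i) → ℤ)),
    (∀ i, IsDelPezzo (F i) ∨ IsPseudoDelPezzo (F i) ∨ IsProjectiveLine (F i)) ∧
    IsToricProduct X F

end Factors

end Toric

end

/-! A maximal cone `s` of a smooth complete fan is a basis of `N`; `level s` is the form that equals
`1` on it. In a Fano fan every other generator has level at most `0`, because levels are integers.
The main tool (`swap_of_level_zero`, `eq_of_level_zero`) is this: a generator of level `0` with a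
negative coordinate at `x ∈ s` is the new vertex of the cone across the wall opposite to `x`. So
that coordinate is `-1`, and the generator is the only one of its kind. A symmetric generator
outside `±s` always has level `0`.

Exchanging non-symmetric elements of `s` for symmetric generators leads to a maximal cone whose
symmetric elements are a basis of `H ∩ N`. If the exchanges are made with control over the sum of
all generators in `H`, every generator in `H` outside `±s` ends up on level `0` (`exists_adapted`).
These remaining generators have coordinates `0, 1, -1`, and two of them are equal, opposite or of
disjoint support (`co_cases`, `eq_or_eq_neg`). Level `0` makes each support even. A support carries
a Del Pezzo or a pseudo Del Pezzo configuration, according to whether both or only one of `±w` is a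
generator; a symmetric element of `s` in no support gives a `ℙ¹` (`exists_blocks`). If `H` is the
whole space this describes all generators, and a Fano fan is determined by its generators.

If `H` is a hyperplane `u = 0`, the generators off `H` have `u = ±1`. Studying a maximal cone that
contains `v₁ + v₂ + 2 • v'`, with `v₁, v₂` on one side and `v'` on the other, shows that each side
has only one generator (`eq_of_opposite`). The fan of `X'` consists of the joins of the cones of the
fibre fan in `H` with the rays of these two generators. It splits over each chart of `ℙ¹`. Two fans
with the same rays share all charts of rays, and the complement of those has codimension at least
two.

The scheme-theoretic claims are reduced to charts, where a product of toric varieties becomes the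
universal property of a monoid algebra (`existsUnique_ringHom`). The passage back to varieties uses
the smallest chart around a point (`mapsCone_of_minimal`). -/

namespace Toric

/-! ### Integral coordinates in cones; complete and Fano fans. -/

section Lattice

variable {N N' : Type} [AddCommGroup N] [AddCommGroup N']

/-- The `ℚ`-linear extension to `N_ℚ` of a rational linear form on `N`. -/
noncomputable def extendForm (u : N →ₗ[ℤ] ℚ) : Module.Dual ℚ (NQ N) := LinearMap.liftBaseChange ℚ u

@[simp] lemma extendForm_toNQ (u : N →ₗ[ℤ] ℚ) (x : N) : extendForm u (toNQ N x) = u x := by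
  change LinearMap.liftBaseChange ℚ u ((1 : ℚ) ⊗ₜ[ℤ] x) = _
  simp

/-- An integral form, regarded as a rational one. -/
noncomputable def ratForm (u : N →ₗ[ℤ] ℤ) : N →ₗ[ℤ] ℚ := (Algebra.linearMap ℤ ℚ).comp u

@[simp] lemma ratForm_apply (u : N →ₗ[ℤ] ℤ) (x : N) : ratForm u x = (u x : ℚ) := rfl

lemma mem_cone_iff {s : Finset N} {v : NQ N} : v ∈ cone (s : Set N) ↔
    ∃ c : N → ℚ, (∀ x, 0 ≤ c x) ∧ v = ∑ x ∈ s, c x • toNQ N x := by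
  classical
  constructor
  · intro hv
    refine Submodule.span_induction
      (p := fun v _ => ∃ c : N → ℚ, (∀ x, 0 ≤ c x) ∧ v = ∑ x ∈ s, c x • toNQ N x) ?_ ?_ ?_ ?_ hv
    · rintro _ ⟨y, hy, rfl⟩
      refine ⟨fun x => if x = y then 1 else 0, fun x => by dsimp only; split_ifs <;> norm_num, ?_⟩
      have hy' : y ∈ s := hy
      simp [hy']
    · exact ⟨0, fun _ => le_rfl, by simp⟩
    · rintro a b _ _ ⟨c, hc, rfl⟩ ⟨d, hd, rfl⟩
      exact ⟨c + d, fun x => add_nonneg (hc x) (hd x), by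
        simp [add_smul, Finset.sum_add_distrib]⟩
    · rintro k a _ ⟨c, hc, rfl⟩
      refine ⟨fun x => k.1 * c x, fun x => mul_nonneg k.2 (hc x), ?_⟩
      change k.1 • (∑ x ∈ s, c x • toNQ N x) = _
      rw [Finset.smul_sum]
      simp [mul_smul]
  · rintro ⟨c, hc, rfl⟩
    refine Submodule.sum_mem _ fun x hx => ?_
    exact Submodule.smul_mem _ (⟨c x, hc x⟩ : {r : ℚ // 0 ≤ r}) (Submodule.subset_span ⟨x, hx, rfl⟩)

lemma toNQ_sum_zsmul (s : Finset N) (c : N → ℤ) :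
    toNQ N (∑ x ∈ s, c x • x) = ∑ x ∈ s, (c x : ℚ) • toNQ N x := by
  rw [map_sum]
  refine Finset.sum_congr rfl fun x _ => ?_
  rw [map_zsmul]
  exact (Int.cast_smul_eq_zsmul ℚ _ _).symm

lemma sum_zsmul_mem_cone {s : Finset N} {c : N → ℤ} (hc : ∀ x ∈ s, 0 ≤ c x) :
    toNQ N (∑ x ∈ s, c x • x) ∈ cone (s : Set N) := by
  classical
  rw [mem_cone_iff]
  refine ⟨fun x => if x ∈ s then (c x : ℚ) else 0, fun x => ?_, ?_⟩
  · dsimp only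
    split_ifs with h
    · exact_mod_cast hc x h
    · exact le_rfl
  · rw [toNQ_sum_zsmul]
    exact Finset.sum_congr rfl fun x hx => by simp [hx]

lemma exists_nsmul_eq_toNQ (v : NQ N) : ∃ k : ℕ, 0 < k ∧ ∃ x : N, (k : ℚ) • v = toNQ N x := by
  induction v using TensorProduct.induction_on with
  | zero => exact ⟨1, one_pos, 0, by simp⟩
  | tmul q x =>
    refine ⟨q.den, q.den_pos, q.num • x, ?_⟩
    rw [map_zsmul]
    change (q.den : ℚ) • (q ⊗ₜ[ℤ] x) = q.num • ((1 : ℚ) ⊗ₜ[ℤ] x)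
    rw [TensorProduct.smul_tmul', TensorProduct.smul_tmul', smul_eq_mul, mul_comm, Rat.mul_den_eq_num]
    simp
  | add a b ha hb =>
    obtain ⟨k, hk, x, hx⟩ := ha
    obtain ⟨l, hl, y, hy⟩ := hb
    refine ⟨k * l, Nat.mul_pos hk hl, l • x + k • y, ?_⟩
    rw [map_add, map_nsmul, map_nsmul, ← hx, ← hy, ← Nat.cast_smul_eq_nsmul ℚ l,
      ← Nat.cast_smul_eq_nsmul ℚ k, smul_smul, smul_smul, smul_add]
    push_cast
    rw [mul_comm (l : ℚ)]

lemma toNQ_injective [Module.Free ℤ N] : Function.Injective (toNQ N) := by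
  rw [← LinearMap.ker_eq_bot, LinearMap.ker_eq_bot']
  intro x hx
  refine (Module.Free.chooseBasis ℤ N).ext_elem fun i => ?_
  have := extendForm_toNQ (ratForm ((Module.Free.chooseBasis ℤ N).coord i)) x
  rw [hx, map_zero] at this
  simpa using this.symm

lemma zero_notMem_of_basis {s : Finset N} (hs : ∃ (ι : Type) (b : Module.Basis ι ℤ N),
    (s : Set N) ⊆ Set.range b) : (0 : N) ∉ s := by
  obtain ⟨ι, b, hb⟩ := hs
  intro h
  obtain ⟨i, hi⟩ := hb h
  exact b.ne_zero i hi

lemma exists_dual_of_basis {s : Finset N} (hs : ∃ (ι : Type) (b : Module.Basis ι ℤ N),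
    (s : Set N) ⊆ Set.range b) :
    ∃ d : N → N →ₗ[ℤ] ℤ, (∀ x ∈ s, d x x = 1) ∧ ∀ x ∈ s, ∀ y ∈ s, x ≠ y → d x y = 0 := by
  classical
  obtain ⟨ι, b, hb⟩ := hs
  refine ⟨fun x => b.constr ℤ fun i => if b i = x then 1 else 0, ?_, ?_⟩
  · intro x hx
    obtain ⟨i, rfl⟩ := hb hx
    simp [Module.Basis.constr_basis]
  · intro x hx y hy hxy
    obtain ⟨i, rfl⟩ := hb hy
    simp [Module.Basis.constr_basis, hxy.symm]

lemma dual_sum {s : Finset N} {d : N → N →ₗ[ℤ] ℤ} (h1 : ∀ x ∈ s, d x x = 1)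
    (h0 : ∀ x ∈ s, ∀ y ∈ s, x ≠ y → d x y = 0) {x : N} (hx : x ∈ s) (c : N → ℤ) :
    d x (∑ y ∈ s, c y • y) = c x := by
  rw [map_sum, Finset.sum_eq_single_of_mem x hx]
  · simp [h1 x hx]
  · intro y hy hyx
    simp [h0 x hx y hy hyx.symm]

variable (X : SmoothFan N)

lemma SmoothFan.exists_dual {X : SmoothFan N} {s : Finset N} (hs : s ∈ X.cones) :
    ∃ d : N → N →ₗ[ℤ] ℤ, (∀ x ∈ s, d x x = 1) ∧ ∀ x ∈ s, ∀ y ∈ s, x ≠ y → d x y = 0 :=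
  exists_dual_of_basis (X.unimodular hs)

/-- The rational coefficients are the values of the integral dual forms at `v`, hence integers. -/
lemma exists_int_coeff [Module.Free ℤ N] {s : Finset N}
    (hs : ∃ (ι : Type) (b : Module.Basis ι ℤ N), (s : Set N) ⊆ Set.range b) {v : N}
    (hv : toNQ N v ∈ cone (s : Set N)) :
    ∃ c : N → ℤ, (∀ x, 0 ≤ c x) ∧ v = ∑ x ∈ s, c x • x := by
  classical
  obtain ⟨d, h1, h0⟩ := exists_dual_of_basis hs
  obtain ⟨c, hc, hcv⟩ := mem_cone_iff.1 hv
  have key : ∀ x ∈ s, (d x v : ℚ) = c x := fun x hx => by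
    have := extendForm_toNQ (ratForm (d x)) v
    rw [hcv, map_sum, Finset.sum_eq_single_of_mem x hx] at this
    · simpa [h1 x hx] using this.symm
    · intro y hy hyx
      simp [h0 x hx y hy hyx.symm]
  refine ⟨fun x => if x ∈ s then d x v else 0, fun x => ?_, toNQ_injective ?_⟩
  · dsimp only
    split_ifs with h
    · have := hc x
      rw [← key x h] at this
      exact_mod_cast this
    · exact le_rfl
  · rw [toNQ_sum_zsmul, hcv]
    refine Finset.sum_congr rfl fun x hx => ?_
    simp [hx, key x hx]

lemma SmoothFan.mem_cone_iff_int [Module.Free ℤ N] {X : SmoothFan N} {s : Finset N}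
    (hs : s ∈ X.cones) {v : N} : toNQ N v ∈ cone (s : Set N) ↔
      ∃ c : N → ℤ, (∀ x, 0 ≤ c x) ∧ v = ∑ x ∈ s, c x • x := by
  refine ⟨exists_int_coeff (X.unimodular hs), ?_⟩
  rintro ⟨c, hc, rfl⟩
  exact sum_zsmul_mem_cone fun x _ => hc x

lemma mem_cone_of_smul {s : Set N} {v : NQ N} {k : ℕ} (hk : 0 < k) (h : (k : ℚ) • v ∈ cone s) :
    v ∈ cone s := by
  have hk' : (k : ℚ) ≠ 0 := by exact_mod_cast hk.ne'
  have := Submodule.smul_mem (cone s) (⟨(k : ℚ)⁻¹, by positivity⟩ : {r : ℚ // 0 ≤ r}) h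
  change (k : ℚ)⁻¹ • (k : ℚ) • v ∈ _ at this
  rwa [inv_smul_smul₀ hk'] at this

lemma SmoothFan.isComplete_iff {X : SmoothFan N} :
    X.IsComplete ↔ ∀ v : N, ∃ s ∈ X.cones, toNQ N v ∈ cone (s : Set N) := by
  refine ⟨fun h v => h _, fun h v => ?_⟩
  obtain ⟨k, hk, x, hx⟩ := exists_nsmul_eq_toNQ v
  obtain ⟨s, hs, h2⟩ := h x
  exact ⟨s, hs, mem_cone_of_smul hk (hx ▸ h2)⟩

lemma SmoothFan.isFano_iff {X : SmoothFan N} :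
    X.IsFano ↔ X.IsComplete ∧ ∀ s ∈ X.cones, ∃ f : N →ₗ[ℤ] ℚ,
      (∀ x ∈ s, f x = 1) ∧ ∀ x ∈ X.gens, x ∉ s → f x < 1 := by
  refine and_congr_right fun _ => forall₂_congr fun s _ => ⟨?_, ?_⟩
  · rintro ⟨f, h1, h2⟩
    exact ⟨(f.restrictScalars ℤ).comp (toNQ N), h1, h2⟩
  · rintro ⟨f, h1, h2⟩
    exact ⟨extendForm f, fun x hx => by simpa using h1 x hx, fun x hx hxs => by
      simpa using h2 x hx hxs⟩

variable {X}

lemma SmoothFan.mem_gens_of_mem {s : Finset N} (hs : s ∈ X.cones) {x : N} (hx : x ∈ s) :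
    x ∈ X.gens :=
  X.face_mem hs (Finset.singleton_subset_iff.2 hx)

lemma SmoothFan.finite_gens (X : SmoothFan N) : X.gens.Finite :=
  X.finite_cones.preimage fun _ _ _ _ h => Finset.singleton_injective h

lemma SmoothFan.ne_zero_of_mem_gens {x : N} (hx : x ∈ X.gens) : x ≠ 0 := by
  rintro rfl
  exact zero_notMem_of_basis (X.unimodular hx) (Finset.mem_singleton_self _)

/-- A lattice point is a positive combination of the generators of a cone. -/
lemma SmoothFan.IsComplete.exists_pos_coeff [Module.Free ℤ N] (hX : X.IsComplete) (v : N) :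
    ∃ s ∈ X.cones, ∃ c : N → ℤ, (∀ x ∈ s, 0 < c x) ∧ v = ∑ x ∈ s, c x • x := by
  classical
  obtain ⟨s, hs, hv⟩ := hX (toNQ N v)
  obtain ⟨c, hc, rfl⟩ := (X.mem_cone_iff_int hs).1 hv
  refine ⟨s.filter (fun x => 0 < c x), X.face_mem hs (Finset.filter_subset _ _), c, fun x hx =>
    (Finset.mem_filter.1 hx).2, ?_⟩
  symm
  refine Finset.sum_subset (Finset.filter_subset _ _) fun x hx hx' => ?_
  have : c x = 0 := le_antisymm (not_lt.1 fun h => hx' (Finset.mem_filter.2 ⟨hx, h⟩)) (hc x)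
  simp [this]

/-- The cones of a Fano fan are exactly the faces of the polytope of its generators. -/
lemma SmoothFan.IsFano.mem_cones [Module.Free ℤ N] (hX : X.IsFano) {s : Finset N}
    (hs : ∀ x ∈ s, x ∈ X.gens) (f : N →ₗ[ℤ] ℚ) (h1 : ∀ x ∈ s, f x = 1)
    (h2 : ∀ x ∈ X.gens, x ∉ s → f x < 1) : s ∈ X.cones := by
  classical
  obtain ⟨hc, hF⟩ := X.isFano_iff.1 hX
  -- The sum of `s` is interior to some cone `t` with supporting form `g`. Evaluating `f` and `g` at
  -- it gives `|s| = ∑ c • f ≤ ∑ c = ∑ g ≤ |s|`; equality throughout forces `s = t`.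
  obtain ⟨t, ht, c, hc0, hct⟩ := hc.exists_pos_coeff (∑ x ∈ s, x)
  obtain ⟨g, g1, g2⟩ := hF t ht
  have hf := congrArg f hct
  have hg := congrArg g hct
  simp only [map_sum, map_zsmul] at hf hg
  rw [Finset.sum_congr rfl h1] at hf
  rw [Finset.sum_congr rfl (fun x hx => by rw [g1 x hx]) (s₂ := t)] at hg
  have fle : ∀ x ∈ X.gens, f x ≤ 1 := fun x hx => by
    by_cases h : x ∈ s
    · exact (h1 x h).le
    · exact (h2 x hx h).le
  have gle : ∀ x ∈ X.gens, g x ≤ 1 := fun x hx => by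
    by_cases h : x ∈ t
    · exact (g1 x h).le
    · exact (g2 x hx h).le
  have e1 : ∑ x ∈ t, c x • f x ≤ ∑ x ∈ t, c x • (1 : ℚ) := Finset.sum_le_sum fun x hx => by
    simp only [zsmul_eq_mul]
    exact mul_le_mul_of_nonneg_left (fle x (X.mem_gens_of_mem ht hx)) (by exact_mod_cast (hc0 x hx).le)
  have e2 : ∑ x ∈ s, g x ≤ ∑ x ∈ s, (1 : ℚ) := Finset.sum_le_sum fun x hx => gle x (hs x hx)
  have heq1 : ∑ x ∈ t, c x • f x = ∑ x ∈ t, c x • (1 : ℚ) := le_antisymm e1 (by rw [← hf, ← hg]; exact e2)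
  have heq2 : ∑ x ∈ s, g x = ∑ x ∈ s, (1 : ℚ) := le_antisymm e2 (by rw [hg, hf]; exact e1)
  have hst : s = t := by
    apply Finset.Subset.antisymm
    · intro x hx
      by_contra hxt
      exact (Finset.sum_lt_sum (fun x hx => gle x (hs x hx)) ⟨x, hx, g2 x (hs x hx) hxt⟩).ne heq2
    · intro x hx
      by_contra hxs
      refine (Finset.sum_lt_sum (fun x hx => ?_) ⟨x, hx, ?_⟩).ne heq1
      · simp only [zsmul_eq_mul]
        exact mul_le_mul_of_nonneg_left (fle x (X.mem_gens_of_mem ht hx)) (by exact_mod_cast (hc0 x hx).le)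
      · simp only [zsmul_eq_mul]
        exact mul_lt_mul_of_pos_left (h2 x (X.mem_gens_of_mem ht hx) hxs) (by exact_mod_cast hc0 x hx)
  exact hst ▸ ht

/-- Moving from an interior point of the cone `⟨s⟩` a little into the direction of `x`, one
stays in a cone that has `⟨s⟩` as a face. -/
lemma SmoothFan.IsComplete.exists_superset [Module.Free ℤ N] (hX : X.IsComplete) {s : Finset N}
    (hs : s ∈ X.cones) (x : N) :
    ∃ t ∈ X.cones, s ⊆ t ∧ ∃ (K : ℕ) (c : N → ℤ), (∀ y, 0 ≤ c y) ∧
      K • (∑ y ∈ s, y) + x = ∑ y ∈ t, c y • y := by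
  classical
  set p := ∑ y ∈ s, y with hp
  have h1 : ∀ K : ℕ, ∃ t : X.cones, toNQ N (K • p + x) ∈ cone (t.1 : Set N) := fun K => by
    obtain ⟨t, ht, h⟩ := hX (toNQ N (K • p + x))
    exact ⟨⟨t, ht⟩, h⟩
  choose T hT using h1
  have := X.finite_cones.to_subtype
  -- Pigeonhole: one cone `t` contains `K • p + x` for infinitely many `K`.
  obtain ⟨⟨t, ht⟩, hinf⟩ := Finite.exists_infinite_fiber T
  have hinf' : (T ⁻¹' {⟨t, ht⟩}).Infinite := Set.infinite_coe_iff.1 hinf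
  have hc : ∀ K ∈ T ⁻¹' {⟨t, ht⟩}, ∃ c : N → ℤ, (∀ y, 0 ≤ c y) ∧ K • p + x = ∑ y ∈ t, c y • y := by
    intro K hK
    have h2 := hT K
    rw [Set.mem_preimage, Set.mem_singleton_iff] at hK
    rw [hK] at h2
    exact (X.mem_cone_iff_int ht).1 h2
  obtain ⟨d, d1, d0⟩ := X.exists_dual ht
  have hdp : ∀ y ∈ t, 0 ≤ d y p := by
    intro y hy
    by_contra hneg
    obtain ⟨K, hK, hlt⟩ := hinf'.exists_gt (d y x).natAbs
    obtain ⟨c, hc0, hcK⟩ := hc K hK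
    have h3 := congrArg (d y) hcK
    rw [dual_sum d1 d0 hy, map_add, map_nsmul, nsmul_eq_mul] at h3
    have h4 := hc0 y
    have h5 : (d y x) ≤ ((d y x).natAbs : ℤ) := Int.le_natAbs
    have h6 : ((d y x).natAbs : ℤ) < K := by exact_mod_cast hlt
    nlinarith
  -- The difference of two of the points `K • p + x` is a nonzero multiple of `p` in the span of
  -- `t`.
  have hpt : p = ∑ y ∈ t, d y p • y := by
    obtain ⟨K, hK, -⟩ := hinf'.exists_gt 0
    obtain ⟨K', hK', hlt⟩ := hinf'.exists_gt K
    obtain ⟨c, hc0, hcK⟩ := hc K hK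
    obtain ⟨c', hc0', hcK'⟩ := hc K' hK'
    have h3 : ∀ y ∈ t, ((K' : ℤ) - K) * d y p = c' y - c y := fun y hy => by
      have e1 := congrArg (d y) hcK
      have e2 := congrArg (d y) hcK'
      rw [dual_sum d1 d0 hy, map_add, map_nsmul, nsmul_eq_mul] at e1 e2
      rw [← e1, ← e2]; ring
    have h4 : ((K' : ℤ) - K) • p = ((K' : ℤ) - K) • ∑ y ∈ t, d y p • y := by
      have h6 : ((K' : ℤ) - K) • ∑ y ∈ t, d y p • y = ∑ y ∈ t, (c' y • y - c y • y) := by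
        rw [Finset.smul_sum]
        exact Finset.sum_congr rfl fun y hy => by rw [smul_smul, h3 y hy, sub_smul]
      rw [h6, Finset.sum_sub_distrib, ← hcK, ← hcK', sub_smul, natCast_zsmul, natCast_zsmul]
      abel
    have h5 : ((K' : ℤ) - K) ≠ 0 := by omega
    exact smul_right_injective N h5 h4
  -- Now `p` lies in both cones, hence in their common face; as all its coordinates along `s` are
  -- `1`, this face is all of `s`.
  have hst : s ⊆ t := by
    have m1 : toNQ N p ∈ cone (t : Set N) := by
      rw [hpt]; exact sum_zsmul_mem_cone hdp
    have m2 : toNQ N p ∈ cone (s : Set N) := by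
      have := sum_zsmul_mem_cone (s := s) (c := fun _ => 1) (fun _ _ => zero_le_one)
      simpa only [one_smul] using this
    have m3 : toNQ N p ∈ cone ((s ∩ t : Finset N) : Set N) := by
      rw [Finset.coe_inter, ← X.inter hs ht]; exact ⟨m2, m1⟩
    obtain ⟨c, -, hc2⟩ := (X.mem_cone_iff_int (X.face_mem hs Finset.inter_subset_left)).1 m3
    obtain ⟨e, e1, e0⟩ := X.exists_dual hs
    intro y hy
    by_contra hyt
    have a1 : e y p = 1 := by
      have := dual_sum e1 e0 hy (fun _ => 1)
      simpa only [one_smul] using this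
    have a2 : e y p = 0 := by
      rw [hc2, map_sum]
      refine Finset.sum_eq_zero fun z hz => ?_
      have hz' := Finset.mem_inter.1 hz
      have : y ≠ z := by rintro rfl; exact hyt hz'.2
      simp [e0 y hy z hz'.1 this]
    omega
  obtain ⟨K, hK, -⟩ := hinf'.exists_gt 0
  obtain ⟨c, hc0, hcK⟩ := hc K hK
  exact ⟨t, ht, hst, K, c, hc0, hcK⟩

/-- The maximal cones of a complete fan: their generators form a basis of the lattice. -/
def SmoothFan.IsFacet (X : SmoothFan N) (s : Finset N) : Prop :=
  s ∈ X.cones ∧ Submodule.span ℤ (s : Set N) = ⊤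

/-- For an inclusion-maximal cone the cone produced by `exists_superset` is the cone itself, so
every lattice vector lies in its integral span. -/
lemma SmoothFan.IsComplete.exists_facet_superset [Module.Free ℤ N] (hX : X.IsComplete)
    {s : Finset N} (hs : s ∈ X.cones) : ∃ t, X.IsFacet t ∧ s ⊆ t := by
  obtain ⟨t, hst, hmax⟩ := X.finite_cones.exists_le_maximal hs
  refine ⟨t, ⟨hmax.1, ?_⟩, hst⟩
  rw [eq_top_iff]
  rintro x -
  obtain ⟨t', ht', htt', K, c, -, h⟩ := hX.exists_superset hmax.1 x
  have heq : t' = t := Finset.Subset.antisymm (hmax.2 ht' htt') htt'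
  rw [heq] at h
  have hx : x = ∑ y ∈ t, c y • y - K • ∑ y ∈ t, y := by rw [← h]; abel
  rw [hx]
  refine Submodule.sub_mem _ (Submodule.sum_mem _ fun y hy => ?_)
    (Submodule.smul_of_tower_mem _ _ (Submodule.sum_mem _ fun y hy => ?_))
  · exact Submodule.smul_mem _ _ (Submodule.subset_span hy)
  · exact Submodule.subset_span hy

end Lattice
end Toric

namespace Toric

/-! ### Coordinates and level with respect to a maximal cone; crossing walls. -/

section Facets

variable {N : Type} [AddCommGroup N]

open Classical in
/-- The coordinates of a lattice vector with respect to the basis `s` of the lattice. -/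
noncomputable def co (s : Finset N) (x : N) : N →ₗ[ℤ] ℤ :=
  if h : ∃ d : N → N →ₗ[ℤ] ℤ, ((∀ x ∈ s, d x x = 1) ∧ ∀ x ∈ s, ∀ y ∈ s, x ≠ y → d x y = 0) ∧
    ∀ v, ∑ x ∈ s, d x v • x = v then h.choose x else 0

/-- The linear form that is `1` on the elements of the basis `s`. -/
noncomputable def level (s : Finset N) : N →ₗ[ℤ] ℤ := ∑ x ∈ s, co s x

lemma level_apply (s : Finset N) (v : N) : level s v = ∑ x ∈ s, co s x v := by
  simp [level]

namespace SmoothFan.IsFacet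

variable {X : SmoothFan N} {s : Finset N}

lemma ext {M : Type*} [AddCommGroup M] (hs : X.IsFacet s) {φ ψ : N →ₗ[ℤ] M}
    (h : ∀ x ∈ s, φ x = ψ x) : φ = ψ :=
  LinearMap.ext_on hs.2 h

lemma co_spec (hs : X.IsFacet s) :
    ((∀ x ∈ s, co s x x = 1) ∧ ∀ x ∈ s, ∀ y ∈ s, x ≠ y → co s x y = 0) ∧
      ∀ v, ∑ x ∈ s, co s x v • x = v := by
  have h : ∃ d : N → N →ₗ[ℤ] ℤ, ((∀ x ∈ s, d x x = 1) ∧ ∀ x ∈ s, ∀ y ∈ s, x ≠ y → d x y = 0) ∧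
      ∀ v, ∑ x ∈ s, d x v • x = v := by
    obtain ⟨d, h1, h0⟩ := X.exists_dual hs.1
    refine ⟨d, ⟨h1, h0⟩, fun v => ?_⟩
    have : (∑ x ∈ s, (d x).smulRight x : N →ₗ[ℤ] N) = LinearMap.id := by
      refine hs.ext fun y hy => ?_
      rw [LinearMap.sum_apply, Finset.sum_eq_single_of_mem y hy]
      · simp [h1 y hy]
      · intro x hx hxy
        simp [h0 x hx y hy hxy]
    simpa using LinearMap.congr_fun this v
  have hco : ∀ x, co s x = h.choose x := fun x => by rw [co, dif_pos h]
  simp only [hco]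
  exact h.choose_spec

lemma co_self (hs : X.IsFacet s) {x : N} (hx : x ∈ s) : co s x x = 1 := hs.co_spec.1.1 x hx

lemma co_ne (hs : X.IsFacet s) {x y : N} (hx : x ∈ s) (hy : y ∈ s) (h : x ≠ y) : co s x y = 0 :=
  hs.co_spec.1.2 x hx y hy h

lemma sum_co (hs : X.IsFacet s) (v : N) : ∑ x ∈ s, co s x v • x = v := hs.co_spec.2 v

lemma co_sum (hs : X.IsFacet s) {x : N} (hx : x ∈ s) (c : N → ℤ) :
    co s x (∑ y ∈ s, c y • y) = c x :=
  dual_sum hs.co_spec.1.1 hs.co_spec.1.2 hx c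

lemma eq_zero_of_co (hs : X.IsFacet s) {v : N} (h : ∀ x ∈ s, co s x v = 0) : v = 0 := by
  rw [← hs.sum_co v]
  exact Finset.sum_eq_zero fun x hx => by rw [h x hx, zero_smul]

lemma eq_of_co (hs : X.IsFacet s) {v w : N} (h : ∀ x ∈ s, co s x v = co s x w) : v = w :=
  sub_eq_zero.1 (hs.eq_zero_of_co fun x hx => by rw [map_sub, h x hx, sub_self])

lemma eq_co (hs : X.IsFacet s) {x : N} (hx : x ∈ s) {φ : N →ₗ[ℤ] ℤ} (h1 : φ x = 1)
    (h0 : ∀ y ∈ s, y ≠ x → φ y = 0) : φ = co s x := by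
  refine hs.ext fun y hy => ?_
  by_cases h : y = x
  · rw [h, h1, hs.co_self hx]
  · rw [h0 y hy h, hs.co_ne hx hy (Ne.symm h)]

lemma level_self (hs : X.IsFacet s) {x : N} (hx : x ∈ s) : level s x = 1 := by
  rw [level_apply, Finset.sum_eq_single_of_mem x hx, hs.co_self hx]
  intro y hy hyx
  exact hs.co_ne hy hx hyx

/-- The generators of a maximal cone, as a basis of the lattice. -/
noncomputable def basis (hs : X.IsFacet s) : Module.Basis s ℤ N :=
  Module.Basis.mk (v := fun x : s => (x : N))
    (by
      rw [linearIndependent_iff']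
      intro t g hg x hx
      have h := congrArg (co s x.1) hg
      rw [map_sum, map_zero, Finset.sum_eq_single_of_mem x hx] at h
      · simpa [hs.co_self x.2] using h
      · intro y _ hyx
        rw [map_smul, hs.co_ne x.2 y.2 (fun h => hyx (Subtype.ext h.symm)), smul_zero])
    (by
      rw [show Set.range (fun x : s => (x : N)) = (s : Set N) by simp]
      exact hs.2.ge)

@[simp] lemma basis_apply (hs : X.IsFacet s) (x : s) : hs.basis x = x := by
  simp [basis]

lemma card_eq (hs : X.IsFacet s) : s.card = Module.finrank ℤ N := by
  rw [Module.finrank_eq_card_basis hs.basis, Fintype.card_coe]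

lemma co_eq_of_mem (hs : X.IsFacet s) {x y : N} (hx : x ∈ s) (hy : y ∈ s) :
    0 ≤ co s x y := by
  by_cases h : x = y
  · subst h; rw [hs.co_self hx]; exact zero_le_one
  · rw [hs.co_ne hx hy h]

lemma notMem_of_co_neg (hs : X.IsFacet s) {x y : N} (hx : x ∈ s) (h : co s x y < 0) : y ∉ s :=
  fun hy => absurd (hs.co_eq_of_mem hx hy) (not_le.2 h)

lemma exists_neg {v : N} (hv : level s v = 0) {x : N} (hx : x ∈ s)
    (h : 0 < co s x v) : ∃ y ∈ s, co s y v < 0 := by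
  by_contra! hcon
  rw [level_apply] at hv
  have := (Finset.sum_eq_zero_iff_of_nonneg hcon).1 hv x hx
  omega

lemma exists_neg_of_ne (hs : X.IsFacet s) {v : N} (hv : level s v = 0) (h : v ≠ 0) :
    ∃ y ∈ s, co s y v < 0 := by
  by_contra! hcon
  rw [level_apply] at hv
  exact h (hs.eq_zero_of_co fun x hx => (Finset.sum_eq_zero_iff_of_nonneg hcon).1 hv x hx)

variable [DecidableEq N]

/-- Change of basis when `w`, with coordinate `-1` at `x`, replaces `x`. Each of the three formulas
is checked on the new basis. -/
lemma swap_co_new {x w : N} (hs : X.IsFacet s) (hx : x ∈ s)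
    (hs' : X.IsFacet (insert w (s.erase x))) (hw : co s x w = -1) (v : N) :
    co (insert w (s.erase x)) w v = -co s x v := by
  have : -co s x = co (insert w (s.erase x)) w := by
    refine hs'.eq_co (Finset.mem_insert_self _ _) (by simp [hw]) fun y hy hyw => ?_
    have hy' := Finset.mem_erase.1 (Finset.mem_of_mem_insert_of_ne hy hyw)
    simp [hs.co_ne hx hy'.2 hy'.1.symm]
  rw [← this]; rfl

lemma swap_co {x w : N} (hs : X.IsFacet s) (hx : x ∈ s)
    (hs' : X.IsFacet (insert w (s.erase x))) (hw : co s x w = -1) {y : N} (hy : y ∈ s)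
    (hyx : y ≠ x) (v : N) :
    co (insert w (s.erase x)) y v = co s y v + co s x v * co s y w := by
  have hws := hs.notMem_of_co_neg hx (by rw [hw]; norm_num)
  have : co s y + (co s y w) • co s x = co (insert w (s.erase x)) y := by
    refine hs'.eq_co (Finset.mem_insert_of_mem (Finset.mem_erase.2 ⟨hyx, hy⟩)) ?_ fun z hz hzy => ?_
    · simp [hs.co_self hy, hs.co_ne hx hy hyx.symm]
    · rcases Finset.mem_insert.1 hz with rfl | hz
      · simp [hw]
      · have hz' := Finset.mem_erase.1 hz
        simp [hs.co_ne hx hz'.2 hz'.1.symm, hs.co_ne hy hz'.2 hzy.symm]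
  rw [← this]
  simp [mul_comm]

/-- In the Fano case `level s w ≤ 0`, so the factor `level s w - 1` is negative and every vector
beyond the wall gains level when the wall is crossed. -/
lemma swap_level {x w : N} (hs : X.IsFacet s) (hx : x ∈ s)
    (hs' : X.IsFacet (insert w (s.erase x))) (hw : co s x w = -1) (v : N) :
    level (insert w (s.erase x)) v = level s v + (level s w - 1) * co s x v := by
  have : level s + (level s w - 1) • co s x = level (insert w (s.erase x)) := by
    refine hs'.ext fun y hy => ?_
    rw [hs'.level_self hy]
    rcases Finset.mem_insert.1 hy with rfl | hy
    · simp [hw]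
    · have hy' := Finset.mem_erase.1 hy
      simp [hs.co_ne hx hy'.2 hy'.1.symm, hs.level_self hy'.2]
  rw [← this]
  simp

end SmoothFan.IsFacet

variable {X : SmoothFan N} {s : Finset N}

/-- Every wall of a maximal cone is a wall of another maximal cone, on the other side. -/
lemma SmoothFan.IsComplete.exists_neighbor [Module.Free ℤ N] [DecidableEq N] (hX : X.IsComplete)
    (hs : X.IsFacet s) {x : N} (hx : x ∈ s) :
    ∃ w, co s x w = -1 ∧ X.IsFacet (insert w (s.erase x)) := by
  -- Start inside the wall and move in the direction `-x`: the cone reached contains the wall and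
  -- lies on its other side.
  obtain ⟨t₀, ht₀, hst₀, K, c₀, hc₀, heq₀⟩ :=
    hX.exists_superset (X.face_mem hs.1 (Finset.erase_subset x s)) (-x)
  obtain ⟨t, ht, htt⟩ := hX.exists_facet_superset ht₀
  have hst := hst₀.trans htt
  have hmem : toNQ N (K • (∑ y ∈ s.erase x, y) + -x) ∈ cone (t : Set N) := by
    rw [heq₀]
    refine Submodule.span_mono (Set.image_mono (Finset.coe_subset.2 htt)) ?_
    exact sum_zsmul_mem_cone fun y _ => hc₀ y
  obtain ⟨c, hc, heq⟩ := (X.mem_cone_iff_int ht.1).1 hmem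
  have hco := congrArg (co s x) heq
  have hzero : ∀ y ∈ s.erase x, co s x y = 0 := fun y hy =>
    hs.co_ne hx (Finset.mem_erase.1 hy).2 (Finset.mem_erase.1 hy).1.symm
  have hlhs : co s x (K • (∑ y ∈ s.erase x, y) + -x) = -1 := by
    rw [map_add, map_nsmul, map_sum, Finset.sum_eq_zero hzero, map_neg, hs.co_self hx]; simp
  rw [hlhs] at hco
  have hcard : (t \ s.erase x).card = 1 := by
    rw [Finset.card_sdiff_of_subset hst, ht.card_eq, Finset.card_erase_of_mem hx, hs.card_eq]
    have : 0 < Module.finrank ℤ N := by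
      rw [← hs.card_eq]; exact Finset.card_pos.2 ⟨x, hx⟩
    omega
  obtain ⟨w, hw⟩ := Finset.card_eq_one.1 hcard
  have hwt : w ∈ t ∧ w ∉ s.erase x := Finset.mem_sdiff.1 (hw ▸ Finset.mem_singleton_self w)
  have htins : t = insert w (s.erase x) := by
    ext y
    constructor
    · intro hy
      by_cases h : y ∈ s.erase x
      · exact Finset.mem_insert_of_mem h
      · have : y ∈ t \ s.erase x := Finset.mem_sdiff.2 ⟨hy, h⟩
        rw [hw, Finset.mem_singleton] at this
        simp [this]
    · intro hy
      rcases Finset.mem_insert.1 hy with rfl | hy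
      · exact hwt.1
      · exact hst hy
  refine ⟨w, ?_, htins ▸ ht⟩
  rw [htins, Finset.sum_insert hwt.2, map_add, map_sum, Finset.sum_eq_zero (fun y hy => by
    rw [map_smul, hzero y hy, smul_zero]), map_smul, add_zero, smul_eq_mul] at hco
  have h2 := hc w
  -- The equation `-1 = c w * co s x w` with `c w ≥ 0` forces `c w = 1`.
  have h3 : c w ∣ 1 := ⟨-co s x w, by linarith⟩
  have h4 : c w = 1 := Int.eq_one_of_dvd_one h2 h3
  rw [h4] at hco
  linarith

/-- The supporting form of a maximal cone is `level s`, an integral form, so `< 1` improves to `≤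
0`. All rigidity of Fano fans used below comes from this gap. -/
lemma SmoothFan.IsFano.level_nonpos (hX : X.IsFano) (hs : X.IsFacet s)
    {v : N} (hv : v ∈ X.gens) (hvs : v ∉ s) : level s v ≤ 0 := by
  obtain ⟨f, h1, h2⟩ := (X.isFano_iff.1 hX).2 s hs.1
  have : f = ratForm (level s) := hs.ext fun x hx => by simp [h1 x hx, hs.level_self hx]
  have h3 := h2 v hv hvs
  rw [this, ratForm_apply] at h3
  have h4 : level s v < 1 := by exact_mod_cast h3
  omega

lemma SmoothFan.IsFano.level_le_one (hX : X.IsFano) (hs : X.IsFacet s)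
    {v : N} (hv : v ∈ X.gens) : level s v ≤ 1 := by
  by_cases h : v ∈ s
  · exact (hs.level_self h).le
  · exact (hX.level_nonpos hs hv h).trans zero_le_one

lemma SmoothFan.IsFano.mem_of_level (hX : X.IsFano) (hs : X.IsFacet s)
    {v : N} (hv : v ∈ X.gens) (h : 0 < level s v) : v ∈ s := by
  by_contra hvs
  exact absurd (hX.level_nonpos hs hv hvs) (not_le.2 h)

/-- A generator on level `0` that is on the other side of a wall spans with the wall the
neighboring cone. -/
lemma SmoothFan.IsFano.swap_of_level_zero [Module.Free ℤ N] [DecidableEq N] (hX : X.IsFano)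
    (hs : X.IsFacet s) {v : N} (hv : v ∈ X.gens) (h0 : level s v = 0) {x : N} (hx : x ∈ s)
    (hneg : co s x v < 0) : co s x v = -1 ∧ X.IsFacet (insert v (s.erase x)) := by
  obtain ⟨w, hw, hs'⟩ := hX.1.exists_neighbor hs hx
  have hws := hs.notMem_of_co_neg hx (by rw [hw]; norm_num)
  have hwg : w ∈ X.gens := X.mem_gens_of_mem hs'.1 (Finset.mem_insert_self _ _)
  have hlw := hX.level_nonpos hs hwg hws
  have hl := hs.swap_level hx hs' hw v
  rw [h0] at hl
  -- A positive level in the neighboring cone makes `v` one of its generators, and `v ∉ s` leaves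
  -- only `v = w`.
  have hpos : 0 < level (insert w (s.erase x)) v := by rw [hl]; nlinarith
  have hmem := hX.mem_of_level hs' hv hpos
  have hvs := hs.notMem_of_co_neg hx hneg
  rcases Finset.mem_insert.1 hmem with rfl | h
  · exact ⟨hw, hs'⟩
  · exact absurd (Finset.mem_erase.1 h).2 hvs

/-- After the exchange of `x` for `v`, the generator `v'` has positive level, so it belongs to the
new cone; its only element not in `s` is `v`. -/
lemma SmoothFan.IsFano.eq_of_level_zero [Module.Free ℤ N] (hX : X.IsFano)
    (hs : X.IsFacet s) {v v' : N} (hv : v ∈ X.gens) (h0 : level s v = 0) (hv' : v' ∈ X.gens)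
    (h0' : level s v' = 0) {x : N} (hx : x ∈ s) (hneg : co s x v < 0) (hneg' : co s x v' < 0) :
    v = v' := by
  classical
  obtain ⟨h1, hf⟩ := hX.swap_of_level_zero hs hv h0 hx hneg
  have hl := hs.swap_level hx hf h1 v'
  rw [h0, h0'] at hl
  have := hX.mem_of_level hf hv' (by rw [hl]; linarith)
  rcases Finset.mem_insert.1 this with h | h
  · exact h.symm
  · exact absurd (Finset.mem_erase.1 h).2 (hs.notMem_of_co_neg hx hneg')

lemma SmoothFan.IsFano.neg_one_le_co [Module.Free ℤ N] (hX : X.IsFano)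
    (hs : X.IsFacet s) {v : N} (hv : v ∈ X.gens) (h0 : level s v = 0) {x : N} (hx : x ∈ s) :
    -1 ≤ co s x v := by
  classical
  by_contra h
  have := (hX.swap_of_level_zero hs hv h0 hx (by omega)).1
  omega

/-- The form `level s` after passing to a neighboring cone through a generator of level `0`. -/
lemma SmoothFan.IsFacet.swap_level_zero [DecidableEq N] {x w : N} (hs : X.IsFacet s) (hx : x ∈ s)
    (hs' : X.IsFacet (insert w (s.erase x))) (hw : co s x w = -1) (h0 : level s w = 0) (v : N) :
    level (insert w (s.erase x)) v = level s v - co s x v := by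
  rw [hs.swap_level hx hs' hw, h0]; ring

end Facets
end Toric

namespace Toric

/-! ### Symmetric generators, and maximal cones adapted to their span `H`. -/

section Symmetric

variable {N : Type} [AddCommGroup N]

/-- `y` is one of the centrally symmetric generators. -/
def SmoothFan.IsSym (X : SmoothFan N) (y : N) : Prop := y ∈ X.gens ∧ -y ∈ X.gens

/-- The lattice `H ∩ N`. -/
def SmoothFan.symLattice (X : SmoothFan N) : Submodule ℤ N :=
  (X.symmSpan.restrictScalars ℤ).comap (toNQ N)

variable {X : SmoothFan N} {s : Finset N}

lemma SmoothFan.IsSym.neg {y : N} (h : X.IsSym y) : X.IsSym (-y) := ⟨h.2, by simpa using h.1⟩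

lemma SmoothFan.IsSym.mem_symLattice {y : N} (h : X.IsSym y) : y ∈ X.symLattice :=
  Submodule.subset_span ⟨y, h, rfl⟩

lemma SmoothFan.eq_zero_of_mem_symLattice {u : N →ₗ[ℤ] ℤ} (hu : ∀ y, X.IsSym y → u y = 0)
    {v : N} (hv : v ∈ X.symLattice) : u v = 0 := by
  have : X.symmSpan ≤ LinearMap.ker (extendForm (ratForm u)) := by
    refine Submodule.span_le.2 ?_
    rintro _ ⟨y, hy, rfl⟩
    simp [hu y hy]
  have h2 := this hv
  rw [LinearMap.mem_ker, extendForm_toNQ] at h2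
  simpa using h2

namespace SmoothFan.IsFano

variable [Module.Free ℤ N] (hX : X.IsFano) (hs : X.IsFacet s)
include hX hs

omit [Module.Free ℤ N] in
lemma sym_cases {y : N} (hy : X.IsSym y) : y ∈ s ∨ -y ∈ s ∨ level s y = 0 := by
  by_cases h1 : y ∈ s
  · exact Or.inl h1
  by_cases h2 : -y ∈ s
  · exact Or.inr (Or.inl h2)
  have a := hX.level_nonpos hs hy.1 h1
  have b := hX.level_nonpos hs hy.2 h2
  rw [map_neg] at b
  exact Or.inr (Or.inr (by omega))

omit [Module.Free ℤ N] in
lemma sym_level_zero {y : N} (hy : X.IsSym y) {x : N} (hx : x ∈ s) (hxs : ¬ X.IsSym x)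
    (h : co s x y ≠ 0) : level s y = 0 := by
  rcases hX.sym_cases hs hy with h1 | h1 | h1
  · exfalso
    by_cases hxy : x = y
    · exact hxs (hxy ▸ hy)
    · exact h (hs.co_ne hx h1 hxy)
  · exfalso
    by_cases hxy : x = -y
    · exact hxs (hxy ▸ hy.neg)
    · have := hs.co_ne hx h1 hxy
      rw [map_neg] at this
      exact h (neg_eq_zero.1 this)
  · exact h1

lemma sym_co {y : N} (hy : X.IsSym y) (h0 : level s y = 0) {x : N} (hx : x ∈ s)
    (h : co s x y ≠ 0) : co s x y = 1 ∨ co s x y = -1 := by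
  have a := hX.neg_one_le_co hs hy.1 h0 hx
  have b := hX.neg_one_le_co hs hy.2 (by rw [map_neg, h0, neg_zero]) hx
  rw [map_neg] at b
  omega

/-- One of `±y` and one of `±y'` are negative at `x`, and `eq_of_level_zero` identifies these two.
-/
lemma sym_unique {y y' : N} (hy : X.IsSym y) (h0 : level s y = 0) (hy' : X.IsSym y')
    (h0' : level s y' = 0) {x : N} (hx : x ∈ s) (h : co s x y ≠ 0) (h' : co s x y' ≠ 0) :
    y' = y ∨ y' = -y := by
  rcases hX.sym_co hs hy h0 hx h with a | a <;> rcases hX.sym_co hs hy' h0' hx h' with b | b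
  · left
    have := hX.eq_of_level_zero hs hy.2 (by rw [map_neg, h0, neg_zero]) hy'.2
      (by rw [map_neg, h0', neg_zero]) hx (by rw [map_neg, a]; norm_num)
      (by rw [map_neg, b]; norm_num)
    exact (neg_injective this).symm
  · right
    exact (hX.eq_of_level_zero hs hy.2 (by rw [map_neg, h0, neg_zero]) hy'.1 h0' hx
      (by rw [map_neg, a]; norm_num) (by rw [b]; norm_num)).symm
  · right
    have := hX.eq_of_level_zero hs hy.1 h0 hy'.2 (by rw [map_neg, h0', neg_zero]) hx
      (by rw [a]; norm_num) (by rw [map_neg, b]; norm_num)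
    rw [this, neg_neg]
  · left
    exact (hX.eq_of_level_zero hs hy.1 h0 hy'.1 h0' hx (by rw [a]; norm_num)
      (by rw [b]; norm_num)).symm

/-- The difference of the two sides is a linear form in `v`. It vanishes at `±y` because the squares
of the signs agree, and at every other symmetric generator because both coordinates are zero there
by `sym_unique`. So it vanishes on `H`. -/
lemma co_mul_eq {y : N} (hy : X.IsSym y) {x x' : N} (hx : x ∈ s) (hxs : ¬ X.IsSym x)
    (hx' : x' ∈ s) (hxs' : ¬ X.IsSym x') (h : co s x y ≠ 0) (h' : co s x' y ≠ 0) {v : N}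
    (hv : v ∈ X.symLattice) : co s x v * co s x y = co s x' v * co s x' y := by
  have h0 := hX.sym_level_zero hs hy hx hxs h
  have key : ∀ z, X.IsSym z → (co s x y • co s x - co s x' y • co s x') z = 0 := by
    intro z hz
    have hsq : co s x y * co s x y = co s x' y * co s x' y := by
      rcases hX.sym_co hs hy h0 hx h with a | a <;>
      rcases hX.sym_co hs hy h0 hx' h' with b | b <;> rw [a, b] <;> norm_num
    have hpm : (z = y ∨ z = -y) ∨ (co s x z = 0 ∧ co s x' z = 0) := by
      by_cases a : co s x z = 0
      · by_cases b : co s x' z = 0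
        · exact Or.inr ⟨a, b⟩
        · exact Or.inl (hX.sym_unique hs hy h0 hz (hX.sym_level_zero hs hz hx' hxs' b) hx' h' b)
      · exact Or.inl (hX.sym_unique hs hy h0 hz (hX.sym_level_zero hs hz hx hxs a) hx h a)
    rcases hpm with (rfl | rfl) | ⟨a, b⟩
    · simp [hsq]
    · simp [hsq]
    · simp [a, b]
  have := SmoothFan.eq_zero_of_mem_symLattice key hv
  simp only [LinearMap.sub_apply, LinearMap.smul_apply, smul_eq_mul] at this
  linarith

omit hs in
/-- For every `σ` in `H` there is a maximal cone `s` whose symmetric generators are a basis of `H`,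
such that `σ` has nonnegative level with respect to `s`. -/
theorem exists_facet_level_nonneg {σ : N} (hσ : σ ∈ X.symLattice) :
    ∃ s, X.IsFacet s ∧ (∀ x ∈ s, ¬ X.IsSym x → ∀ v ∈ X.symLattice, co s x v = 0) ∧
      0 ≤ level s σ := by
  classical
  -- Induction on the number of non-symmetric elements of `s`. The invariant bounds the coordinates
  -- of `σ`: those at non-symmetric elements are nonnegative, and those at symmetric elements have a
  -- nonnegative sum.
  have main : ∀ (n : ℕ) (s : Finset N), X.IsFacet s → (s.filter fun x => ¬ X.IsSym x).card = n →
      0 ≤ ∑ x ∈ s.filter X.IsSym, co s x σ → (∀ x ∈ s, ¬ X.IsSym x → 0 ≤ co s x σ) →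
      ∃ s, X.IsFacet s ∧ (∀ x ∈ s, ¬ X.IsSym x → ∀ v ∈ X.symLattice, co s x v = 0) ∧
        0 ≤ level s σ := by
    intro n
    induction n with
    | zero =>
      intro s hs hcard hsum hpos
      have hemp := Finset.card_eq_zero.1 hcard
      have hsym : ∀ x ∈ s, X.IsSym x := fun x hx => by
        by_contra h
        have : x ∈ s.filter fun x => ¬ X.IsSym x := Finset.mem_filter.2 ⟨hx, h⟩
        rw [hemp] at this
        exact absurd this (Finset.notMem_empty _)
      refine ⟨s, hs, fun x hx h => absurd (hsym x hx) h, ?_⟩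
      rwa [Finset.filter_true_of_mem hsym, ← level_apply] at hsum
    | succ n ih =>
      intro s hs hcard hsum hpos
      by_cases hall : ∀ x ∈ s, ¬ X.IsSym x → ∀ y, X.IsSym y → co s x y = 0
      · have hz : ∀ x ∈ s, ¬ X.IsSym x → ∀ v ∈ X.symLattice, co s x v = 0 := fun x hx hxs v hv =>
          SmoothFan.eq_zero_of_mem_symLattice (hall x hx hxs) hv
        refine ⟨s, hs, hz, ?_⟩
        rw [level_apply, ← Finset.sum_filter_add_sum_filter_not s X.IsSym]
        rw [Finset.sum_eq_zero (s := s.filter fun x => ¬ X.IsSym x) (fun x hx =>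
          hz x (Finset.mem_filter.1 hx).1 (Finset.mem_filter.1 hx).2 σ hσ), add_zero]
        exact hsum
      · push Not at hall
        obtain ⟨x, hx, hxs, y₀, hy₀, hne₀⟩ := hall
        obtain ⟨y, hy, hxy⟩ : ∃ y, X.IsSym y ∧ co s x y = -1 := by
          rcases hX.sym_co hs hy₀ (hX.sym_level_zero hs hy₀ hx hxs hne₀) hx hne₀ with h | h
          · exact ⟨-y₀, hy₀.neg, by rw [map_neg, h]⟩
          · exact ⟨y₀, hy₀, h⟩
        have hne : co s x y ≠ 0 := by rw [hxy]; norm_num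
        have hy0 := hX.sym_level_zero hs hy hx hxs hne
        obtain ⟨-, hs'⟩ := hX.swap_of_level_zero hs hy.1 hy0 hx (by rw [hxy]; norm_num)
        have hys := hs.notMem_of_co_neg hx (y := y) (by rw [hxy]; norm_num)
        -- On `H` the coordinates at the non-symmetric elements in the support of `y` agree up to
        -- sign.
        have hratio : ∀ z ∈ s, ¬ X.IsSym z → co s z y ≠ 0 →
            -co s x σ = co s z σ * co s z y := fun z hz hzs hzy => by
          rw [← hX.co_mul_eq hs hy hx hxs hz hzs hne hzy hσ, hxy]; ring
        have hxσ := hpos x hx hxs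
        have hfil : (insert y (s.erase x)).filter X.IsSym = insert y (s.filter X.IsSym) := by
          rw [Finset.filter_insert, if_pos hy, Finset.filter_erase, Finset.erase_eq_of_notMem]
          simp [hxs]
        have hfil' : ((insert y (s.erase x)).filter fun x => ¬ X.IsSym x) =
            (s.filter fun x => ¬ X.IsSym x).erase x := by
          rw [Finset.filter_insert, if_neg (not_not.2 hy), Finset.filter_erase]
        have hxmem : x ∈ s.filter fun x => ¬ X.IsSym x := Finset.mem_filter.2 ⟨hx, hxs⟩
        refine ih _ hs' ?_ ?_ ?_
        · rw [hfil', Finset.card_erase_of_mem hxmem, hcard]; rfl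
        · rw [hfil, Finset.sum_insert (fun h => hys (Finset.mem_filter.1 h).1),
            hs.swap_co_new hx hs' hxy]
          have e1 : ∑ z ∈ s.filter X.IsSym, co (insert y (s.erase x)) z σ =
              ∑ z ∈ s.filter X.IsSym, co s z σ + co s x σ * ∑ z ∈ s.filter X.IsSym, co s z y := by
            rw [Finset.mul_sum, ← Finset.sum_add_distrib]
            refine Finset.sum_congr rfl fun z hz => ?_
            have hz' := Finset.mem_filter.1 hz
            exact hs.swap_co hx hs' hxy hz'.1 (by rintro rfl; exact hxs hz'.2) σ
          -- By level zero, the symmetric coordinates of `y` sum to `1` minus the remaining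
          -- non-symmetric ones. The exchange therefore changes the sum for `σ` by `-co s x σ` times
          -- the latter, and `e3` gives this the right sign.
          have e2 : ∑ z ∈ s.filter X.IsSym, co s z y =
              1 - ∑ z ∈ (s.filter fun x => ¬ X.IsSym x).erase x, co s z y := by
            have := hy0
            rw [level_apply, ← Finset.sum_filter_add_sum_filter_not s X.IsSym,
              ← Finset.add_sum_erase _ _ hxmem, hxy] at this
            linarith
          have e3 : co s x σ * ∑ z ∈ (s.filter fun x => ¬ X.IsSym x).erase x, co s z y ≤ 0 := by
            rw [Finset.mul_sum]
            refine Finset.sum_nonpos fun z hz => ?_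
            have hz' := Finset.mem_filter.1 (Finset.mem_erase.1 hz).2
            by_cases hzy : co s z y = 0
            · simp [hzy]
            · have h1 := hratio z hz'.1 hz'.2 hzy
              have h2 := hpos z hz'.1 hz'.2
              rcases lt_or_gt_of_ne hzy with h3 | h3
              · nlinarith
              · have h4 : co s x σ = 0 := by nlinarith
                rw [h4, zero_mul]
          rw [e1, e2]
          linarith
        · intro z hz hzs
          rcases Finset.mem_insert.1 hz with rfl | hz
          · exact absurd hy hzs
          · have hz' := Finset.mem_erase.1 hz
            rw [hs.swap_co hx hs' hxy hz'.2 hz'.1]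
            have h2 := hpos z hz'.2 hzs
            -- If `co s z y = -1`, then `hratio` gives `co s z σ = co s x σ`, and the new coordinate
            -- is exactly `0`.
            rcases lt_or_ge (co s z y) 0 with h3 | h3
            · have h4 := hratio z hz'.2 hzs h3.ne
              rcases hX.sym_co hs hy hy0 hz'.2 h3.ne with h5 | h5
              · omega
              · rw [h5] at h4 ⊢
                linarith
            · positivity
  obtain ⟨t, ht, hσt⟩ := hX.1 (toNQ N σ)
  obtain ⟨s, hs, hts⟩ := hX.1.exists_facet_superset ht
  have hσs : toNQ N σ ∈ cone (s : Set N) :=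
    Submodule.span_mono (Set.image_mono (Finset.coe_subset.2 hts)) hσt
  obtain ⟨c, hc, hσc⟩ := (X.mem_cone_iff_int hs.1).1 hσs
  have hco : ∀ x ∈ s, 0 ≤ co s x σ := fun x hx => by
    rw [hσc, hs.co_sum hx]; exact hc x
  exact main _ s hs rfl (Finset.sum_nonneg fun x hx => hco x (Finset.mem_filter.1 hx).1)
    fun x hx _ => hco x hx

end SmoothFan.IsFano

/-- A maximal cone `s` is adapted to the subspace `H` if its symmetric generators are a basis of
`H ∩ N` and all generators in `H` other than these and their negatives have level zero. -/
structure SmoothFan.IsAdapted (X : SmoothFan N) (s : Finset N) : Prop where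
  facet : X.IsFacet s
  co_eq_zero : ∀ x ∈ s, ¬ X.IsSym x → ∀ v ∈ X.symLattice, co s x v = 0
  level_eq_zero : ∀ v ∈ X.gens, v ∈ X.symLattice → v ∈ s ∨ -v ∈ s ∨ level s v = 0

lemma SmoothFan.IsAdapted.isSym (h : X.IsAdapted s) {x : N} (hx : x ∈ s)
    (hxH : x ∈ X.symLattice) : X.IsSym x := by
  by_contra hxs
  have := h.co_eq_zero x hx hxs x hxH
  rw [h.facet.co_self hx] at this
  exact one_ne_zero this

/-- Take for `σ` the sum of all generators in `H`. The symmetric elements of `s` cancel against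
their negatives, and all other generators in `H` have level at most `0`; since their levels add up
to `level s σ ≥ 0`, all of them vanish. -/
theorem SmoothFan.IsFano.exists_adapted [Module.Free ℤ N] (hX : X.IsFano) :
    ∃ s, X.IsAdapted s := by
  classical
  set G := X.finite_gens.toFinset.filter (· ∈ X.symLattice) with hG
  obtain ⟨s, hs, h0, hσ⟩ := hX.exists_facet_level_nonneg (σ := ∑ v ∈ G, v)
    (Submodule.sum_mem _ fun v hv => (Finset.mem_filter.1 hv).2)
  refine ⟨s, hs, h0, ?_⟩
  set T := s.filter X.IsSym with hT
  have hTG : T ⊆ G := fun x hx => by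
    have hx' := Finset.mem_filter.1 hx
    exact Finset.mem_filter.2 ⟨X.finite_gens.mem_toFinset.2 hx'.2.1, hx'.2.mem_symLattice⟩
  have hTG' : T.image Neg.neg ⊆ G := fun y hy => by
    obtain ⟨x, hx, rfl⟩ := Finset.mem_image.1 hy
    have hx' := Finset.mem_filter.1 hx
    exact Finset.mem_filter.2 ⟨X.finite_gens.mem_toFinset.2 hx'.2.2, hx'.2.neg.mem_symLattice⟩
  have hdisj : Disjoint T (T.image Neg.neg) := by
    rw [Finset.disjoint_left]
    rintro _ hx hy
    obtain ⟨x, hx', rfl⟩ := Finset.mem_image.1 hy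
    have a := hs.level_self (Finset.mem_filter.1 hx).1
    have b := hs.level_self (Finset.mem_filter.1 hx').1
    rw [map_neg] at a
    omega
  have hrest : ∀ v ∈ G \ (T ∪ T.image Neg.neg), level s v ≤ 0 := fun v hv => by
    have hv' := Finset.mem_sdiff.1 hv
    have hvG := Finset.mem_filter.1 hv'.1
    refine hX.level_nonpos hs (X.finite_gens.mem_toFinset.1 hvG.1) fun hvs => hv'.2 ?_
    refine Finset.mem_union_left _ (Finset.mem_filter.2 ⟨hvs, ?_⟩)
    by_contra hns
    have := h0 v hvs hns v hvG.2
    rw [hs.co_self hvs] at this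
    exact one_ne_zero this
  have hsum : ∑ v ∈ G \ (T ∪ T.image Neg.neg), level s v = level s (∑ v ∈ G, v) := by
    rw [map_sum, ← Finset.sum_sdiff (Finset.union_subset hTG hTG'), Finset.sum_union hdisj,
      Finset.sum_image (fun a _ b _ h => neg_injective h)]
    simp
  have hzero := (Finset.sum_eq_zero_iff_of_nonpos hrest).1
    (le_antisymm (Finset.sum_nonpos hrest) (hsum ▸ hσ))
  intro v hv hvH
  by_cases h1 : v ∈ T
  · exact Or.inl (Finset.mem_filter.1 h1).1
  by_cases h2 : v ∈ T.image Neg.neg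
  · obtain ⟨x, hx, rfl⟩ := Finset.mem_image.1 h2
    exact Or.inr (Or.inl (by simpa using (Finset.mem_filter.1 hx).1))
  exact Or.inr (Or.inr (hzero v (Finset.mem_sdiff.2 ⟨Finset.mem_filter.2
    ⟨X.finite_gens.mem_toFinset.2 hv, hvH⟩, by simp only [Finset.mem_union]; tauto⟩)))

namespace SmoothFan.IsFano

variable [Module.Free ℤ N] (hX : X.IsFano) (hs : X.IsFacet s)
include hX hs

/-- A negative value would give `w = w'`, contrary to the signs at `j`. If the value were `0`,
exchange `x` for `w`: then `w'` and `-x` are both on level zero and negative at `j` for the new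
cone, hence equal, although `-x` has level `-1` for `s`. -/
lemma co_pos_of_sym {w w' : N} (hw : w ∈ X.gens) (h0 : level s w = 0) (hw' : w' ∈ X.gens)
    (h0' : level s w' = 0) {x j : N} (hx : x ∈ s) (hxs : X.IsSym x) (hxw : co s x w < 0)
    (hj : j ∈ s) (hjw : 0 < co s j w) (hjw' : co s j w' < 0) : 0 < co s x w' := by
  classical
  obtain ⟨h1, hs'⟩ := hX.swap_of_level_zero hs hw h0 hx hxw
  by_contra hcon
  rcases lt_or_eq_of_le (not_lt.1 hcon) with h | h
  · have := hX.eq_of_level_zero hs hw h0 hw' h0' hx hxw h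
    rw [this] at hjw
    omega
  · have hjx : j ≠ x := by rintro rfl; omega
    have a1 : level (insert w (s.erase x)) w' = 0 := by
      rw [hs.swap_level_zero hx hs' h1 h0, h0', h, sub_zero]
    have a2 : level (insert w (s.erase x)) (-x) = 0 := by
      rw [hs.swap_level_zero hx hs' h1 h0, map_neg, map_neg, hs.level_self hx, hs.co_self hx]; rfl
    have a3 : co (insert w (s.erase x)) j w' < 0 := by
      rw [hs.swap_co hx hs' h1 hj hjx, h, zero_mul, add_zero]; exact hjw'
    have a4 : co (insert w (s.erase x)) j (-x) < 0 := by
      rw [hs.swap_co hx hs' h1 hj hjx, map_neg, map_neg, hs.co_self hx, hs.co_ne hj hx hjx]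
      linarith
    have := hX.eq_of_level_zero hs' hw' a1 hxs.2 a2
      (Finset.mem_insert_of_mem (Finset.mem_erase.2 ⟨hjx, hj⟩)) a3 a4
    rw [this, map_neg, hs.level_self hx] at h0'
    omega

/-- Two generators of level zero with opposite signs at some coordinate are opposite, under
suitable symmetry conditions. -/
lemma eq_neg_of_co {w w' : N} (hw : w ∈ X.gens) (h0 : level s w = 0) (hw' : w' ∈ X.gens)
    (h0' : level s w' = 0) {j : N} (hj : j ∈ s) (hjw : 0 < co s j w) (hjw' : co s j w' < 0)
    (hsym : ∀ x ∈ s, co s x w < 0 → X.IsSym x)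
    (hsym' : ∀ x ∈ s, co s x w' < 0 → X.IsSym x ∨ 0 < co s x w) : w' = -w := by
  have n1 : ∀ x ∈ s, co s x w < 0 → 0 < co s x w' := fun x hx h =>
    hX.co_pos_of_sym hs hw h0 hw' h0' hx (hsym x hx h) h hj hjw hjw'
  obtain ⟨i, hi, hiw⟩ := SmoothFan.IsFacet.exists_neg h0 hj hjw
  have n2 : ∀ x ∈ s, co s x w' < 0 → 0 < co s x w := fun x hx h => by
    rcases hsym' x hx h with h2 | h2
    · exact hX.co_pos_of_sym hs hw' h0' hw h0 hx h2 h hi (n1 i hi hiw) hiw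
    · exact h2
  -- Wherever one of the two is negative, it equals `-1` and the other is positive. So `w + w'` lies
  -- in the cone `⟨s⟩` on level zero, hence is zero.
  have hnn : ∀ x ∈ s, 0 ≤ co s x (w + w') := fun x hx => by
    rw [map_add]
    have a := hX.neg_one_le_co hs hw h0 hx
    have b := hX.neg_one_le_co hs hw' h0' hx
    rcases lt_or_ge (co s x w) 0 with h | h
    · have := n1 x hx h; omega
    · rcases lt_or_ge (co s x w') 0 with h2 | h2
      · have := n2 x hx h2; omega
      · omega
  have hl : level s (w + w') = 0 := by rw [map_add, h0, h0', add_zero]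
  rw [level_apply] at hl
  have := hs.eq_zero_of_co fun x hx => (Finset.sum_eq_zero_iff_of_nonneg hnn).1 hl x hx
  exact (neg_eq_of_add_eq_zero_right this).symm

/-- Exchange `x` for `w` and then `x'` for `w'`. In the resulting cone `-x` and `-x'` are both on
level zero and negative at `j`, so `eq_of_level_zero` makes them equal. -/
lemma not_both_pos {w w' : N} (hw : w ∈ X.gens) (h0 : level s w = 0) (hw' : w' ∈ X.gens)
    (h0' : level s w' = 0) {j x x' : N} (hj : j ∈ s) (hjw : 0 < co s j w) (hjw' : 0 < co s j w')
    (hx : x ∈ s) (hxs : X.IsSym x) (hx' : x' ∈ s) (hxs' : X.IsSym x') (hxw : co s x w < 0)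
    (hxw' : co s x w' = 0) (hxw2 : co s x' w' < 0) (hxw2' : co s x' w = 0) : False := by
  classical
  have hxx : x' ≠ x := by rintro rfl; omega
  have hjx : j ≠ x := by rintro rfl; omega
  have hjx' : j ≠ x' := by rintro rfl; omega
  obtain ⟨h1, hs1⟩ := hX.swap_of_level_zero hs hw h0 hx hxw
  have hx1 : x' ∈ insert w (s.erase x) := Finset.mem_insert_of_mem (Finset.mem_erase.2 ⟨hxx, hx'⟩)
  have hj1 : j ∈ insert w (s.erase x) := Finset.mem_insert_of_mem (Finset.mem_erase.2 ⟨hjx, hj⟩)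
  have l1 := hs.swap_level_zero hx hs1 h1 h0
  have c1 := fun v => hs.swap_co hx hs1 h1 hx' hxx v
  have cj := fun v => hs.swap_co hx hs1 h1 hj hjx v
  have lw' : level (insert w (s.erase x)) w' = 0 := by rw [l1, h0', hxw', sub_zero]
  obtain ⟨h2, hs2⟩ := hX.swap_of_level_zero hs1 hw' lw' hx1
    (by rw [c1, hxw', zero_mul, add_zero]; exact hxw2)
  have l2 := hs1.swap_level_zero hx1 hs2 h2 lw'
  have cj2 := fun v => hs1.swap_co hx1 hs2 h2 hj1 hjx' v
  have e1 := hs.co_self hx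
  have e2 := hs.co_self hx'
  have e3 := hs.co_ne hx hx' hxx.symm
  have e4 := hs.co_ne hx' hx hxx
  have e5 := hs.co_ne hj hx hjx
  have e6 := hs.co_ne hj hx' hjx'
  have e7 := hs.level_self hx
  have e8 := hs.level_self hx'
  have := hX.eq_of_level_zero hs2 hxs.2 (by rw [l2, l1, c1]; simp [e1, e4, e7, hxw2'])
    hxs'.2 (by rw [l2, l1, c1]; simp [e2, e3, e8])
    (Finset.mem_insert_of_mem (Finset.mem_erase.2 ⟨hjx', hj1⟩))
    (by rw [cj2, cj, cj, c1]; simp [e1, e4, e5, hxw2']; exact hjw)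
    (by rw [cj2, cj, cj, c1]; simp [e2, e3, e6, hxw']; exact hjw')
  exact hxx (neg_injective this).symm

end SmoothFan.IsFano

namespace SmoothFan.IsAdapted

variable [Module.Free ℤ N] (hX : X.IsFano) (hs : X.IsAdapted s)
include hX hs

omit [Module.Free ℤ N] hX in
lemma isSym_of_co_ne {w : N} (hw : w ∈ X.symLattice) {x : N} (hx : x ∈ s) (h : co s x w ≠ 0) :
    X.IsSym x := by
  by_contra hxs
  exact h (hs.co_eq_zero x hx hxs w hw)

/-- Exchange a symmetric `i` at which `w` is negative for `w`. In the new cone `i` has level zero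
and its coordinate at `x` is `co s x w`; both `i` and `-i` are generators, so this is at least `-1`
and at most `1`. -/
lemma co_cases {w : N} (hw : w ∈ X.gens) (hwH : w ∈ X.symLattice) (h0 : level s w = 0)
    {x : N} (hx : x ∈ s) : co s x w = 0 ∨ co s x w = 1 ∨ co s x w = -1 := by
  classical
  have hf := hs.facet
  obtain ⟨i, hi, hiw⟩ := hf.exists_neg_of_ne h0 (X.ne_zero_of_mem_gens hw)
  have hisym := hs.isSym_of_co_ne hwH hi hiw.ne
  obtain ⟨h1, hs'⟩ := hX.swap_of_level_zero hf hw h0 hi hiw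
  by_cases hxi : x = i
  · subst hxi; exact Or.inr (Or.inr h1)
  have hl : level (insert w (s.erase i)) i = 0 := by
    rw [hf.swap_level_zero hi hs' h1 h0, hf.level_self hi, hf.co_self hi, sub_self]
  have hc : co (insert w (s.erase i)) x i = co s x w := by
    rw [hf.swap_co hi hs' h1 hx hxi, hf.co_ne hx hi hxi, hf.co_self hi]; ring
  have hx' := Finset.mem_insert_of_mem (b := w) (Finset.mem_erase.2 ⟨hxi, hx⟩)
  have a := hX.neg_one_le_co hs' hisym.1 hl hx'
  have b := hX.neg_one_le_co hs' hisym.2 (by rw [map_neg, hl, neg_zero]) hx'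
  rw [map_neg] at b
  rw [hc] at a b
  omega

/-- The generators of level zero in `H` have disjoint supports, up to sign. -/
lemma eq_or_eq_neg {w w' : N} (hw : w ∈ X.gens) (hwH : w ∈ X.symLattice) (h0 : level s w = 0)
    (hw' : w' ∈ X.gens) (hwH' : w' ∈ X.symLattice) (h0' : level s w' = 0) {x : N} (hx : x ∈ s)
    (h : co s x w ≠ 0) (h' : co s x w' ≠ 0) : w' = w ∨ w' = -w := by
  have hf := hs.facet
  have S := fun z hz h => hs.isSym_of_co_ne (w := w) hwH (x := z) hz h
  have S' := fun z hz h => hs.isSym_of_co_ne (w := w') hwH' (x := z) hz h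
  -- Opposite signs at a single coordinate already force `w' = -w`.
  have key : ∀ j ∈ s, 0 < co s j w → co s j w' < 0 → w' = -w := fun j hj a b =>
    hX.eq_neg_of_co hf hw h0 hw' h0' hj a b (fun z hz h => S z hz h.ne)
      (fun z hz h => Or.inl (S' z hz h.ne))
  have key' : ∀ j ∈ s, 0 < co s j w' → co s j w < 0 → w' = -w := fun j hj a b => by
    have := hX.eq_neg_of_co hf hw' h0' hw h0 hj a b (fun z hz h => S' z hz h.ne)
      (fun z hz h => Or.inl (S z hz h.ne))
    rw [this, neg_neg]
  rcases lt_or_gt_of_ne h with a | a <;> rcases lt_or_gt_of_ne h' with b | b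
  · exact Or.inl (hX.eq_of_level_zero hf hw h0 hw' h0' hx a b).symm
  · exact Or.inr (key' x hx b a)
  · exact Or.inr (key x hx a b)
  -- Both are positive at `x`, so each has a negative coordinate somewhere. Comparing signs there
  -- leaves only the situation of `not_both_pos`.
  · obtain ⟨i, hi, hiw⟩ := SmoothFan.IsFacet.exists_neg h0 hx a
    obtain ⟨i', hi', hiw'⟩ := SmoothFan.IsFacet.exists_neg h0' hx b
    rcases lt_trichotomy (co s i w') 0 with c | c | c
    · exact Or.inl (hX.eq_of_level_zero hf hw h0 hw' h0' hi hiw c).symm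
    · rcases lt_trichotomy (co s i' w) 0 with d | d | d
      · exact Or.inl (hX.eq_of_level_zero hf hw h0 hw' h0' hi' d hiw').symm
      · exact (hX.not_both_pos hf hw h0 hw' h0' hx a b hi (S i hi hiw.ne) hi' (S' i' hi' hiw'.ne)
          hiw c hiw' d).elim
      · exact Or.inr (key i' hi' d hiw')
    · exact Or.inr (key' i hi c hiw)

end SmoothFan.IsAdapted

end Symmetric
end Toric

namespace Toric

/-! ### The case where `H` is a hyperplane: generators off `H`. -/

section Hyperplane

variable {N : Type} [AddCommGroup N] {X : SmoothFan N} {s : Finset N}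

namespace SmoothFan

lemma IsComplete.exists_facet_nonneg [Module.Free ℤ N] (hX : X.IsComplete) (v : N) :
    ∃ s, X.IsFacet s ∧ ∀ x ∈ s, 0 ≤ co s x v := by
  obtain ⟨t, ht, hvt⟩ := hX (toNQ N v)
  obtain ⟨s, hs, hts⟩ := hX.exists_facet_superset ht
  have hvs : toNQ N v ∈ cone (s : Set N) :=
    Submodule.span_mono (Set.image_mono (Finset.coe_subset.2 hts)) hvt
  obtain ⟨c, hc, hvc⟩ := (X.mem_cone_iff_int hs.1).1 hvs
  exact ⟨s, hs, fun x hx => by rw [hvc, hs.co_sum hx]; exact hc x⟩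

namespace IsFacet

variable (hs : X.IsFacet s)
include hs

lemma eq_zero_of_nonneg {v : N} (h : ∀ x ∈ s, 0 ≤ co s x v) (h0 : level s v = 0) : v = 0 := by
  rw [level_apply] at h0
  exact hs.eq_zero_of_co fun x hx => (Finset.sum_eq_zero_iff_of_nonneg h).1 h0 x hx

omit hs in
lemma level_nonneg {v : N} (h : ∀ x ∈ s, 0 ≤ co s x v) : 0 ≤ level s v := by
  rw [level_apply]
  exact Finset.sum_nonneg h

lemma level_pos {v : N} (h : ∀ x ∈ s, 0 ≤ co s x v) (hv : v ≠ 0) : 0 < level s v :=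
  lt_of_le_of_ne (level_nonneg h) fun h0 => hv (hs.eq_zero_of_nonneg h h0.symm)

lemma mem_of_level_eq_one {v : N} (h : ∀ x ∈ s, 0 ≤ co s x v) (h1 : level s v = 1) : v ∈ s := by
  obtain ⟨x, hx, hpos⟩ : ∃ x ∈ s, 0 < co s x v := by
    by_contra! hcon
    rw [level_apply] at h1
    have := Finset.sum_nonpos hcon
    omega
  have : v - x = 0 := by
    refine hs.eq_zero_of_nonneg (fun y hy => ?_) ?_
    · rw [map_sub]
      by_cases hyx : y = x
      · subst hyx; rw [hs.co_self hx]; omega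
      · rw [hs.co_ne hy hx hyx, sub_zero]; exact h y hy
    · rw [map_sub, h1, hs.level_self hx, sub_self]
  rw [sub_eq_zero.1 this]; exact hx

omit hs in
lemma add_co_le_level {v : N} (h : ∀ x ∈ s, 0 ≤ co s x v) {a b : N} (ha : a ∈ s) (hb : b ∈ s)
    (hab : a ≠ b) : co s a v + co s b v ≤ level s v := by
  classical
  rw [level_apply, ← Finset.sum_pair (f := fun x => co s x v) hab]
  refine Finset.sum_le_sum_of_subset_of_nonneg ?_ fun x hx _ => h x hx
  intro x hx
  rcases Finset.mem_insert.1 hx with rfl | hx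
  · exact ha
  · rw [Finset.mem_singleton.1 hx]; exact hb

lemma form_eq_of_one {u : N →ₗ[ℤ] ℤ} {a : N} (ha : a ∈ s) (hout : ∀ x ∈ s, u x ≠ 0 → x = a)
    (v : N) : u v = co s a v * u a := by
  have : u = u a • co s a := by
    refine hs.ext fun x hx => ?_
    by_cases h : x = a
    · subst h; simp [hs.co_self hx]
    · have : u x = 0 := by
        by_contra h2
        exact h (hout x hx h2)
      simp [this, hs.co_ne ha hx (Ne.symm h)]
  rw [this]
  simp [hs.co_self ha, mul_comm]

lemma form_eq_of_two {u : N →ₗ[ℤ] ℤ} {a b : N} (ha : a ∈ s) (hb : b ∈ s) (hab : a ≠ b)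
    (hout : ∀ x ∈ s, u x ≠ 0 → x = a ∨ x = b) (v : N) :
    u v = co s a v * u a + co s b v * u b := by
  have : u = u a • co s a + u b • co s b := by
    refine hs.ext fun x hx => ?_
    by_cases h : x = a
    · subst h; simp [hs.co_self hx, hs.co_ne hb hx hab.symm]
    by_cases h' : x = b
    · subst h'; simp [hs.co_self hx, hs.co_ne ha hx hab]
    have : u x = 0 := by
      by_contra h2
      rcases hout x hx h2 with h3 | h3
      · exact h h3
      · exact h' h3
    simp [this, hs.co_ne ha hx (Ne.symm h), hs.co_ne hb hx (Ne.symm h')]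
  conv_lhs => rw [this]
  simp [mul_comm]

end IsFacet

/-- `u` is an equation of the hyperplane spanned by the symmetric generators. -/
def IsSymEquation (X : SmoothFan N) (u : N →ₗ[ℤ] ℤ) : Prop :=
  (∀ v, v ∈ X.symLattice ↔ u v = 0) ∧ ∃ z, u z = 1

namespace IsSymEquation

variable {u : N →ₗ[ℤ] ℤ} (hu : X.IsSymEquation u)
include hu

lemma sym {y : N} (hy : X.IsSym y) : u y = 0 := (hu.1 y).1 hy.mem_symLattice

lemma neg : X.IsSymEquation (-u) :=
  ⟨fun v => by rw [hu.1 v]; simp, by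
    obtain ⟨z, hz⟩ := hu.2
    exact ⟨-z, by simp [hz]⟩⟩

lemma not_sym {x : N} (hx : u x ≠ 0) : ¬ X.IsSym x := fun h => hx (hu.sym h)

variable [Module.Free ℤ N] (hX : X.IsFano) (hs : X.IsFacet s)
include hX hs

/-- The vector `u b • a - u a • b` lies in `H` and has a nonzero coordinate at `a`, so some
symmetric `y` has one too. If `y` had coordinate `0` at `b`, then `co_mul_eq` would exclude every
further element of `s` off `H` from its support, and `u y = co s a y * u a ≠ 0`. -/
lemma exists_sym_of_two {a b : N} (ha : a ∈ s) (hb : b ∈ s) (hab : a ≠ b) (hua : u a ≠ 0)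
    (hub : u b ≠ 0) : ∃ y, X.IsSym y ∧ level s y = 0 ∧ co s a y ≠ 0 ∧ co s b y ≠ 0 := by
  have hv : u b • a - u a • b ∈ X.symLattice := by
    rw [hu.1]; simp [mul_comm]
  have hva : co s a (u b • a - u a • b) = u b := by
    simp [hs.co_self ha, hs.co_ne ha hb hab]
  obtain ⟨y, hy, hay⟩ : ∃ y, X.IsSym y ∧ co s a y ≠ 0 := by
    by_contra! hcon
    exact hub (hva.symm.trans (SmoothFan.eq_zero_of_mem_symLattice hcon hv))
  refine ⟨y, hy, hX.sym_level_zero hs hy ha (hu.not_sym hua) hay, hay, fun hby => ?_⟩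
  have huy := hu.sym hy
  rw [← hs.sum_co y, map_sum, Finset.sum_eq_single_of_mem a ha] at huy
  · rw [map_smul, smul_eq_mul] at huy
    exact (mul_ne_zero hay hua) huy
  · intro x hx hxa
    rw [map_smul, smul_eq_mul]
    by_cases hux : u x = 0
    · rw [hux, mul_zero]
    by_cases hxb : x = b
    · rw [hxb, hby, zero_mul]
    by_cases hxy : co s x y = 0
    · rw [hxy, zero_mul]
    exfalso
    have := hX.co_mul_eq hs hy hx (hu.not_sym hux) ha (hu.not_sym hua) hxy hay hv
    rw [hva, map_sub, map_smul, map_smul, hs.co_ne hx ha hxa, hs.co_ne hx hb hxb, smul_zero,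
      smul_zero, sub_zero, zero_mul] at this
    exact mul_ne_zero hub hay this.symm

/-- With three elements of `s` off `H`, one symmetric `y` has all three in its support by
`sym_unique`. Then `co_mul_eq` compares the coordinates of `u b • a - u a • b` at `x`, which is
zero, and at `a`, which is not. -/
lemma eq_or_eq_of_two {a b : N} (ha : a ∈ s) (hb : b ∈ s) (hab : a ≠ b) (hua : u a ≠ 0)
    (hub : u b ≠ 0) {x : N} (hx : x ∈ s) (hux : u x ≠ 0) : x = a ∨ x = b := by
  by_contra! hcon
  obtain ⟨y, hy, h0, hay, hby⟩ := hu.exists_sym_of_two hX hs ha hb hab hua hub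
  obtain ⟨y', hy', h0', hay', hxy'⟩ := hu.exists_sym_of_two hX hs ha hx hcon.1.symm hua hux
  have hxy : co s x y ≠ 0 := by
    rcases hX.sym_unique hs hy h0 hy' h0' ha hay hay' with rfl | rfl
    · exact hxy'
    · simpa using hxy'
  have hv : u b • a - u a • b ∈ X.symLattice := by
    rw [hu.1]; simp [mul_comm]
  have := hX.co_mul_eq hs hy hx (hu.not_sym hux) ha (hu.not_sym hua) hxy hay hv
  rw [map_sub, map_smul, map_smul, hs.co_ne hx ha hcon.1, hs.co_ne hx hb hcon.2, smul_zero,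
      smul_zero, sub_zero, zero_mul, map_sub, map_smul, map_smul, hs.co_self ha,
      hs.co_ne ha hb hab] at this
  simp at this
  tauto

lemma exists_neg_sym_of_two {a b : N} (ha : a ∈ s) (hb : b ∈ s) (hab : a ≠ b) (hua : u a ≠ 0)
    (hub : u b ≠ 0) : ∃ y, X.IsSym y ∧ level s y = 0 ∧ co s a y = -1 ∧ u a = co s b y * u b := by
  have hf := hs.form_eq_of_two ha hb hab
    (fun x hx hux => hu.eq_or_eq_of_two hX hs ha hb hab hua hub hx hux)
  obtain ⟨y, hy, h0, hay, hby⟩ := hu.exists_sym_of_two hX hs ha hb hab hua hub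
  obtain ⟨y, hy, h0, hay⟩ : ∃ y, X.IsSym y ∧ level s y = 0 ∧ co s a y = -1 := by
    rcases hX.sym_co hs hy h0 ha hay with h | h
    · exact ⟨-y, hy.neg, by rw [map_neg, h0, neg_zero], by rw [map_neg, h]⟩
    · exact ⟨y, hy, h0, h⟩
  refine ⟨y, hy, h0, hay, ?_⟩
  have := hf y
  rw [hu.sym hy, hay] at this
  linarith

/-- Exchange `a` for a symmetric `y` of level zero. The level of `g` becomes `level s g - co s a g`,
and `g` does not belong to the new cone because `y` is in `H`. -/
lemma level_le_co_of_two {a b : N} (ha : a ∈ s) (hb : b ∈ s) (hab : a ≠ b) (hua : u a ≠ 0)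
    (hub : u b ≠ 0) {g : N} (hg : g ∈ X.gens) (hug : u g ≠ 0) (hgs : g ∉ s) :
    level s g ≤ co s a g := by
  classical
  obtain ⟨y, hy, h0, hay, -⟩ := hu.exists_neg_sym_of_two hX hs ha hb hab hua hub
  obtain ⟨-, hs'⟩ := hX.swap_of_level_zero hs hy.1 h0 ha (by rw [hay]; norm_num)
  have hl := hs.swap_level_zero ha hs' hay h0 g
  have : g ∉ insert y (s.erase a) := fun h => by
    rcases Finset.mem_insert.1 h with rfl | h
    · exact hug (hu.sym hy)
    · exact hgs (Finset.mem_erase.1 h).2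
  have := hX.level_nonpos hs' hg this
  omega

/-- Otherwise some symmetric `±y` of level zero would have coordinate `-1` at `x`, and uniqueness
would identify `g` with an element of `H`. -/
lemma isSym_of_co_neg {g : N} (hg : g ∈ X.gens) (hug : u g ≠ 0) (h0 : level s g = 0) {x : N}
    (hx : x ∈ s) (hux : u x = 0) (hneg : co s x g < 0) : X.IsSym x := by
  by_contra hxs
  obtain ⟨y, hy, hxy⟩ : ∃ y, X.IsSym y ∧ co s x y ≠ 0 := by
    by_contra! hcon
    have := SmoothFan.eq_zero_of_mem_symLattice hcon ((hu.1 x).2 hux)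
    rw [hs.co_self hx] at this
    exact one_ne_zero this
  have hy0 := hX.sym_level_zero hs hy hx hxs hxy
  rcases hX.sym_co hs hy hy0 hx hxy with h | h
  · have := hX.eq_of_level_zero hs hg h0 hy.2 (by rw [map_neg, hy0, neg_zero]) hx hneg
      (by rw [map_neg, h]; norm_num)
    exact hug (this ▸ hu.sym hy.neg)
  · have := hX.eq_of_level_zero hs hg h0 hy.1 hy0 hx hneg (by rw [h]; norm_num)
    exact hug (this ▸ hu.sym hy)

/-- Since `s` is a basis with at most two elements off `H`, whose values under `u` are multiples of
each other, `u a` divides `u z = 1`. -/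
lemma eq_one_or_of_facet {a : N} (ha : a ∈ s) (hua : u a ≠ 0) : u a = 1 ∨ u a = -1 := by
  obtain ⟨z, hz⟩ := hu.2
  by_cases h : ∃ b ∈ s, b ≠ a ∧ u b ≠ 0
  · obtain ⟨b, hb, hba, hub⟩ := h
    have hf := hs.form_eq_of_two ha hb hba.symm
      (fun x hx hux => hu.eq_or_eq_of_two hX hs ha hb hba.symm hua hub hx hux) z
    obtain ⟨y, -, h0, hay, he⟩ := hu.exists_neg_sym_of_two hX hs hb ha hba hub hua
    have : u a ∣ 1 := ⟨co s a z + co s b z * co s a y, by rw [← hz, hf, he]; ring⟩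
    exact Int.isUnit_iff.1 (isUnit_of_dvd_one this)
  · push Not at h
    have hf := hs.form_eq_of_one (u := u) ha (fun x hx hux => by
      by_contra hxa
      exact hux (h x hx hxa)) z
    exact Int.isUnit_iff.1 (isUnit_of_dvd_one ⟨co s a z, by rw [← hz, hf]; ring⟩)

omit hs in
lemma eq_one_or {a : N} (ha : a ∈ X.gens) (hua : u a ≠ 0) : u a = 1 ∨ u a = -1 := by
  obtain ⟨s, hs, has⟩ := hX.1.exists_facet_superset ha
  exact hu.eq_one_or_of_facet hX hs (has (Finset.mem_singleton_self a)) hua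

variable {v₁ v₂ v' : N} (h₁ : v₁ ∈ X.gens) (u₁ : u v₁ = 1) (h₂ : v₂ ∈ X.gens) (u₂ : u v₂ = 1)
  (h' : v' ∈ X.gens) (u' : u v' = -1) (hne : v₁ ≠ v₂)
  (hpos : ∀ x ∈ s, 0 ≤ co s x (v₁ + v₂ + 2 • v'))

omit [Module.Free ℤ N] hX hs in
include h₂ u₂ h' in
lemma ne_neg : v' ≠ -v₂ := by
  rintro rfl
  have := hu.sym ⟨h₂, h'⟩
  omega

include h₁ u₁ h₂ u₂ h' u' hne hpos

/-- Write `p` for the vector `v₁ + v₂ + 2 • v'`, which lies in `H ∩ ⟨s⟩`. Its coordinates at `v'`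
and `v₁` agree since `u p = 0`. The level bounds then leave only `-1` and `-2` as the coordinate of
`v₂` at `v'`. -/
lemma false_of_mem_mem (hp : 0 < level s (v₁ + v₂ + 2 • v')) (hv' : v' ∈ s) (hv₁ : v₁ ∈ s) :
    False := by
  classical
  have hab : v' ≠ v₁ := by rintro rfl; omega
  have e1 := hs.co_self hv'
  have e2 := hs.co_self hv₁
  have e3 := hs.co_ne hv' hv₁ hab
  have e4 := hs.co_ne hv₁ hv' hab.symm
  have l1 := hs.level_self hv'
  have l2 := hs.level_self hv₁
  have hout := fun x hx hux => hu.eq_or_eq_of_two hX hs hv' hv₁ hab (by omega) (by omega)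
    (x := x) hx hux
  have hv₂ : v₂ ∉ s := fun h => by
    rcases hout v₂ h (by omega) with rfl | rfl
    · omega
    · exact hne rfl
  obtain ⟨y, hy, hy0, hay, hby⟩ := hu.exists_neg_sym_of_two hX hs hv' hv₁ hab (by omega) (by omega)
  rw [u', u₁, mul_one] at hby
  obtain ⟨-, hs'⟩ := hX.swap_of_level_zero hs hy.1 hy0 hv' (by rw [hay]; norm_num)
  have hl := hs.swap_level_zero hv' hs' hay hy0 v₂
  have hv₂s' : v₂ ∉ insert y (s.erase v') := fun h => by
    rcases Finset.mem_insert.1 h with rfl | h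
    · have := hu.sym hy; omega
    · exact hv₂ (Finset.mem_erase.1 h).2
  have hle := hX.level_nonpos hs' h₂ hv₂s'
  have hup := hs.form_eq_of_two hv' hv₁ hab hout (v₁ + v₂ + 2 • v')
  have hsum := IsFacet.add_co_le_level hpos hv' hv₁ hab
  have hc0 := hpos v' hv'
  have hneg := hu.ne_neg h₂ u₂ h'
  simp only [map_add, map_nsmul, nsmul_eq_mul, Nat.cast_ofNat, e1, e2, e3, e4, l1, l2, u₁, u₂,
    u'] at hup hsum hp hc0
  by_cases hc : co s v' v₂ = -1
  · -- `p = v₁ + v'`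
    have h0 : v₂ + v' = 0 := by
      refine hs.eq_zero_of_nonneg (fun x hx => ?_) ?_
      · by_cases hx1 : x = v'
        · subst hx1; rw [map_add]; omega
        by_cases hx2 : x = v₁
        · subst hx2; rw [map_add]; omega
        · have := hpos x hx
          simp only [map_add, map_nsmul, hs.co_ne hx hv' hx1, hs.co_ne hx hv₁ hx2] at this ⊢
          simpa using this
      · rw [map_add]; omega
    exact hneg (neg_eq_of_add_eq_zero_right h0).symm
  · have hl2 : level s v₂ = -2 := by omega
    have hc2 : co s v' v₂ = -2 := by omega
    have hp1 : level s (v₁ + v₂ + 2 • v') = 1 := by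
      simp only [map_add, map_nsmul, nsmul_eq_mul, Nat.cast_ofNat]; omega
    set p := v₁ + v₂ + 2 • v' with hpdef
    have hps := hs.mem_of_level_eq_one hpos hp1
    -- Here `p` is itself an element of `s`. The vector has nonnegative coordinates, because `v₂` is
    -- on level zero after the exchange of `v'` for `y`; but its level is `1 - 0 - 1 - 1`.
    have hcontra : 0 ≤ level s (p - y - v₁ - v') := by
      refine IsFacet.level_nonneg fun k hk => ?_
      by_cases hk1 : k = v'
      · subst hk1
        have := hpos k hk
        simp only [map_sub]; omega
      by_cases hk2 : k = v₁
      · subst hk2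
        have := hpos k hk
        simp only [map_sub]; omega
      have c1 := hs.co_ne hk hv' hk1
      have c2 := hs.co_ne hk hv₁ hk2
      have hle2 := hX.neg_one_le_co hs' h₂ (by omega)
        (Finset.mem_insert_of_mem (Finset.mem_erase.2 ⟨hk1, hk⟩))
      rw [hs.swap_co hv' hs' hay hk hk1] at hle2
      have c3 : co s k p = co s k v₂ := by
        rw [hpdef]; simp [c1, c2]
      have c4 : co s k p = 0 ∨ co s k p = 1 := by
        by_cases hkp : k = p
        · right; rw [← hkp]; exact hs.co_self hk
        · left; exact hs.co_ne hk hps hkp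
      simp only [map_sub, c1, c2]
      rw [hc2] at hle2
      omega
    simp only [map_sub, hp1, hy0, l1, l2] at hcontra
    omega

/-- The bounds of `level_le_co_of_two` exclude a second element of `s` off `H`. So `v₁` and `v₂`
both have coordinate `-1` at `v'`, and they coincide if both are on level zero. -/
lemma false_of_mem_of_level (hv' : v' ∈ s) (hv₁ : v₁ ∉ s) (hv₂ : v₂ ∉ s) (f₁ : level s v₁ = 0)
    (f₂ : -1 ≤ level s v₂) : False := by
  classical
  have e1 := hs.co_self hv'
  have l1 := hs.level_self hv'
  have f₂' := hX.level_nonpos hs h₂ hv₂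
  have hneg := hu.ne_neg h₂ u₂ h'
  by_cases hb : ∃ b ∈ s, b ≠ v' ∧ u b ≠ 0
  · obtain ⟨b, hb, hbv', hub⟩ := hb
    have hout := fun x hx hux => hu.eq_or_eq_of_two hX hs hv' hb hbv'.symm (by omega) hub
      (x := x) hx hux
    have t1 := hu.level_le_co_of_two hX hs hv' hb hbv'.symm (by omega) hub h₁ (by omega) hv₁
    have t2 := hu.level_le_co_of_two hX hs hv' hb hbv'.symm (by omega) hub h₂ (by omega) hv₂
    have t3 := hu.level_le_co_of_two hX hs hb hv' hbv' hub (by omega) h₁ (by omega) hv₁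
    have t4 := hu.level_le_co_of_two hX hs hb hv' hbv' hub (by omega) h₂ (by omega) hv₂
    have g1 := hs.form_eq_of_two hv' hb hbv'.symm hout v₁
    have g2 := hs.form_eq_of_two hv' hb hbv'.symm hout v₂
    have hsum := IsFacet.add_co_le_level hpos hv' hb hbv'.symm
    have hc0 := hpos v' hv'
    have e3 := hs.co_ne hb hv' hbv'
    simp only [map_add, map_nsmul, nsmul_eq_mul, Nat.cast_ofNat, e1, e3, l1] at hsum hc0
    rcases hu.eq_one_or_of_facet hX hs hb hub with h | h
    · rw [u₁, u', h] at g1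
      rw [u₂, u', h] at g2
      omega
    · rw [u₁, u', h] at g1
      omega
  · push Not at hb
    have hf := hs.form_eq_of_one (u := u) hv' (fun x hx hux => by
      by_contra hxa
      exact hux (hb x hx hxa))
    have c1 : co s v' v₁ = -1 := by have := hf v₁; rw [u₁, u'] at this; omega
    have c2 : co s v' v₂ = -1 := by have := hf v₂; rw [u₂, u'] at this; omega
    by_cases f20 : level s v₂ = 0
    · exact hne (hX.eq_of_level_zero hs h₁ f₁ h₂ f20 hv' (by omega) (by omega))
    obtain ⟨-, hs'⟩ := hX.swap_of_level_zero hs h₁ f₁ hv' (by omega)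
    have hl := hs.swap_level_zero hv' hs' c1 f₁ v₂
    have hp1 : level s (v₁ + v₂ + 2 • v') = 1 := by
      simp only [map_add, map_nsmul, nsmul_eq_mul, Nat.cast_ofNat]; omega
    set p := v₁ + v₂ + 2 • v' with hpdef
    have hps := hs.mem_of_level_eq_one hpos hp1
    -- This vector is `v₂ + v'`, and `v₂ = -v'` is excluded because `v₂` would be symmetric.
    have hz : p - v' - v₁ = 0 := by
      refine hs.eq_zero_of_nonneg (fun k hk => ?_) ?_
      · by_cases hk1 : k = v'
        · subst hk1
          have := hpos k hk
          simp only [map_sub]; omega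
        have d1 := hs.co_ne hk hv' hk1
        have hle2 := hX.neg_one_le_co hs' h₂ (by omega)
          (Finset.mem_insert_of_mem (Finset.mem_erase.2 ⟨hk1, hk⟩))
        rw [hs.swap_co hv' hs' c1 hk hk1, c2] at hle2
        have d3 : co s k p = co s k v₁ + co s k v₂ := by
          rw [hpdef]; simp [d1]
        have d4 : co s k p = 0 ∨ co s k p = 1 := by
          by_cases hkp : k = p
          · right; rw [← hkp]; exact hs.co_self hk
          · left; exact hs.co_ne hk hps hkp
        simp only [map_sub, d1]
        omega
      · simp only [map_sub]; omega
    apply hneg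
    have : v₂ + v' = 0 := by
      rw [← hz, hpdef]; abel
    exact (neg_eq_of_add_eq_zero_right this).symm

/-- Positivity of the level of `p` puts `v'` on level zero, and `v₂` too unless it is in `s`. The
level bounds exclude a second element of `s` off `H`; then `v'` and `v₂` have opposite signs at
`v₁`, and `eq_neg_of_co` gives `v' = -v₂`. -/
lemma false_of_notMem_of_mem (hp : 0 < level s (v₁ + v₂ + 2 • v')) (hv' : v' ∉ s) (hv₁ : v₁ ∈ s) :
    False := by
  have f' := hX.level_nonpos hs h' hv'
  have e2 := hs.co_self hv₁
  have l2 := hs.level_self hv₁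
  have hp2 := hp
  simp only [map_add, map_nsmul, nsmul_eq_mul, Nat.cast_ofNat, l2] at hp
  by_cases hv₂ : v₂ ∈ s
  · have l3 := hs.level_self hv₂
    have hout := fun x hx hux => hu.eq_or_eq_of_two hX hs hv₁ hv₂ hne (by omega) (by omega)
      (x := x) hx hux
    have t1 := hu.level_le_co_of_two hX hs hv₁ hv₂ hne (by omega) (by omega) h' (by omega) hv'
    have t2 := hu.level_le_co_of_two hX hs hv₂ hv₁ hne.symm (by omega) (by omega) h' (by omega) hv'
    have g1 := hs.form_eq_of_two hv₁ hv₂ hne hout v'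
    rw [u', u₁, u₂] at g1
    omega
  have f₂ := hX.level_nonpos hs h₂ hv₂
  have f₂0 : level s v₂ = 0 := by omega
  have f'0 : level s v' = 0 := by omega
  by_cases hb : ∃ b ∈ s, b ≠ v₁ ∧ u b ≠ 0
  · obtain ⟨b, hb, hbv, hub⟩ := hb
    have hout := fun x hx hux => hu.eq_or_eq_of_two hX hs hv₁ hb hbv.symm (by omega) hub
      (x := x) hx hux
    have t1 := hu.level_le_co_of_two hX hs hv₁ hb hbv.symm (by omega) hub h' (by omega) hv'
    have t2 := hu.level_le_co_of_two hX hs hv₁ hb hbv.symm (by omega) hub h₂ (by omega) hv₂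
    have t3 := hu.level_le_co_of_two hX hs hb hv₁ hbv hub (by omega) h' (by omega) hv'
    have t4 := hu.level_le_co_of_two hX hs hb hv₁ hbv hub (by omega) h₂ (by omega) hv₂
    have g1 := hs.form_eq_of_two hv₁ hb hbv.symm hout v'
    have g2 := hs.form_eq_of_two hv₁ hb hbv.symm hout v₂
    have hsum := IsFacet.add_co_le_level hpos hv₁ hb hbv.symm
    have e3 := hs.co_ne hb hv₁ hbv
    simp only [map_add, map_nsmul, nsmul_eq_mul, Nat.cast_ofNat, e2, e3, l2] at hsum
    rcases hu.eq_one_or_of_facet hX hs hb hub with h | h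
    · rw [u', u₁, h] at g1
      omega
    · rw [u', u₁, h] at g1
      rw [u₂, u₁, h] at g2
      omega
  · push Not at hb
    have hf := hs.form_eq_of_one (u := u) hv₁ (fun x hx hux => by
      by_contra hxa
      exact hux (hb x hx hxa))
    have c1 : co s v₁ v' = -1 := by have := hf v'; rw [u₁, u'] at this; omega
    have c2 : co s v₁ v₂ = 1 := by have := hf v₂; rw [u₂, u₁] at this; omega
    refine hu.ne_neg h₂ u₂ h' (hX.eq_neg_of_co hs h₂ f₂0 h' f'0 hv₁ (by omega) (by omega) ?_ ?_)
    · intro x hx hneg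
      have hxv : x ≠ v₁ := by rintro rfl; omega
      exact hu.isSym_of_co_neg hX hs h₂ (by omega) f₂0 hx (hb x hx hxv) hneg
    · intro x hx hneg
      by_cases hxv : x = v₁
      · right; rw [hxv]; omega
      · left; exact hu.isSym_of_co_neg hX hs h' (by omega) f'0 hx (hb x hx hxv) hneg

omit hs hne hpos in
/-- If there are generators on both sides of the hyperplane `H`, then there is only one on each
side. -/
theorem eq_of_opposite : v₁ = v₂ := by
  by_contra hne
  -- If this vector is zero it has no positive level, so a cone containing `v₁ + v₂` is used
  -- instead.
  by_cases hp0 : v₁ + v₂ + 2 • v' = 0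
  · obtain ⟨s, hs, hpos⟩ := hX.1.exists_facet_nonneg (v₁ + v₂)
    have hlp := hs.level_pos hpos (fun h => by
      have := congrArg u h
      rw [map_add, u₁, u₂, map_zero] at this
      omega)
    rw [map_add] at hlp
    by_cases hmem : v₁ ∈ s ∧ v₂ ∈ s
    -- Parity: the coordinate at `v₁` would read `1 + 0 + 2 * c = 0`.
    · have := congrArg (co s v₁) hp0
      simp only [map_add, map_nsmul, nsmul_eq_mul, hs.co_self hmem.1, map_zero,
        hs.co_ne hmem.1 hmem.2 hne] at this
      omega
    -- Otherwise the level is exactly `1`, so `v₁ + v₂` is a generator with `u = 2`.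
    · have l1 := hX.level_le_one hs h₁
      have l2 := hX.level_le_one hs h₂
      have : level s (v₁ + v₂) = 1 := by
        rw [map_add]
        by_contra h
        exact hmem ⟨hX.mem_of_level hs h₁ (by omega), hX.mem_of_level hs h₂ (by omega)⟩
      have h3 := hs.mem_of_level_eq_one hpos this
      have h4 : u (v₁ + v₂) = 2 := by rw [map_add, u₁, u₂]; rfl
      have := hu.eq_one_or_of_facet hX hs h3 (by omega)
      omega
  obtain ⟨s, hs, hpos⟩ := hX.1.exists_facet_nonneg (v₁ + v₂ + 2 • v')
  have hp := hs.level_pos hpos hp0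
  have hcomm : v₁ + v₂ + 2 • v' = v₂ + v₁ + 2 • v' := by rw [add_comm v₁]
  have hpos' := hpos
  have hp' := hp
  rw [hcomm] at hpos' hp'
  by_cases hv' : v' ∈ s
  · by_cases hv₁ : v₁ ∈ s
    · exact hu.false_of_mem_mem hX hs h₁ u₁ h₂ u₂ h' u' hne hpos hp hv' hv₁
    by_cases hv₂ : v₂ ∈ s
    · exact hu.false_of_mem_mem hX hs h₂ u₂ h₁ u₁ h' u' (Ne.symm hne) hpos' hp' hv' hv₂
    have f₁ := hX.level_nonpos hs h₁ hv₁
    have f₂ := hX.level_nonpos hs h₂ hv₂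
    simp only [map_add, map_nsmul, nsmul_eq_mul, Nat.cast_ofNat, hs.level_self hv'] at hp
    by_cases f10 : level s v₁ = 0
    · exact hu.false_of_mem_of_level hX hs h₁ u₁ h₂ u₂ h' u' hne hpos hv' hv₁ hv₂ f10 (by omega)
    · exact hu.false_of_mem_of_level hX hs h₂ u₂ h₁ u₁ h' u' (Ne.symm hne) hpos' hv' hv₂ hv₁
        (by omega) (by omega)
  · by_cases hv₁ : v₁ ∈ s
    · exact hu.false_of_notMem_of_mem hX hs h₁ u₁ h₂ u₂ h' u' hne hpos hp hv' hv₁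
    by_cases hv₂ : v₂ ∈ s
    · exact hu.false_of_notMem_of_mem hX hs h₂ u₂ h₁ u₁ h' u' (Ne.symm hne) hpos' hp' hv' hv₂
    -- With none of the three in `s`, all levels are nonpositive, against positivity of the total.
    have f₁ := hX.level_nonpos hs h₁ hv₁
    have f₂ := hX.level_nonpos hs h₂ hv₂
    have f' := hX.level_nonpos hs h' hv'
    simp only [map_add, map_nsmul, nsmul_eq_mul, Nat.cast_ofNat] at hp
    omega

end IsSymEquation
end SmoothFan

end Hyperplane
end Toric

namespace Toric

/-! ### Splitting the generators in `H` into standard blocks. -/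

section Blocks

/-- Representatives of the equivalence classes of a finite type, with an enumeration of each. -/
lemma exists_sigma_equiv {T : Type} [Finite T] (r : Setoid T) :
    ∃ (k : ℕ) (d : Fin k → ℕ) (E : (Σ i : Fin k, Fin (d i)) ≃ T),
      (∀ i, 0 < d i) ∧ ∀ p q, r (E p) (E q) ↔ p.1 = q.1 := by
  classical
  have := Fintype.ofFinite T
  let q : T → Quotient r := Quotient.mk r
  let e := Fintype.equivFin (Quotient r)
  let f : T → Fin (Fintype.card (Quotient r)) := e ∘ q
  have hf : ∀ x y, f x = f y ↔ r x y := fun x y => by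
    simp only [f, q, Function.comp, EmbeddingLike.apply_eq_iff_eq]
    exact Quotient.eq
  let E : (Σ i, Fin (Fintype.card {x // f x = i})) ≃ T :=
    (Equiv.sigmaCongrRight fun i => (Fintype.equivFin {x // f x = i}).symm).trans
      (Equiv.sigmaFiberEquiv f)
  have hE : ∀ p, f (E p) = p.1 := fun p => ((Fintype.equivFin {x // f x = p.1}).symm p.2).2
  refine ⟨_, _, E, fun i => ?_, fun p q => by rw [← hf, hE, hE]⟩
  rw [Fintype.card_pos_iff]
  obtain ⟨x, hx⟩ := Quotient.exists_rep (e.symm i)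
  exact ⟨⟨x, by simp [f, q, hx]⟩⟩

/-- The sets of generators of Del Pezzo varieties, pseudo Del Pezzo varieties, and `ℙ¹`. -/
def IsStandard {h : ℕ} (S : Set (Fin h → ℤ)) : Prop :=
  (0 < h ∧ Even h ∧ S = {v | ∃ i, v = Pi.single i 1 ∨ v = -Pi.single i 1} ∪
      {-∑ i, Pi.single i 1, ∑ i, Pi.single i 1}) ∨
  (0 < h ∧ Even h ∧ S = {v | ∃ i, v = Pi.single i 1 ∨ v = -Pi.single i 1} ∪
      {-∑ i, Pi.single i 1}) ∨
  (h = 1 ∧ S = {1, -1})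

lemma even_card_of_sum_eq_zero {ι : Type*} {s : Finset ι} {f : ι → ℤ}
    (hf : ∀ i ∈ s, f i = 1 ∨ f i = -1) (h : ∑ i ∈ s, f i = 0) : Even s.card := by
  have h1 : ∑ i ∈ s, (f i + 1) = s.card := by rw [Finset.sum_add_distrib, h]; simp
  have h2 : Even (∑ i ∈ s, (f i + 1)) := Finset.even_sum _ fun i hi => by
    rcases hf i hi with h | h <;> rw [h]
    · exact ⟨1, rfl⟩
    · exact ⟨0, rfl⟩
  rw [h1] at h2
  exact_mod_cast h2

variable {N : Type} [AddCommGroup N] {X : SmoothFan N} {s : Finset N}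

lemma SmoothFan.IsAdapted.mem_symLattice_iff (hs : X.IsAdapted s) {v : N} :
    v ∈ X.symLattice ↔ ∀ x ∈ s, ¬ X.IsSym x → co s x v = 0 := by
  refine ⟨fun h x hx hxs => hs.co_eq_zero x hx hxs v h, fun h => ?_⟩
  rw [← hs.facet.sum_co v]
  refine Submodule.sum_mem _ fun x hx => ?_
  by_cases hxs : X.IsSym x
  · exact Submodule.smul_mem _ _ hxs.mem_symLattice
  · rw [h x hx hxs, zero_smul]
    exact Submodule.zero_mem _

open Classical in
lemma SmoothFan.IsAdapted.finrank_symmSpan (hs : X.IsAdapted s) :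
    Module.finrank ℚ X.symmSpan = (s.filter X.IsSym).card := by
  have hspan : X.symmSpan =
      Submodule.span ℚ (Set.range fun x : s.filter X.IsSym => toNQ N (x : N)) := by
    apply le_antisymm
    · refine Submodule.span_le.2 ?_
      rintro _ ⟨y, hy, rfl⟩
      have hy' : X.IsSym y := hy
      rw [← hs.facet.sum_co y, toNQ_sum_zsmul]
      refine Submodule.sum_mem _ fun x hx => ?_
      by_cases hxs : X.IsSym x
      · exact Submodule.smul_mem _ _
          (Submodule.subset_span ⟨⟨x, Finset.mem_filter.2 ⟨hx, hxs⟩⟩, rfl⟩)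
      · rw [hs.co_eq_zero x hx hxs y hy'.mem_symLattice, Int.cast_zero, zero_smul]
        exact Submodule.zero_mem _
    · refine Submodule.span_mono ?_
      rintro _ ⟨x, rfl⟩
      exact ⟨x, (Finset.mem_filter.1 x.2).2, rfl⟩
  rw [hspan, finrank_span_eq_card, Fintype.card_coe]
  rw [linearIndependent_iff']
  intro t g hg x hx
  have hx' := (Finset.mem_filter.1 x.2).1
  have h := congrArg (extendForm (ratForm (co s x.1))) hg
  rw [map_sum, map_zero, Finset.sum_eq_single_of_mem x hx] at h
  · simpa [hs.facet.co_self hx'] using h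
  · intro y _ hyx
    rw [map_smul, extendForm_toNQ, ratForm_apply, hs.facet.co_ne hx'
      (Finset.mem_filter.1 y.2).1 (fun h => hyx (Subtype.ext h.symm))]
    simp

/-- The generators in `H` split into blocks: `H ∩ N` is a product of lattices `ℤ^(d i)`, and the
generators in `H` are those of a product of Del Pezzo varieties, pseudo Del Pezzo varieties and
projective lines. -/
theorem SmoothFan.IsAdapted.exists_blocks [Module.Free ℤ N] (hX : X.IsFano) (hs : X.IsAdapted s) :
    ∃ (k : ℕ) (d : Fin k → ℕ) (l : (∀ i, Fin (d i) → ℤ) →ₗ[ℤ] N),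
      Function.Injective l ∧ LinearMap.range l = X.symLattice ∧
      (∀ i, IsStandard {a : Fin (d i) → ℤ | l (Pi.single i a) ∈ X.gens}) ∧
      ∀ v ∈ X.gens, v ∈ X.symLattice → ∃ i a, v = l (Pi.single i a) := by
  classical
  have hf := hs.facet
  -- generators of level zero in `H`
  let W : Set N := {w | w ∈ X.gens ∧ w ∈ X.symLattice ∧ level s w = 0}
  have hWneg : ∀ w ∈ W, ∀ x ∈ s, co s x w ≠ 0 → co s x w = 1 ∨ co s x w = -1 :=
    fun w hw x hx h => (hs.co_cases hX hw.1 hw.2.1 hw.2.2 hx).resolve_left h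
  have hWW : ∀ w ∈ W, ∀ w' ∈ W, ∀ x ∈ s, co s x w ≠ 0 → co s x w' ≠ 0 → w' = w ∨ w' = -w :=
    fun w hw w' hw' x hx h h' =>
      hs.eq_or_eq_neg hX hw.1 hw.2.1 hw.2.2 hw'.1 hw'.2.1 hw'.2.2 hx h h'
  have hpm : ∀ {w w' x : N}, (w' = w ∨ w' = -w) → (co s x w' ≠ 0 ↔ co s x w ≠ 0) := by
    rintro w w' x (rfl | rfl) <;> simp
  -- The classes are the supports of the elements of `W`, and singletons. Transitivity holds because
  -- two overlapping supports belong to `w` and `±w`.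
  let r : Setoid (s.filter X.IsSym) :=
    { r := fun x y => x = y ∨ ∃ w ∈ W, co s x.1 w ≠ 0 ∧ co s y.1 w ≠ 0
      iseqv :=
        { refl := fun x => Or.inl rfl
          symm := by
            rintro x y (rfl | ⟨w, hw, h1, h2⟩)
            · exact Or.inl rfl
            · exact Or.inr ⟨w, hw, h2, h1⟩
          trans := by
            rintro x y z (rfl | ⟨w, hw, h1, h2⟩) (rfl | ⟨w', hw', h1', h2'⟩)
            · exact Or.inl rfl
            · exact Or.inr ⟨w', hw', h1', h2'⟩
            · exact Or.inr ⟨w, hw, h1, h2⟩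
            · refine Or.inr ⟨w, hw, h1, ?_⟩
              exact (hpm (hWW w hw w' hw' y (Finset.mem_filter.1 y.2).1 h2 h1')).1 h2' } }
  have hr : ∀ x y, r x y ↔ (x = y ∨ ∃ w ∈ W, co s x.1 w ≠ 0 ∧ co s y.1 w ≠ 0) := fun _ _ => Iff.rfl
  obtain ⟨k, d, E, hd, hE⟩ := exists_sigma_equiv r
  have hEs : ∀ p, (E p : N) ∈ s := fun p => (Finset.mem_filter.1 (E p).2).1
  have hEsym : ∀ p, X.IsSym (E p : N) := fun p => (Finset.mem_filter.1 (E p).2).2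
  -- signs
  have hsgn : ∃ sg : (Σ i : Fin k, Fin (d i)) → ℤ, (∀ p, sg p = 1 ∨ sg p = -1) ∧
      ∀ i, ((∃ w ∈ W, ∀ j, co s (E ⟨i, j⟩ : N) w = -sg ⟨i, j⟩) ∨
        ∀ w ∈ W, ∀ j, co s (E ⟨i, j⟩ : N) w = 0) := by
    have : ∀ i : Fin k, ∃ sg : Fin (d i) → ℤ, (∀ j, sg j = 1 ∨ sg j = -1) ∧
        ((∃ w ∈ W, ∀ j, co s (E ⟨i, j⟩ : N) w = -sg j) ∨
        ∀ w ∈ W, ∀ j, co s (E ⟨i, j⟩ : N) w = 0) := by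
      intro i
      by_cases h : ∃ w ∈ W, ∃ j, co s (E ⟨i, j⟩ : N) w ≠ 0
      · obtain ⟨w, hw, j, hj⟩ := h
        have hall : ∀ j', co s (E ⟨i, j'⟩ : N) w ≠ 0 := fun j' => by
          rcases (hr _ _).1 ((hE ⟨i, j⟩ ⟨i, j'⟩).2 rfl) with h | ⟨w', hw', h1, h2⟩
          · rw [← h]; exact hj
          · exact (hpm (hWW w hw w' hw' _ (hEs _) hj h1)).1 h2
        -- With these signs `w` becomes minus the sum of the signed basis of its block, the vector
        -- `e₀` of the standard model.
        refine ⟨fun j => -co s (E ⟨i, j⟩ : N) w, fun j' => ?_, Or.inl ⟨w, hw, fun j => by simp⟩⟩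
        rcases hWneg w hw _ (hEs _) (hall j') with h | h <;> simp [h]
      · push Not at h
        exact ⟨fun _ => 1, fun _ => Or.inl rfl, Or.inr fun w hw j => h w hw j⟩
    choose sg h1 h2 using this
    exact ⟨fun p => sg p.1 p.2, fun p => h1 _ _, h2⟩
  obtain ⟨sg, hsg, hblock⟩ := hsgn
  have hsq : ∀ p, sg p * sg p = 1 := fun p => by rcases hsg p with h | h <;> rw [h] <;> rfl
  let l : (∀ i, Fin (d i) → ℤ) →ₗ[ℤ] N :=
    ∑ p : (Σ i : Fin k, Fin (d i)), ((LinearMap.proj p.2).comp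
      (LinearMap.proj p.1 : (∀ i, Fin (d i) → ℤ) →ₗ[ℤ] (Fin (d p.1) → ℤ))).smulRight
        (sg p • (E p : N))
  have hl : ∀ a, l a = ∑ p : (Σ i : Fin k, Fin (d i)), a p.1 p.2 • (sg p • (E p : N)) := fun a => by
    simp [l]
  have hEE : ∀ p q, co s (E p : N) (E q) = if q = p then 1 else 0 := fun p q => by
    split_ifs with h
    · rw [h]; exact hf.co_self (hEs p)
    · exact hf.co_ne (hEs p) (hEs q) fun h2 => h (E.injective (Subtype.ext h2.symm))
  have hco : ∀ a p, co s (E p : N) (l a) = sg p * a p.1 p.2 := fun a p => by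
    rw [hl, map_sum, Finset.sum_eq_single p]
    · simp [hEE, mul_comm]
    · intro q _ hq; simp [hEE, hq]
    · simp
  have hinj : Function.Injective l := by
    rw [← LinearMap.ker_eq_bot, LinearMap.ker_eq_bot']
    intro a ha
    ext i j
    have := hco a ⟨i, j⟩
    rw [ha, map_zero] at this
    rcases hsg ⟨i, j⟩ with h | h <;> rw [h] at this <;> simpa using this.symm
  have hmemH : ∀ a, l a ∈ X.symLattice := fun a => by
    rw [hl]
    exact Submodule.sum_mem _ fun p _ => Submodule.smul_mem _ _ (Submodule.smul_mem _ _
      (hEsym p).mem_symLattice)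
  have hext : ∀ v w, v ∈ X.symLattice → w ∈ X.symLattice →
      (∀ p, co s (E p : N) v = co s (E p : N) w) → v = w := fun v w hv hw h => by
    refine hf.eq_of_co fun x hx => ?_
    by_cases hxs : X.IsSym x
    · have := h (E.symm ⟨x, Finset.mem_filter.2 ⟨hx, hxs⟩⟩)
      simpa using this
    · rw [hs.co_eq_zero x hx hxs v hv, hs.co_eq_zero x hx hxs w hw]
  have hsurj : ∀ v ∈ X.symLattice, l (fun i j => sg ⟨i, j⟩ * co s (E ⟨i, j⟩ : N) v) = v :=
    fun v hv => hext _ _ (hmemH _) hv fun p => by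
      rw [hco, ← mul_assoc]
      change sg p * sg p * co s (E p : N) v = _
      rw [hsq, one_mul]
  have hsingle : ∀ i j, l (Pi.single i (Pi.single j 1)) = sg ⟨i, j⟩ • (E ⟨i, j⟩ : N) := by
    intro i j
    rw [hl, Finset.sum_eq_single ⟨i, j⟩]
    · simp
    · rintro ⟨i', j'⟩ _ hne
      by_cases hi : i' = i
      · subst hi
        have : j' ≠ j := fun h => hne (by rw [h])
        simp [this]
      · simp [Pi.single_eq_of_ne hi]
    · simp
  have hgen : ∀ p, sg p • (E p : N) ∈ X.gens ∧ -(sg p • (E p : N)) ∈ X.gens := fun p => by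
    rcases hsg p with h | h <;> rw [h]
    · simpa [SmoothFan.IsSym] using hEsym p
    · simpa [SmoothFan.IsSym] using (hEsym p).neg
  -- the generators
  have hcases : ∀ v ∈ X.gens, v ∈ X.symLattice →
      (∃ p, v = sg p • (E p : N) ∨ v = -(sg p • (E p : N))) ∨ v ∈ W := by
    intro v hv hvH
    have key : ∀ x ∈ s, X.IsSym x → ∃ p, x = sg p • (E p : N) ∨ x = -(sg p • (E p : N)) := by
      intro x hx hxs
      refine ⟨E.symm ⟨x, Finset.mem_filter.2 ⟨hx, hxs⟩⟩, ?_⟩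
      rcases hsg (E.symm ⟨x, Finset.mem_filter.2 ⟨hx, hxs⟩⟩) with h | h <;> rw [h] <;> simp
    rcases hs.level_eq_zero v hv hvH with h | h | h
    · exact Or.inl (key v h (hs.isSym h hvH))
    · obtain ⟨p, hp⟩ := key (-v) h (hs.isSym h (Submodule.neg_mem _ hvH))
      refine Or.inl ⟨p, ?_⟩
      rcases hp with hp | hp
      · right; rw [← hp, neg_neg]
      · left; exact neg_injective hp
    · exact Or.inr ⟨hv, hvH, h⟩
  have hWblock : ∀ w ∈ W, ∃ i, (∀ j, co s (E ⟨i, j⟩ : N) w ≠ 0) ∧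
      ∀ p, p.1 ≠ i → co s (E p : N) w = 0 := by
    intro w hw
    obtain ⟨x, hx, hxw⟩ := hf.exists_neg_of_ne hw.2.2 (X.ne_zero_of_mem_gens hw.1)
    have hxs := hs.isSym_of_co_ne hw.2.1 hx hxw.ne
    obtain ⟨⟨i, j⟩, hp⟩ := E.surjective ⟨x, Finset.mem_filter.2 ⟨hx, hxs⟩⟩
    have hij : co s (E ⟨i, j⟩ : N) w ≠ 0 := by rw [hp]; exact hxw.ne
    refine ⟨i, fun j' => ?_, fun p hpi => ?_⟩
    · rcases (hr _ _).1 ((hE ⟨i, j⟩ ⟨i, j'⟩).2 rfl) with h | ⟨w', hw', h1, h2⟩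
      · rw [← h]; exact hij
      · exact (hpm (hWW w hw w' hw' _ (hEs _) hij h1)).1 h2
    · by_contra hne
      exact hpi ((hE p ⟨i, j⟩).1 ((hr _ _).2 (Or.inr ⟨w, hw, hne, hij⟩)))
  have hsum : ∀ i, l (Pi.single i (∑ j, Pi.single j 1)) = ∑ j, sg ⟨i, j⟩ • (E ⟨i, j⟩ : N) := by
    intro i
    have : (Pi.single i (∑ j, Pi.single j 1) : ∀ i, Fin (d i) → ℤ) =
        ∑ j, Pi.single i (Pi.single j 1) :=
      map_sum (AddMonoidHom.single (fun i => Fin (d i) → ℤ) i) _ _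
    rw [this, map_sum]
    exact Finset.sum_congr rfl fun j _ => hsingle i j
  have hWeq : ∀ i w, w ∈ W → (∀ j, co s (E ⟨i, j⟩ : N) w = -sg ⟨i, j⟩) →
      w = -l (Pi.single i (∑ j, Pi.single j 1)) := by
    intro i w hw h
    refine hext _ _ hw.2.1 (Submodule.neg_mem _ (hmemH _)) fun p => ?_
    rw [map_neg, hco]
    obtain ⟨i', hi', hi0⟩ := hWblock w hw
    have hii : i' = i := by
      by_contra hne
      have h1 := hi0 ⟨i, ⟨0, hd i⟩⟩ (Ne.symm hne)
      rw [h] at h1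
      have := hsq ⟨i, ⟨0, hd i⟩⟩
      rw [neg_eq_zero.1 h1] at this
      norm_num at this
    subst hii
    obtain ⟨i, j⟩ := p
    by_cases hne : i = i'
    · subst hne
      rw [h]
      simp [Finset.sum_apply]
    · rw [hi0 _ hne]
      simp [Pi.single_eq_of_ne hne]
  refine ⟨k, d, l, hinj, ?_, fun i => ?_, fun v hv hvH => ?_⟩
  · ext v
    exact ⟨by rintro ⟨a, rfl⟩; exact hmemH a, fun hv => ⟨_, hsurj v hv⟩⟩
  · have hneg : ∀ a : Fin (d i) → ℤ, l (Pi.single i (-a)) = -l (Pi.single i a) := fun a => by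
      rw [Pi.single_neg, map_neg]
    have hsub1 : ∀ j, (Pi.single j 1 : Fin (d i) → ℤ) ∈ {a | l (Pi.single i a) ∈ X.gens} ∧
        (-Pi.single j 1 : Fin (d i) → ℤ) ∈ {a | l (Pi.single i a) ∈ X.gens} := fun j => by
      rw [Set.mem_ofPred_eq, Set.mem_ofPred_eq, hneg, hsingle]
      exact hgen _
    have hinj' : ∀ a b : Fin (d i) → ℤ, l (Pi.single i a) = l (Pi.single i b) → a = b :=
      fun a b h => Pi.single_injective i (hinj h)
    -- elements of the block that are not on level zero
    have hcase1 : ∀ a : Fin (d i) → ℤ, ∀ p, (l (Pi.single i a) = sg p • (E p : N) ∨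
        l (Pi.single i a) = -(sg p • (E p : N))) →
        ∃ j, a = Pi.single j 1 ∨ a = -Pi.single j 1 := by
      rintro a ⟨i', j⟩ h
      have hi : i' = i := by
        by_contra hne
        rw [← hsingle, ← map_neg] at h
        rcases h with h | h
        · have := congrFun (congrFun (hinj h) i') j
          simp [Pi.single_eq_of_ne hne] at this
        · have := congrFun (congrFun (hinj h) i') j
          simp [Pi.single_eq_of_ne hne] at this
      subst hi
      rw [← hsingle, ← hneg] at h
      exact ⟨j, h.imp (hinj' _ _) (hinj' _ _)⟩
    rcases hblock i with ⟨w, hw, hwi⟩ | hno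
    · have hwl := hWeq i w hw hwi
      -- Level zero says that the signs sum to zero over the block.
      have heven : Even (d i) := by
        have h1 : ∑ j, sg ⟨i, j⟩ = 0 := by
          have h2 := hw.2.2
          rw [hwl, hsum, map_neg, map_sum, neg_eq_zero] at h2
          rw [← h2]
          refine Finset.sum_congr rfl fun j _ => ?_
          rw [map_smul, hf.level_self (hEs _)]; simp
        have := even_card_of_sum_eq_zero (s := Finset.univ) (fun j _ => hsg ⟨i, j⟩) h1
        simpa using this
      have hmw : (-∑ j, Pi.single j 1 : Fin (d i) → ℤ) ∈ {a | l (Pi.single i a) ∈ X.gens} := by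
        rw [Set.mem_ofPred_eq, hneg, ← hwl]; exact hw.1
      have hcase2 : ∀ a : Fin (d i) → ℤ, l (Pi.single i a) ∈ W →
          a = -∑ j, Pi.single j 1 ∨ a = ∑ j, Pi.single j 1 := by
        intro a ha
        obtain ⟨i', hi', -⟩ := hWblock _ ha
        have hii : i' = i := by
          by_contra hne
          apply hi' ⟨0, hd i'⟩
          rw [hco]
          simp [Pi.single_eq_of_ne hne]
        subst hii
        have hw0 : co s (E ⟨i', ⟨0, hd i'⟩⟩ : N) w ≠ 0 := by
          rw [hwi]
          rcases hsg ⟨i', ⟨0, hd i'⟩⟩ with h | h <;> rw [h] <;> norm_num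
        rcases hWW w hw _ ha _ (hEs _) hw0 (hi' ⟨0, hd i'⟩) with h | h
        · left
          rw [hwl, ← hneg] at h
          exact hinj' _ _ h
        · right
          rw [hwl, neg_neg] at h
          exact hinj' _ _ h
      by_cases hpos : l (Pi.single i (∑ j, Pi.single j 1)) ∈ X.gens
      · left
        refine ⟨hd i, heven, Set.Subset.antisymm ?_ ?_⟩
        · intro a ha
          rcases hcases _ ha (hmemH _) with ⟨p, hp⟩ | h
          · exact Or.inl (hcase1 a p hp)
          · exact Or.inr (hcase2 a h)
        · rintro a (⟨j, rfl | rfl⟩ | rfl | rfl)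
          · exact (hsub1 j).1
          · exact (hsub1 j).2
          · exact hmw
          · exact hpos
      · right; left
        refine ⟨hd i, heven, Set.Subset.antisymm ?_ ?_⟩
        · intro a ha
          rcases hcases _ ha (hmemH _) with ⟨p, hp⟩ | h
          · exact Or.inl (hcase1 a p hp)
          · rcases hcase2 a h with h | rfl
            · exact Or.inr h
            · exact absurd ha hpos
        · rintro a (⟨j, rfl | rfl⟩ | rfl)
          · exact (hsub1 j).1
          · exact (hsub1 j).2
          · exact hmw
    · right; right
      -- Two different elements of a class lie in a common support, which this block does not have.
      have h1 : d i = 1 := by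
        by_contra hne
        have h2 := hd i
        rcases (hr _ _).1 ((hE ⟨i, ⟨0, hd i⟩⟩ ⟨i, ⟨1, by omega⟩⟩).2 rfl) with h | ⟨w, hw, h, -⟩
        · have := E.injective h
          simp at this
        · exact h (hno w hw _)
      have hone : ∀ j, (Pi.single j 1 : Fin (d i) → ℤ) = 1 := fun j => by
        ext j'
        have : j' = j := Fin.ext (by omega)
        subst this
        simp
      refine ⟨h1, Set.Subset.antisymm ?_ ?_⟩
      · intro a ha
        rcases hcases _ ha (hmemH _) with ⟨p, hp⟩ | h
        · obtain ⟨j, hj⟩ := hcase1 a p hp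
          rw [hone] at hj
          exact hj
        · obtain ⟨i', hi', hi0⟩ := hWblock _ h
          have hii : i' = i := by
            by_contra hne
            apply hi' ⟨0, hd i'⟩
            rw [hco]
            simp [Pi.single_eq_of_ne hne]
          subst hii
          exact absurd (hno _ h ⟨0, hd i'⟩) (hi' _)
      · rintro a (rfl | rfl)
        · rw [← hone ⟨0, hd i⟩]; exact (hsub1 _).1
        · rw [← hone ⟨0, hd i⟩]; exact (hsub1 _).2
  · rcases hcases v hv hvH with ⟨⟨i, j⟩, h | h⟩ | hw
    · exact ⟨i, Pi.single j 1, by rw [hsingle, h]⟩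
    · exact ⟨i, -Pi.single j 1, by rw [Pi.single_neg, map_neg, hsingle, h]⟩
    · obtain ⟨i, hi, hi0⟩ := hWblock v hw
      refine ⟨i, fun j => sg ⟨i, j⟩ * co s (E ⟨i, j⟩ : N) v, hext _ _ hvH (hmemH _) fun p => ?_⟩
      rw [hco]
      obtain ⟨i', j⟩ := p
      by_cases hne : i' = i
      · subst hne
        rw [Pi.single_eq_same, ← mul_assoc, hsq, one_mul]
      · rw [hi0 _ hne]
        simp [Pi.single_eq_of_ne hne]

end Blocks
end Toric

namespace Toric

/-! ### Fans of faces of smooth Fano polytopes; the standard configurations. -/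

section FaceFans

variable {N M : Type} [AddCommGroup N] [AddCommGroup M]

/-- The set `G` of lattice vectors is the set of vertices of a smooth Fano polytope. -/
structure IsFanoConfig (G : Set N) : Prop where
  finite : G.Finite
  unimodular : ∀ f : N →ₗ[ℤ] ℤ, (∀ x ∈ G, f x ≤ 1) →
    ∃ (ι : Type) (b : Module.Basis ι ℤ N), ∀ x ∈ G, f x = 1 → x ∈ Set.range b
  complete : ∀ v : N, ∃ f : N →ₗ[ℤ] ℤ, (∀ x ∈ G, f x ≤ 1) ∧
    v ∈ AddSubmonoid.closure {x | x ∈ G ∧ f x = 1}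
  vertex : ∀ x ∈ G, ∃ f : N →ₗ[ℤ] ℤ, (∀ x ∈ G, f x ≤ 1) ∧ f x = 1

namespace IsFanoConfig

variable {G : Set N}

/-- Write a common vector as `∑ a x • x` over `s` and `∑ b y • y` over `t`. Evaluating `f` and `g`
gives `∑ a = ∑ b * f ≤ ∑ b = ∑ a * g ≤ ∑ a`, so every `y` with `b y ≠ 0` lies on the face `f = 1`.
There uniqueness of coordinates puts `y` in `s`. -/
lemma cone_inter_le (hG : IsFanoConfig G) {s t : Finset N} (hs : ∀ x ∈ s, x ∈ G)
    (ht : ∀ x ∈ t, x ∈ G) {f g : N →ₗ[ℤ] ℤ} (hf : ∀ x ∈ G, f x ≤ 1) (hfs : ∀ x ∈ s, f x = 1)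
    (hg : ∀ x ∈ G, g x ≤ 1) (hgt : ∀ x ∈ t, g x = 1) :
    cone (s : Set N) ⊓ cone (t : Set N) ≤ cone ((s : Set N) ∩ (t : Set N)) := by
  classical
  rintro v ⟨hvs, hvt⟩
  obtain ⟨a, ha, hva⟩ := mem_cone_iff.1 hvs
  obtain ⟨b, hb, hvb⟩ := mem_cone_iff.1 hvt
  have key : ∀ u : N →ₗ[ℤ] ℤ, ∑ x ∈ s, a x * u x = ∑ y ∈ t, b y * u y := fun u => by
    have := congrArg (extendForm (ratForm u)) (hva.symm.trans hvb)
    simpa using this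
  have e1 := key f
  have e2 := key g
  rw [Finset.sum_congr rfl (g := a) (fun x hx => by simp [hfs x hx])] at e1
  rw [Finset.sum_congr rfl (s₂ := t) (g := b) (fun x hx => by simp [hgt x hx])] at e2
  have l2 : ∑ x ∈ s, a x * g x ≤ ∑ x ∈ s, a x := Finset.sum_le_sum fun x hx => by
    have : (g x : ℚ) ≤ 1 := by exact_mod_cast hg x (hs x hx)
    nlinarith [ha x]
  have l1 : ∀ y ∈ t, b y * f y ≤ b y := fun x hx => by
    have : (f x : ℚ) ≤ 1 := by exact_mod_cast hf x (ht x hx)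
    nlinarith [hb x]
  have heq := (Finset.sum_eq_sum_iff_of_le l1).1
    (le_antisymm (Finset.sum_le_sum l1) (by rw [← e1, ← e2]; exact l2))
  have hft : ∀ y ∈ t, b y ≠ 0 → f y = 1 := fun y hy hby => by
    have := mul_left_cancel₀ hby ((heq y hy).trans (mul_one _).symm)
    exact_mod_cast this
  obtain ⟨ι, B, hB⟩ := hG.unimodular f hf
  obtain ⟨d, d1, d0⟩ := exists_dual_of_basis (s := s ∪ t.filter (fun y => b y ≠ 0))
    ⟨ι, B, fun x hx => by
      rcases Finset.mem_union.1 (Finset.mem_coe.1 hx) with h | h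
      · exact hB x (hs x h) (hfs x h)
      · have h' := Finset.mem_filter.1 h
        exact hB x (ht x h'.1) (hft x h'.1 h'.2)⟩
  have hts : ∀ y ∈ t, b y ≠ 0 → y ∈ s := fun y hy hby => by
    by_contra hys
    have hyt : y ∈ s ∪ t.filter (fun y => b y ≠ 0) :=
      Finset.mem_union_right _ (Finset.mem_filter.2 ⟨hy, hby⟩)
    have h := key (d y)
    rw [Finset.sum_eq_zero, Finset.sum_eq_single_of_mem y hy, d1 y hyt] at h
    · exact hby (by simpa using h.symm)
    · intro z hz hzy
      by_cases hbz : b z = 0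
      · simp [hbz]
      · rw [d0 y hyt z (Finset.mem_union_right _ (Finset.mem_filter.2 ⟨hz, hbz⟩)) hzy.symm]; simp
    · intro x hx
      rw [d0 y hyt x (Finset.mem_union_left _ hx) (by rintro rfl; exact hys hx)]; simp
  rw [← Finset.coe_inter, mem_cone_iff]
  refine ⟨b, hb, ?_⟩
  rw [hvb]
  symm
  refine Finset.sum_subset Finset.inter_subset_right fun y hy hy' => ?_
  have : b y = 0 := by
    by_contra h
    exact hy' (Finset.mem_inter.2 ⟨hts y hy h, hy⟩)
  simp [this]

/-- The fan of the faces of a smooth Fano polytope. -/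
def fan (hG : IsFanoConfig G) : SmoothFan N where
  cones := {s | (∀ x ∈ s, x ∈ G) ∧ ∃ f : N →ₗ[ℤ] ℤ, (∀ x ∈ G, f x ≤ 1) ∧ ∀ x ∈ s, f x = 1}
  finite_cones := by
    refine hG.finite.toFinset.powerset.finite_toSet.subset fun s hs => ?_
    exact Finset.mem_coe.2 (Finset.mem_powerset.2 fun x hx => hG.finite.mem_toFinset.2 (hs.1 x hx))
  empty_mem := ⟨fun x hx => by simp at hx, 0, by simp, by simp⟩
  face_mem := fun hs hts => ⟨fun x hx => hs.1 x (hts hx), hs.2.imp fun f hf =>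
    ⟨hf.1, fun x hx => hf.2 x (hts hx)⟩⟩
  unimodular := fun hs => by
    obtain ⟨hsG, f, hf, hfs⟩ := hs
    obtain ⟨ι, b, hb⟩ := hG.unimodular f hf
    exact ⟨ι, b, fun x hx => hb x (hsG x hx) (hfs x hx)⟩
  inter := fun hs ht => by
    obtain ⟨hsG, f, hf, hfs⟩ := hs
    obtain ⟨htG, g, hg, hgt⟩ := ht
    refine le_antisymm (hG.cone_inter_le hsG htG hf hfs hg hgt) (le_inf ?_ ?_)
    · exact Submodule.span_mono (Set.image_mono Set.inter_subset_left)
    · exact Submodule.span_mono (Set.image_mono Set.inter_subset_right)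

lemma gens_fan (hG : IsFanoConfig G) : hG.fan.gens = G := by
  ext x
  constructor
  · intro h
    exact h.1 x (Finset.mem_singleton_self x)
  · intro h
    obtain ⟨f, hf, hfx⟩ := hG.vertex x h
    exact ⟨fun y hy => by rw [Finset.mem_singleton.1 hy]; exact h, f, hf,
      fun y hy => by rw [Finset.mem_singleton.1 hy]; exact hfx⟩

lemma isFano_fan (hG : IsFanoConfig G) : hG.fan.IsFano := by
  classical
  rw [SmoothFan.isFano_iff, SmoothFan.isComplete_iff]
  constructor
  · intro v
    obtain ⟨f, hf, hv⟩ := hG.complete v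
    refine ⟨hG.finite.toFinset.filter fun x => f x = 1, ⟨fun x hx => ?_, f, hf, fun x hx => ?_⟩, ?_⟩
    · exact hG.finite.mem_toFinset.1 (Finset.mem_filter.1 hx).1
    · exact (Finset.mem_filter.1 hx).2
    · have : ((hG.finite.toFinset.filter fun x => f x = 1 : Finset N) : Set N) =
          {x | x ∈ G ∧ f x = 1} := by ext; simp
      rw [this]
      refine AddSubmonoid.closure_induction (motive := fun v _ => toNQ N v ∈ cone {x | x ∈ G ∧ f x = 1})
        (fun x hx => Submodule.subset_span ⟨x, hx, rfl⟩) ?_ (fun x y _ _ hx hy => ?_) hv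
      · rw [map_zero]; exact Submodule.zero_mem _
      · rw [map_add]; exact Submodule.add_mem _ hx hy
  · rintro s ⟨hsG, f, hf, hfs⟩
    obtain ⟨ι, b, hb⟩ := hG.unimodular f hf
    obtain ⟨m, m0, m1⟩ := exists_face_form (s := hG.finite.toFinset.filter fun x => f x = 1) (t := s)
      b fun x hx => by
        have := Finset.mem_filter.1 (Finset.mem_coe.1 hx)
        exact hb x (hG.finite.mem_toFinset.1 this.1) this.2
    -- The form `f` may equal `1` outside `s`. Subtracting `m / K` lowers it there by `1 / K` and
    -- leaves it on `s`; off the face `f ≤ 0`, and `K` exceeds every `-m x`, so the value stays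
    -- below `1`.
    set K : ℤ := 1 + ∑ x ∈ hG.finite.toFinset, |m x| with hK
    have hKpos : 0 < K := by
      have : 0 ≤ ∑ x ∈ hG.finite.toFinset, |m x| := Finset.sum_nonneg fun x _ => abs_nonneg _
      omega
    have hKm : ∀ x ∈ G, -m x < K := fun x hx => by
      have := Finset.single_le_sum (f := fun x => |m x|) (fun x _ => abs_nonneg _)
        (hG.finite.mem_toFinset.2 hx)
      have h2 := neg_le_abs (m x)
      omega
    have hKQ : (0 : ℚ) < K := by exact_mod_cast hKpos
    refine ⟨ratForm f - (K : ℚ)⁻¹ • ratForm m, fun x hx => ?_, fun x hx hxs => ?_⟩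
    · have h1 := m0 x (Finset.mem_filter.2 ⟨hG.finite.mem_toFinset.2 (hsG x hx), hfs x hx⟩) hx
      simp [hfs x hx, h1]
    · rw [gens_fan] at hx
      simp only [LinearMap.sub_apply, LinearMap.smul_apply, ratForm_apply, smul_eq_mul]
      by_cases h1 : f x = 1
      · have h2 := m1 x (Finset.mem_filter.2 ⟨hG.finite.mem_toFinset.2 hx, h1⟩) hxs
        rw [h1, h2]
        have : 0 < (K : ℚ)⁻¹ := inv_pos.2 hKQ
        push_cast
        linarith
      · have h2 : f x ≤ 0 := by have := hf x hx; omega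
        have h3 : (f x : ℚ) ≤ 0 := by exact_mod_cast h2
        have h4 : -(m x : ℚ) < K := by exact_mod_cast hKm x hx
        have h5 : (K : ℚ)⁻¹ * -(m x : ℚ) < 1 := by
          rw [inv_mul_lt_iff₀ hKQ, mul_one]; exact h4
        linarith

lemma map (hG : IsFanoConfig G) (e : N ≃ₗ[ℤ] M) : IsFanoConfig (e '' G) where
  finite := hG.finite.image _
  unimodular := fun f hf => by
    obtain ⟨ι, b, hb⟩ := hG.unimodular (f.comp e.toLinearMap) fun x hx => hf _ ⟨x, hx, rfl⟩
    refine ⟨ι, b.map e, ?_⟩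
    rintro _ ⟨x, hx, rfl⟩ hfx
    obtain ⟨i, hi⟩ := hb x hx hfx
    exact ⟨i, by rw [Module.Basis.map_apply, hi]⟩
  complete := fun v => by
    obtain ⟨f, hf, hv⟩ := hG.complete (e.symm v)
    refine ⟨f.comp e.symm.toLinearMap, ?_, ?_⟩
    · rintro _ ⟨x, hx, rfl⟩
      simpa using hf x hx
    · have := AddSubmonoid.mem_map_of_mem (e : N →+ M) hv
      rw [AddMonoidHom.map_mclosure] at this
      have h2 : (e : N →+ M) (e.symm v) = v := e.apply_symm_apply v
      rw [h2] at this
      refine AddSubmonoid.closure_mono ?_ this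
      rintro _ ⟨x, hx, rfl⟩
      exact ⟨⟨x, hx.1, rfl⟩, by simpa using hx.2⟩
  vertex := by
    rintro _ ⟨x, hx, rfl⟩
    obtain ⟨f, hf, hfx⟩ := hG.vertex x hx
    refine ⟨f.comp e.symm.toLinearMap, ?_, by simpa using hfx⟩
    rintro _ ⟨x, hx, rfl⟩
    simpa using hf x hx

/-- The product of smooth Fano polytopes (more precisely, their free sum). -/
lemma pi {ι : Type} [Fintype ι] [DecidableEq ι] {L : ι → Type} [∀ i, AddCommGroup (L i)]
    {G : ∀ i, Set (L i)} (hG : ∀ i, IsFanoConfig (G i)) :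
    IsFanoConfig {v : ∀ i, L i | ∃ i, ∃ a ∈ G i, v = Pi.single i a} where
  finite := by
    have : {v : ∀ i, L i | ∃ i, ∃ a ∈ G i, v = Pi.single i a} = ⋃ i, Pi.single i '' G i := by
      ext v; simp [eq_comm]
    rw [this]
    exact Set.finite_iUnion fun i => (hG i).finite.image _
  unimodular := fun f hf => by
    have := fun i => (hG i).unimodular (f.comp (LinearMap.single ℤ L i)) fun x hx =>
      hf _ ⟨i, x, hx, rfl⟩
    choose κ b hb using this
    refine ⟨_, Pi.basis b, ?_⟩
    rintro _ ⟨i, a, ha, rfl⟩ hfa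
    obtain ⟨j, hj⟩ := hb i a ha hfa
    exact ⟨⟨i, j⟩, by rw [Pi.basis_apply, hj]⟩
  complete := fun v => by
    have := fun i => (hG i).complete (v i)
    choose f hf hv using this
    have hfs : ∀ i a, (∑ i, (f i).comp (LinearMap.proj i : (∀ i, L i) →ₗ[ℤ] L i))
        (Pi.single i a) = f i a := fun i a => by
      rw [LinearMap.sum_apply, Finset.sum_eq_single i]
      · simp
      · intro j _ hj; simp [Pi.single_eq_of_ne hj]
      · simp
    refine ⟨∑ i, (f i).comp (LinearMap.proj i), ?_, ?_⟩
    · rintro _ ⟨i, a, ha, rfl⟩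
      rw [hfs]; exact hf i a ha
    · rw [← Finset.univ_sum_single v]
      refine AddSubmonoid.sum_mem _ fun i _ => ?_
      have := AddSubmonoid.mem_map_of_mem (AddMonoidHom.single L i) (hv i)
      rw [AddMonoidHom.map_mclosure] at this
      refine AddSubmonoid.closure_mono ?_ this
      rintro _ ⟨x, hx, rfl⟩
      exact ⟨⟨i, x, hx.1, rfl⟩, (hfs i x).trans hx.2⟩
  vertex := by
    rintro _ ⟨i, a, ha, rfl⟩
    obtain ⟨f, hf, hfa⟩ := (hG i).vertex a ha
    refine ⟨f.comp (LinearMap.proj i), ?_, by simpa using hfa⟩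
    rintro _ ⟨j, b, hb, rfl⟩
    by_cases h : j = i
    · subst h; simpa using hf b hb
    · simp [Pi.single_eq_of_ne (Ne.symm h)]

end IsFanoConfig

/-! ### Del Pezzo and pseudo Del Pezzo configurations -/

variable {h : ℕ}

/-- The linear form on `ℤ^h` with the values `g` on the standard basis. -/
def sumForm (g : Fin h → ℤ) : (Fin h → ℤ) →ₗ[ℤ] ℤ := ∑ i, g i • LinearMap.proj i

lemma sumForm_apply (g v : Fin h → ℤ) : sumForm g v = ∑ i, g i * v i := by
  simp [sumForm]

@[simp] lemma sumForm_single (g : Fin h → ℤ) (i : Fin h) : sumForm g (Pi.single i 1) = g i := by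
  rw [sumForm_apply, Finset.sum_eq_single i]
  · simp
  · intro j _ hj; simp [Pi.single_eq_of_ne hj]
  · simp

/-- A form that realizes the median splitting of the entries `0, v 0, …, v (h - 1)`. -/
lemma exists_median (he : Even h) (v : Fin h → ℤ) : ∃ (g : Fin (h + 1) → ℤ) (m : ℤ),
    (∀ i, g i = 1 ∨ g i = 0 ∨ g i = -1) ∧ ∑ i, g i = 0 ∧
    (∀ i, g i = 1 → m ≤ (Fin.cons 0 v : Fin (h + 1) → ℤ) i) ∧
    (∀ i, g i = -1 → (Fin.cons 0 v : Fin (h + 1) → ℤ) i ≤ m) ∧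
    ∀ i, g i = 0 → (Fin.cons 0 v : Fin (h + 1) → ℤ) i = m := by
  obtain ⟨k, hk⟩ := he
  set w : Fin (h + 1) → ℤ := Fin.cons 0 v with hw
  set σ := Tuple.sort w with hσ
  have hmono : Monotone (w ∘ σ) := Tuple.monotone_sort w
  let k' : Fin (h + 1) := ⟨k, by omega⟩
  have hpos : ∀ i, w i = (w ∘ σ) (σ.symm i) := fun i => by simp
  -- There are `h + 1 = 2 * k + 1` entries. After sorting, `g` is the sign of the position relative
  -- to the middle one, whose entry is `m`.
  refine ⟨fun i => Int.sign ((σ.symm i : ℕ) - k : ℤ), w (σ k'), fun i => ?_, ?_, fun i hi => ?_,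
    fun i hi => ?_, fun i hi => ?_⟩
  · dsimp only
    rcases lt_trichotomy ((σ.symm i : ℕ) - k : ℤ) 0 with h | h | h
    · rw [Int.sign_eq_neg_one_of_neg h]; simp
    · rw [h]; simp
    · rw [Int.sign_eq_one_of_pos h]; simp
  · rw [Equiv.sum_comp σ.symm (fun j : Fin (h + 1) => Int.sign ((j : ℕ) - k : ℤ))]
    -- Reversing the order changes the sign of every term.
    have h1 : ∑ j : Fin (h + 1), Int.sign ((j : ℕ) - k : ℤ) =
        -∑ j : Fin (h + 1), Int.sign ((j : ℕ) - k : ℤ) := by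
      conv_lhs => rw [← Equiv.sum_comp Fin.revPerm]
      rw [← Finset.sum_neg_distrib]
      refine Finset.sum_congr rfl fun j _ => ?_
      rw [← Int.sign_neg]
      congr 1
      have hj := j.2
      simp only [Fin.revPerm_apply, Fin.val_rev]
      omega
    omega
  · rw [hpos i]
    refine hmono (Fin.le_def.2 ?_)
    have := Int.sign_eq_one_iff_pos.1 hi
    change k ≤ _
    omega
  · rw [hpos i]
    refine hmono (Fin.le_def.2 ?_)
    have := Int.sign_eq_neg_one_iff_neg.1 hi
    change _ ≤ k
    omega
  · rw [hpos i]
    have := Int.sign_eq_zero_iff_zero.1 hi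
    have h2 : σ.symm i = k' := Fin.ext (by change _ = k; omega)
    rw [h2]; rfl

lemma zsmul_mem_closure {S : Set N} {x : N} {c : ℤ} (hc : 0 ≤ c) (hx : c = 0 ∨ x ∈ S) :
    c • x ∈ AddSubmonoid.closure S := by
  rcases hx with rfl | hx
  · rw [zero_smul]; exact AddSubmonoid.zero_mem _
  · lift c to ℕ using hc
    rw [natCast_zsmul]
    exact AddSubmonoid.nsmul_mem _ (AddSubmonoid.subset_closure hx) _

/-- At most one of `±e_i` lies on `f = 1`; the signs of the basis are chosen accordingly. -/
lemma exists_basis_cross (f : (Fin h → ℤ) →ₗ[ℤ] ℤ) :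
    ∃ b : Module.Basis (Fin h) ℤ (Fin h → ℤ), ∀ i, (f (Pi.single i 1) = 1 → Pi.single i 1 ∈ Set.range b) ∧
      (f (-Pi.single i 1) = 1 → -Pi.single i 1 ∈ Set.range b) := by
  classical
  refine ⟨(Pi.basisFun ℤ (Fin h)).unitsSMul fun i => if f (Pi.single i 1) = 1 then 1 else -1,
    fun i => ⟨fun h1 => ⟨i, ?_⟩, fun h1 => ⟨i, ?_⟩⟩⟩
  · simp [Module.Basis.unitsSMul_apply, h1]
  · rw [map_neg] at h1
    have : ¬ f (Pi.single i 1) = 1 := by omega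
    simp [Module.Basis.unitsSMul_apply, this]

/-- The vector `e₀ = -e₁ - ⋯ - e_h`. -/
def negSum (h : ℕ) : Fin h → ℤ := -∑ i, Pi.single i 1

lemma negSum_apply (i : Fin h) : negSum h i = -1 := by
  simp [negSum, Finset.sum_apply]

/-- As `f` vanishes at `±e_j`, neither lies on the face, and `e_j` can make room for `e₀`. The
involution `R` sends `e_j` to `e₀` and fixes the other basis vectors. -/
lemma exists_basis_negSum (f : (Fin h → ℤ) →ₗ[ℤ] ℤ) {j : Fin h} (hj : f (Pi.single j 1) = 0) :
    ∃ b : Module.Basis (Fin h) ℤ (Fin h → ℤ), (∀ i, (f (Pi.single i 1) = 1 → Pi.single i 1 ∈ Set.range b) ∧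
      (f (-Pi.single i 1) = 1 → -Pi.single i 1 ∈ Set.range b)) ∧
      (f (negSum h) = 1 → negSum h ∈ Set.range b) ∧
      (f (-negSum h) = 1 → -negSum h ∈ Set.range b) := by
  classical
  let R : (Fin h → ℤ) →ₗ[ℤ] (Fin h → ℤ) :=
    LinearMap.id + (LinearMap.proj j : (Fin h → ℤ) →ₗ[ℤ] ℤ).smulRight (negSum h - Pi.single j 1)
  have hR : ∀ v, R v = v + v j • (negSum h - Pi.single j 1) := fun v => rfl
  have hinv : Function.Involutive R := fun v => by
    rw [hR (R v), hR v]
    simp only [Pi.add_apply, Pi.smul_apply, Pi.sub_apply, negSum_apply, Pi.single_eq_same,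
      smul_eq_mul]
    rw [add_assoc, ← add_smul]
    have : v j + (v j + v j * (-1 - 1)) = 0 := by ring
    rw [this, zero_smul, add_zero]
  let e : (Fin h → ℤ) ≃ₗ[ℤ] (Fin h → ℤ) := LinearEquiv.ofInvolutive R hinv
  have he : ∀ v, e v = R v := fun v => rfl
  have hej : e (Pi.single j 1) = negSum h := by rw [he, hR]; simp
  have hei : ∀ i, i ≠ j → e (Pi.single i 1) = Pi.single i 1 := fun i hi => by
    rw [he, hR, Pi.single_eq_of_ne hi.symm]; simp
  let ε : Fin h → ℤˣ := fun i => if i = j then (if f (negSum h) = 1 then 1 else -1) else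
    if f (Pi.single i 1) = 1 then 1 else -1
  refine ⟨((Pi.basisFun ℤ (Fin h)).map e).unitsSMul ε,
    fun i => ⟨fun h1 => ⟨i, ?_⟩, fun h1 => ⟨i, ?_⟩⟩, fun h1 => ⟨j, ?_⟩, fun h1 => ⟨j, ?_⟩⟩
  · have hij : i ≠ j := by rintro rfl; omega
    simp [Module.Basis.unitsSMul_apply, h1, ε, hij, hei]
  · rw [map_neg] at h1
    have hij : i ≠ j := by rintro rfl; omega
    have : ¬ f (Pi.single i 1) = 1 := by omega
    simp [Module.Basis.unitsSMul_apply, this, ε, hij, hei]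
  · simp [Module.Basis.unitsSMul_apply, h1, ε, hej]
  · rw [map_neg] at h1
    have : ¬ f (negSum h) = 1 := by omega
    simp [Module.Basis.unitsSMul_apply, this, ε, hej]

lemma map_negSum (f : (Fin h → ℤ) →ₗ[ℤ] ℤ) : f (negSum h) = -∑ i, f (Pi.single i 1) := by
  rw [negSum, map_neg, map_sum]

/-- If all `h` values `f e_i` were `±1`, their sum would have the parity of `h`. This is where
evenness of the dimension makes the fan smooth. -/
lemma exists_eq_zero_of_odd (he : Even h) (f : (Fin h → ℤ) →ₗ[ℤ] ℤ)
    (hf : ∀ i, f (Pi.single i 1) ≤ 1) (hf' : ∀ i, f (-Pi.single i 1) ≤ 1)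
    (hodd : Odd (f (negSum h))) : ∃ j, f (Pi.single j 1) = 0 := by
  by_contra! hcon
  have h1 : Even (∑ i, (f (Pi.single i 1) + 1)) := Finset.even_sum _ fun i _ => by
    have a := hf i
    have b := hf' i
    rw [map_neg] at b
    have c := hcon i
    rcases (show f (Pi.single i 1) = 1 ∨ f (Pi.single i 1) = -1 by omega) with h | h <;> rw [h]
    · exact ⟨1, rfl⟩
    · exact ⟨0, rfl⟩
  rw [Finset.sum_add_distrib] at h1
  have h2 : Even (∑ _i : Fin h, (1 : ℤ)) := by simpa using he
  have h3 : Even (f (negSum h)) := by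
    rw [map_negSum]
    exact ((Int.even_add.1 h1).2 h2).neg
  exact (Int.not_even_iff_odd.2 hodd) h3

/-- A set between the pseudo Del Pezzo configuration and the Del Pezzo configuration. -/
lemma isFanoConfig_delPezzo (h0 : 0 < h) (he : Even h) {S : Set (Fin h → ℤ)}
    (hS : {v | ∃ i, v = Pi.single i 1 ∨ v = -Pi.single i 1} ∪ {negSum h} ⊆ S)
    (hS' : S ⊆ {v | ∃ i, v = Pi.single i 1 ∨ v = -Pi.single i 1} ∪ {negSum h, -negSum h}) :
    IsFanoConfig S := by
  classical
  have m1 : ∀ i, Pi.single i 1 ∈ S := fun i => hS (Or.inl ⟨i, Or.inl rfl⟩)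
  have m2 : ∀ i, -Pi.single i 1 ∈ S := fun i => hS (Or.inl ⟨i, Or.inr rfl⟩)
  have m3 : negSum h ∈ S := hS (Or.inr rfl)
  have hcase : ∀ x ∈ S, (∃ i, x = Pi.single i 1 ∨ x = -Pi.single i 1) ∨ x = negSum h ∨
    x = -negSum h := fun x hx => hS' hx
  have hcoord : ∀ i, ∀ x ∈ S, x i ≤ 1 ∧ -1 ≤ x i := fun i x hx => by
    rcases hcase x hx with ⟨j, rfl | rfl⟩ | rfl | rfl
    · by_cases hij : i = j
      · subst hij; simp
      · simp [Pi.single_eq_of_ne hij]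
    · by_cases hij : i = j
      · subst hij; simp
      · simp [Pi.single_eq_of_ne hij]
    · rw [negSum_apply]; norm_num
    · rw [Pi.neg_apply, negSum_apply]; norm_num
  refine ⟨?_, fun f hf => ?_, fun v => ?_, fun x hx => ?_⟩
  · refine Set.Finite.subset (((Set.finite_range fun i : Fin h => (Pi.single i 1 : Fin h → ℤ)).union
      (Set.finite_range fun i : Fin h => (-Pi.single i 1 : Fin h → ℤ))).union
      (Set.toFinite {negSum h, -negSum h})) ?_
    intro x hx
    rcases hS' hx with ⟨i, rfl | rfl⟩ | h
    · exact Or.inl (Or.inl ⟨i, rfl⟩)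
    · exact Or.inl (Or.inr ⟨i, rfl⟩)
    · exact Or.inr h
  -- If `±e₀` lies on the face, then `f e₀` is odd; otherwise the face belongs to the
  -- cross-polytope.
  · by_cases hodd : Odd (f (negSum h))
    · obtain ⟨j, hj⟩ := exists_eq_zero_of_odd he f (fun i => hf _ (m1 i)) (fun i => hf _ (m2 i)) hodd
      obtain ⟨b, hb1, hb2, hb3⟩ := exists_basis_negSum f hj
      refine ⟨_, b, fun x hx hfx => ?_⟩
      rcases hcase x hx with ⟨i, rfl | rfl⟩ | rfl | rfl
      · exact (hb1 i).1 hfx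
      · exact (hb1 i).2 hfx
      · exact hb2 hfx
      · exact hb3 hfx
    · obtain ⟨b, hb⟩ := exists_basis_cross f
      refine ⟨_, b, fun x hx hfx => ?_⟩
      rcases hcase x hx with ⟨i, rfl | rfl⟩ | rfl | rfl
      · exact (hb i).1 hfx
      · exact (hb i).2 hfx
      · exact absurd (hfx ▸ odd_one) hodd
      · rw [map_neg] at hfx
        exact absurd (by rw [show f (negSum h) = -1 by omega]; exact odd_neg_one) hodd
  -- Since `e₀ + e₁ + ⋯ + e_h = 0`, the coefficients `0, v₁, …, v_h` may all be shifted by `-m`.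
  -- With `m` the median, equally many `g` are `1` and `-1`, so `g` is a linear form with `g 0` as
  -- its value at `e₀`.
  · obtain ⟨g, m, hg, hsum, hg1, hg2, hg3⟩ := exists_median he v
    have hval : ∀ i, sumForm (fun i => g i.succ) (Pi.single i 1) = g i.succ := fun i => by simp
    have hval0 : sumForm (fun i => g i.succ) (negSum h) = g 0 := by
      rw [map_negSum, Finset.sum_congr rfl fun i _ => hval i]
      rw [Fin.sum_univ_succ] at hsum
      omega
    by_cases hav : g 0 ≠ -1 ∨ -negSum h ∈ S
    · refine ⟨sumForm fun i => g i.succ, fun x hx => ?_, ?_⟩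
      · rcases hcase x hx with ⟨i, rfl | rfl⟩ | rfl | rfl
        · rw [hval]; have := hg i.succ; omega
        · rw [map_neg, hval]; have := hg i.succ; omega
        · rw [hval0]; have := hg 0; omega
        · rw [map_neg, hval0]; have := hg 0; omega
      · have hv : v = (-m) • negSum h + ∑ i, (v i - m) • (Pi.single i 1 : Fin h → ℤ) := by
          ext j
          simp [negSum_apply, Finset.sum_apply, Pi.single_apply]
        rw [hv]
        refine AddSubmonoid.add_mem _ ?_ (AddSubmonoid.sum_mem _ fun i _ => ?_)
        · rcases hg 0 with h1 | h1 | h1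
          · have := hg1 0 h1
            rw [Fin.cons_zero] at this
            exact zsmul_mem_closure (by omega) (Or.inr ⟨m3, hval0.trans h1⟩)
          · have := hg3 0 h1
            rw [Fin.cons_zero] at this
            exact zsmul_mem_closure (by omega) (Or.inl (by omega))
          · have := hg2 0 h1
            rw [Fin.cons_zero] at this
            rw [← neg_smul_neg, neg_neg]
            refine zsmul_mem_closure this (Or.inr ⟨hav.resolve_left (by omega), ?_⟩)
            rw [map_neg, hval0, h1]; rfl
        · rcases hg i.succ with h1 | h1 | h1
          · have := hg1 _ h1
            rw [Fin.cons_succ] at this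
            exact zsmul_mem_closure (by omega) (Or.inr ⟨m1 i, (hval i).trans h1⟩)
          · have := hg3 _ h1
            rw [Fin.cons_succ] at this
            exact zsmul_mem_closure (by omega) (Or.inl (by omega))
          · have := hg2 _ h1
            rw [Fin.cons_succ] at this
            rw [← neg_smul_neg]
            refine zsmul_mem_closure (by omega) (Or.inr ⟨m2 i, ?_⟩)
            rw [map_neg, hval, h1]; rfl
    -- Here `-e₀` would be needed but is missing, and `v` lies in an orthant cone instead. Because
    -- `m ≥ 0`, negative entries have `g = -1`, so the signs of `v` dominate `g` and the form is at
    -- most `-1` at `e₀`.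
    · push Not at hav
      have hval' : ∀ i, sumForm (fun i => if 0 ≤ v i then (1 : ℤ) else -1) (Pi.single i 1) =
        if 0 ≤ v i then 1 else -1 := fun i => by simp
      refine ⟨sumForm fun i => if 0 ≤ v i then 1 else -1, fun x hx => ?_, ?_⟩
      · rcases hcase x hx with ⟨i, rfl | rfl⟩ | rfl | rfl
        · rw [hval']; split_ifs <;> norm_num
        · rw [map_neg, hval']; split_ifs <;> norm_num
        · rw [map_negSum, Finset.sum_congr rfl fun i _ => hval' i]
          have h1 : ∑ i : Fin h, g i.succ ≤ ∑ i, if 0 ≤ v i then (1 : ℤ) else -1 := by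
            refine Finset.sum_le_sum fun i _ => ?_
            split_ifs with hvi
            · have := hg i.succ; omega
            · have h2 := hg2 0 hav.1
              rw [Fin.cons_zero] at h2
              have h3 := hg1 i.succ
              have h4 := hg3 i.succ
              rw [Fin.cons_succ] at h3 h4
              have := hg i.succ
              omega
          rw [Fin.sum_univ_succ, hav.1] at hsum
          omega
        · exact absurd hx hav.2
      · have hv : v = ∑ i, v i • (Pi.single i 1 : Fin h → ℤ) := by
          ext j
          simp [Finset.sum_apply, Pi.single_apply]
        have hmem : ∑ i, v i • (Pi.single i 1 : Fin h → ℤ) ∈ AddSubmonoid.closure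
            {x | x ∈ S ∧ sumForm (fun i => if 0 ≤ v i then (1 : ℤ) else -1) x = 1} := by
          refine AddSubmonoid.sum_mem _ fun i _ => ?_
          by_cases hvi : 0 ≤ v i
          · exact zsmul_mem_closure hvi (Or.inr ⟨m1 i, by rw [hval', if_pos hvi]⟩)
          · rw [← neg_smul_neg]
            exact zsmul_mem_closure (by omega) (Or.inr ⟨m2 i, by
              rw [map_neg, hval', if_neg hvi]; rfl⟩)
        rwa [← hv] at hmem
  · have hp : ∀ i, ∀ x ∈ S, (LinearMap.proj i : (Fin h → ℤ) →ₗ[ℤ] ℤ) x ≤ 1 :=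
      fun i x hx => (hcoord i x hx).1
    have hn : ∀ i, ∀ x ∈ S, (-LinearMap.proj i : (Fin h → ℤ) →ₗ[ℤ] ℤ) x ≤ 1 := fun i x hx => by
      have := (hcoord i x hx).2
      simp only [LinearMap.neg_apply, LinearMap.proj_apply]
      omega
    rcases hcase x hx with ⟨i, rfl | rfl⟩ | rfl | rfl
    · exact ⟨_, hp i, by simp⟩
    · exact ⟨_, hn i, by simp⟩
    · exact ⟨_, hn ⟨0, h0⟩, by simp [negSum_apply]⟩
    · exact ⟨_, hp ⟨0, h0⟩, by simp [negSum_apply]⟩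

lemma isFanoConfig_line : IsFanoConfig ({1, -1} : Set (Fin 1 → ℤ)) := by
  have hone : (1 : Fin 1 → ℤ) = Pi.single 0 1 := by ext i; fin_cases i; rfl
  have hv : ∀ v : Fin 1 → ℤ, v = v 0 • 1 := fun v => by
    ext i; fin_cases i; simp
  refine ⟨Set.toFinite _, fun f _ => ?_, fun v => ?_, ?_⟩
  · obtain ⟨b, hb⟩ := exists_basis_cross f
    refine ⟨_, b, ?_⟩
    rintro x (rfl | rfl) hfx
    · rw [hone] at hfx ⊢; exact (hb 0).1 hfx
    · rw [hone] at hfx ⊢; exact (hb 0).2 hfx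
  · by_cases h0 : 0 ≤ v 0
    · refine ⟨LinearMap.proj 0, ?_, ?_⟩
      · rintro x (rfl | rfl) <;> simp
      · rw [hv v]
        exact zsmul_mem_closure h0 (Or.inr ⟨Or.inl rfl, rfl⟩)
    · refine ⟨-LinearMap.proj 0, ?_, ?_⟩
      · rintro x (rfl | rfl) <;> simp
      · rw [hv v, ← neg_smul_neg]
        exact zsmul_mem_closure (by omega) (Or.inr ⟨Or.inr rfl, by simp⟩)
  · rintro x (rfl | rfl)
    · refine ⟨LinearMap.proj 0, ?_, rfl⟩
      rintro x (rfl | rfl) <;> simp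
    · refine ⟨-LinearMap.proj 0, ?_, by simp⟩
      rintro x (rfl | rfl) <;> simp

lemma IsStandard.isFanoConfig {S : Set (Fin h → ℤ)} (hS : IsStandard S) : IsFanoConfig S := by
  have hneg : (∑ i, Pi.single i 1 : Fin h → ℤ) = -negSum h := by rw [negSum, neg_neg]
  rcases hS with ⟨h0, he, rfl⟩ | ⟨h0, he, rfl⟩ | ⟨rfl, rfl⟩
  · refine isFanoConfig_delPezzo h0 he (Set.union_subset_union_right _ ?_)
      (Set.union_subset_union_right _ ?_)
    · rintro _ rfl; exact Or.inl rfl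
    · rintro _ (rfl | rfl)
      · exact Or.inl rfl
      · exact Or.inr hneg
  · refine isFanoConfig_delPezzo h0 he (Set.union_subset_union_right _ ?_)
      (Set.union_subset_union_right _ ?_)
    · rintro _ rfl; rfl
    · rintro _ rfl; exact Or.inl rfl
  · exact isFanoConfig_line

lemma IsStandard.isStandardFactor {S : Set (Fin h → ℤ)} (hS : IsStandard S) :
    IsDelPezzo hS.isFanoConfig.fan ∨ IsPseudoDelPezzo hS.isFanoConfig.fan ∨
      IsProjectiveLine hS.isFanoConfig.fan := by
  have hF := hS.isFanoConfig.isFano_fan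
  have hg := hS.isFanoConfig.gens_fan
  rcases id hS with ⟨h0, he, h⟩ | ⟨h0, he, h⟩ | ⟨h0, h⟩
  · exact Or.inl ⟨h0, he, hF, hg.trans h⟩
  · exact Or.inr (Or.inl ⟨h0, he, hF, hg.trans h⟩)
  · exact Or.inr (Or.inr ⟨h0, hF.1, hg.trans h⟩)

end FaceFans
end Toric

namespace Toric

/-! ### Charts and points of a toric variety; toric morphisms and subfans. -/

section Geometry

variable {N N' : Type} [AddCommGroup N] [AddCommGroup N']

instance (X : SmoothFan N) {s t : X.cones} (f : t ⟶ s) :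
    IsOpenImmersion ((X.diagram ⋙ Over.forget base).map f) :=
  inferInstanceAs (IsOpenImmersion (X.diagram.map f).left)

instance (X : SmoothFan N) : ((X.diagram ⋙ Over.forget base) ⋙ Scheme.forget).IsLocallyDirected :=
  inferInstanceAs (X.diagram ⋙ Over.forget base ⋙ Scheme.forget).IsLocallyDirected

namespace SmoothFan

variable (X : SmoothFan N)

/-- The underlying scheme of the toric variety, as a colimit of schemes. -/
noncomputable def leftIso : X.variety.left ≅ colimit (X.diagram ⋙ Over.forget base) :=
  preservesColimitIso (Over.forget base) X.diagram

lemma ι_leftIso (s : Finset N) (hs : s ∈ X.cones) : (X.ι s hs).left ≫ X.leftIso.hom =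
    colimit.ι (X.diagram ⋙ Over.forget base) ⟨s, hs⟩ :=
  ι_preservesColimitIso_hom (Over.forget base) X.diagram ⟨s, hs⟩

lemma ι_left_eq (s : Finset N) (hs : s ∈ X.cones) : (X.ι s hs).left =
    colimit.ι (X.diagram ⋙ Over.forget base) ⟨s, hs⟩ ≫ X.leftIso.inv :=
  (Iso.eq_comp_inv X.leftIso).2 (X.ι_leftIso s hs)

instance isOpenImmersion_ι (s : Finset N) (hs : s ∈ X.cones) : IsOpenImmersion (X.ι s hs).left := by
  rw [ι_left_eq]
  have h : IsOpenImmersion (colimit.ι (X.diagram ⋙ Over.forget base) ⟨s, hs⟩) :=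
    (Scheme.IsLocallyDirected.openCover (X.diagram ⋙ Over.forget base)).map_prop ⟨s, hs⟩
  exact MorphismProperty.comp_mem @IsOpenImmersion _ _ h (inferInstance : IsOpenImmersion _)

lemma ι_injective (s : Finset N) (hs : s ∈ X.cones) : Function.Injective (X.ι s hs).left :=
  (X.ι s hs).left.isOpenEmbedding.injective

variable {X}

lemma faceMap_ι {s t : Finset N} (hs : s ∈ X.cones) (ht : t ∈ X.cones) (hts : t ⊆ s) :
    faceMap hts ≫ X.ι s hs = X.ι t ht :=
  colimit.w X.diagram (homOfLE hts : (⟨t, ht⟩ : X.cones) ⟶ ⟨s, hs⟩)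

lemma faceMap_ι_apply {s t : Finset N} (hs : s ∈ X.cones) (ht : t ∈ X.cones) (hts : t ⊆ s)
    (y : (chart t).left) : (X.ι s hs).left ((faceMap hts).left y) = (X.ι t ht).left y := by
  rw [← faceMap_ι hs ht hts]; rfl

lemma variety_hom_ext {T : Over base} {f g : X.variety ⟶ T}
    (h : ∀ s hs, X.ι s hs ≫ f = X.ι s hs ≫ g) : f = g :=
  colimit.hom_ext fun s => h s.1 s.2

lemma exists_ι_eq (x : X.variety.left) : ∃ s, ∃ hs : s ∈ X.cones, ∃ y, (X.ι s hs).left y = x := by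
  obtain ⟨⟨s, hs⟩, y, hy⟩ := Scheme.IsLocallyDirected.ι_jointly_surjective
    (X.diagram ⋙ Over.forget base) (X.leftIso.hom x)
  refine ⟨s, hs, y, ?_⟩
  apply X.leftIso.hom.isOpenEmbedding.injective
  rw [← hy, ← X.ι_leftIso s hs]
  rfl

lemma ι_eq_ι {s t : Finset N} (hs : s ∈ X.cones) (ht : t ∈ X.cones) {y : (chart s).left}
    {z : (chart t).left} (h : (X.ι s hs).left y = (X.ι t ht).left z) :
    ∃ u ∈ X.cones, ∃ (hus : u ⊆ s) (hut : u ⊆ t), ∃ w,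
      (faceMap hus).left w = y ∧ (faceMap hut).left w = z := by
  have h2 : colimit.ι (X.diagram ⋙ Over.forget base) ⟨s, hs⟩ y =
      colimit.ι (X.diagram ⋙ Over.forget base) ⟨t, ht⟩ z := by
    rw [← X.ι_leftIso s hs, ← X.ι_leftIso t ht]
    exact congrArg X.leftIso.hom h
  obtain ⟨⟨u, hu⟩, fi, fj, w, h3, h4⟩ :=
    (Scheme.IsLocallyDirected.ι_eq_ι_iff (X.diagram ⋙ Over.forget base)).1 h2
  exact ⟨u, hu, leOfHom fi, leOfHom fj, w, h3, h4⟩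

variable (X) in
/-- The affine invariant open subset `U_s`. -/
def chartSet (s : Finset N) : Set X.variety.left :=
  {x | ∃ (hs : s ∈ X.cones) (y : (chart s).left), (X.ι s hs).left y = x}

lemma chartSet_eq_range {s : Finset N} (hs : s ∈ X.cones) :
    X.chartSet s = Set.range (X.ι s hs).left := by
  ext x
  exact ⟨fun ⟨_, y, hy⟩ => ⟨y, hy⟩, fun ⟨y, hy⟩ => ⟨hs, y, hy⟩⟩

lemma chartSet_mono {s t : Finset N} (hs : s ∈ X.cones) (hts : t ⊆ s) :
    X.chartSet t ⊆ X.chartSet s := by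
  rintro x ⟨ht, y, rfl⟩
  exact ⟨hs, (faceMap hts).left y, faceMap_ι_apply hs ht hts y⟩

lemma mem_chartSet_inter [DecidableEq N] {s t : Finset N} {x : X.variety.left}
    (h1 : x ∈ X.chartSet s) (h2 : x ∈ X.chartSet t) : x ∈ X.chartSet (s ∩ t) := by
  obtain ⟨hs, y, hy⟩ := h1
  obtain ⟨ht, z, hz⟩ := h2
  obtain ⟨u, hu, hus, hut, w, hw1, hw2⟩ := ι_eq_ι hs ht (hy.trans hz.symm)
  refine chartSet_mono (X.face_mem hs Finset.inter_subset_left) (Finset.subset_inter hus hut)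
    ⟨hu, w, ?_⟩
  rw [← faceMap_ι_apply hs hu hus, hw1, hy]

/-- Every point lies in a smallest chart. -/
lemma exists_minimal_chart (x : X.variety.left) : ∃ s ∈ X.cones, x ∈ X.chartSet s ∧
    ∀ t, x ∈ X.chartSet t → s ⊆ t := by
  classical
  obtain ⟨s₀, hs₀, y₀, hy₀⟩ := exists_ι_eq x
  have hfin : {s | x ∈ X.chartSet s}.Finite := X.finite_cones.subset fun s hs => hs.1
  obtain ⟨s, hs⟩ := hfin.exists_minimal ⟨s₀, hs₀, y₀, hy₀⟩
  refine ⟨s, hs.1.1, hs.1, fun t ht => ?_⟩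
  have h := hs.2 (mem_chartSet_inter hs.1 ht) Finset.inter_subset_left
  exact h.trans Finset.inter_subset_right

end SmoothFan

/-! ### Toric morphisms -/

variable {X : SmoothFan N} {Y : SmoothFan N'} {φ : N →ₗ[ℤ] N'}

lemma MapsCone.subset {s t : Finset N} {s' : Finset N'} (h : MapsCone φ s s') (hts : t ⊆ s) :
    MapsCone φ t s' := fun x hx => h x (hts hx)

lemma faceMap_chartMap {s t : Finset N} {s' : Finset N'} (h : MapsCone φ s s') (hts : t ⊆ s) :
    faceMap hts ≫ chartMap φ h = chartMap φ (h.subset hts) :=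
  chartMap_comp LinearMap.id φ _ _ _

lemma chartMap_faceMap {s : Finset N} {s' t' : Finset N'} (h : MapsCone φ s t') (hts : t' ⊆ s')
    (h' : MapsCone φ s s') : chartMap φ h ≫ faceMap hts = chartMap φ h' :=
  chartMap_comp φ LinearMap.id _ _ _

/-- A lattice map that maps cones into cones induces a toric morphism. -/
theorem exists_toricMorphism (h : ∀ s ∈ X.cones, ∃ s' ∈ Y.cones, MapsCone φ s s') :
    ∃ f : X.variety ⟶ Y.variety, IsToricMorphism X Y φ f := by
  classical
  -- The map does not depend on the target cone, since both choices factor through the chart of the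
  -- intersection.
  have hind : ∀ {s : Finset N} {s₁ s₂ : Finset N'} (h₁ : s₁ ∈ Y.cones) (h₂ : s₂ ∈ Y.cones)
      (m₁ : MapsCone φ s s₁) (m₂ : MapsCone φ s s₂),
      chartMap φ m₁ ≫ Y.ι s₁ h₁ = chartMap φ m₂ ≫ Y.ι s₂ h₂ := by
    intro s s₁ s₂ h₁ h₂ m₁ m₂
    have m : MapsCone φ s (s₁ ∩ s₂) := fun x hx => by
      rw [Finset.coe_inter, ← Y.inter h₁ h₂]
      exact ⟨m₁ x hx, m₂ x hx⟩
    have hi := Y.face_mem h₁ (Finset.inter_subset_left (s₂ := s₂))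
    rw [← chartMap_faceMap m Finset.inter_subset_left m₁,
      ← chartMap_faceMap m Finset.inter_subset_right m₂, Category.assoc, Category.assoc,
      SmoothFan.faceMap_ι h₁ hi, SmoothFan.faceMap_ι h₂ hi]
  choose s' hs' hm using h
  let c : Cocone X.diagram :=
    { pt := Y.variety
      ι :=
        { app := fun s => chartMap φ (hm s.1 s.2) ≫ Y.ι (s' s.1 s.2) (hs' s.1 s.2)
          naturality := fun t s f => by
            change faceMap (leOfHom f) ≫ chartMap φ (hm s.1 s.2) ≫ _ = (chartMap φ _ ≫ _) ≫ 𝟙 _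
            rw [Category.comp_id, ← Category.assoc, faceMap_chartMap]
            exact hind _ _ _ _ } }
  refine ⟨colimit.desc X.diagram c, fun s hs => ⟨_, hs' s hs, hm s hs⟩, fun s hs t ht m => ?_⟩
  have : X.ι s hs ≫ colimit.desc X.diagram c =
      chartMap φ (hm s hs) ≫ Y.ι (s' s hs) (hs' s hs) := colimit.ι_desc c ⟨s, hs⟩
  rw [this]
  exact hind _ _ _ _

namespace IsToricMorphism

variable {f : X.variety ⟶ Y.variety} (hf : IsToricMorphism X Y φ f)
include hf

lemma apply_ι {s : Finset N} (hs : s ∈ X.cones) {s' : Finset N'} (hs' : s' ∈ Y.cones)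
    (m : MapsCone φ s s') (y : (chart s).left) :
    f.left ((X.ι s hs).left y) = (Y.ι s' hs').left ((chartMap φ m).left y) := by
  have := congrArg (fun q => q.left y) (hf.comp_eq s hs s' hs' m)
  exact this

/-- If a point in the smallest chart `U_s` is mapped into `U_t`, then `φ` maps `⟨s⟩` into `⟨t⟩`. -/
lemma mapsCone_of_minimal {x : X.variety.left} {s : Finset N} (hs : s ∈ X.cones)
    (hx : x ∈ X.chartSet s) (hmin : ∀ t, x ∈ X.chartSet t → s ⊆ t) {t : Finset N'}
    (hfx : f.left x ∈ Y.chartSet t) : MapsCone φ s t := by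
  classical
  obtain ⟨_, y, rfl⟩ := hx
  obtain ⟨s', hs', m⟩ := hf.exists_mapsCone s hs
  have hmem := SmoothFan.mem_chartSet_inter (s := s') ⟨hs', _, (hf.apply_ι hs hs' m y).symm⟩ hfx
  rw [hf.apply_ι hs hs' m y] at hmem
  obtain ⟨hi, z, hz⟩ := hmem
  rw [← SmoothFan.faceMap_ι_apply hs' hi Finset.inter_subset_left] at hz
  have hz' := Y.ι_injective s' hs' hz
  -- Let `u` cut out the face `s' ∩ t` of `s'`. Its character does not vanish at the image point, so
  -- that of `u ∘ φ` does not vanish at `y`; hence `y` lies in the chart of the face of `s` on which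
  -- `u ∘ φ = 0`.
  obtain ⟨κ, b, hb⟩ := Y.unimodular hs'
  obtain ⟨u, u0, u1⟩ := exists_face_form (t := t) b hb
  have hu : u ∈ dualMonoid s' := fun x hx => by
    by_cases hxt : x ∈ t
    · rw [u0 x hx hxt]
    · rw [u1 x hx hxt]; exact zero_le_one
  obtain ⟨-, hr⟩ := isOpenImmersion_face (s := s') (t := s' ∩ t) Finset.inter_subset_left ⟨u, hu⟩
    (fun x hx => u0 x (Finset.mem_inter.1 hx).1 (Finset.mem_inter.1 hx).2)
    (fun x hx hxt => by
      change 0 < u x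
      rw [u1 x hx fun h => hxt (Finset.mem_inter.2 ⟨hx, h⟩)]; exact zero_lt_one)
  have hD : (chartMap φ m).left y ∈ (PrimeSpectrum.basicOpen
      (AddMonoidAlgebra.single (⟨u, hu⟩ : dualMonoid s') (1 : ℂ)) : Set (PrimeSpectrum _)) := by
    rw [← hr]; exact ⟨z, hz'⟩
  let v := dualMap φ m ⟨u, hu⟩
  have hv : ∀ x, v.1 x = u (φ x) := fun _ => rfl
  have hDy : y ∈ (PrimeSpectrum.basicOpen
      (AddMonoidAlgebra.single v (1 : ℂ)) : Set (PrimeSpectrum _)) := by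
    intro hmem
    refine hD ?_
    change chartRingMap φ m (AddMonoidAlgebra.single (⟨u, hu⟩ : dualMonoid s') (1 : ℂ)) ∈
      (PrimeSpectrum.asIdeal y)
    have : chartRingMap φ m (AddMonoidAlgebra.single (⟨u, hu⟩ : dualMonoid s') (1 : ℂ)) =
        AddMonoidAlgebra.single v (1 : ℂ) := AddMonoidAlgebra.mapDomain_single
    rw [this]
    exact hmem
  have hvs : ∀ x ∈ s, 0 ≤ v.1 x := v.2
  obtain ⟨-, hr2⟩ := isOpenImmersion_face (s := s) (t := s.filter fun x => v.1 x = 0)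
    (Finset.filter_subset _ _) v (fun x hx => (Finset.mem_filter.1 hx).2)
    (fun x hx hx' => lt_of_le_of_ne (hvs x hx)
      fun h => hx' (Finset.mem_filter.2 ⟨hx, h.symm⟩))
  rw [← hr2] at hDy
  obtain ⟨w, hw⟩ := hDy
  have hsf : s.filter (fun x => v.1 x = 0) ∈ X.cones := X.face_mem hs (Finset.filter_subset _ _)
  -- By minimality this face is all of `s`. So `φ` maps `s` into `⟨s'⟩` with `u = 0`, which is the
  -- face spanned by elements of `t`.
  have hsub := hmin _ ⟨hsf, w, by
    rw [← hw, SmoothFan.faceMap_ι_apply hs hsf]⟩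
  intro x hx
  have hux : u (φ x) = 0 := (Finset.mem_filter.1 (hsub hx)).2
  obtain ⟨c, hc, hcx⟩ := mem_cone_iff.1 (m x hx)
  have hzero := congrArg (extendForm (ratForm u)) hcx
  rw [extendForm_toNQ, ratForm_apply, hux, map_sum] at hzero
  have hterm : ∀ y ∈ s', 0 ≤ extendForm (ratForm u) (c y • toNQ N' y) := fun y hy => by
    rw [map_smul, extendForm_toNQ, ratForm_apply, smul_eq_mul]
    exact mul_nonneg (hc y) (by exact_mod_cast hu y hy)
  have hall := (Finset.sum_eq_zero_iff_of_nonneg hterm).1 (by rw [← hzero]; simp)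
  rw [hcx]
  refine Submodule.sum_mem _ fun y hy => ?_
  by_cases hyt : y ∈ t
  · exact Submodule.smul_mem _ (⟨c y, hc y⟩ : {r : ℚ // 0 ≤ r})
      (Submodule.subset_span ⟨y, hyt, rfl⟩)
  · have := hall y hy
    rw [map_smul, extendForm_toNQ, ratForm_apply, smul_eq_mul, u1 y hy hyt] at this
    have hcy : c y = 0 := by simpa using this
    rw [hcy, zero_smul]
    exact Submodule.zero_mem _

end IsToricMorphism

/-! ### Subfans -/

lemma mapsCone_id {s : Finset N} : MapsCone (LinearMap.id : N →ₗ[ℤ] N) s s :=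
  mapsCone_of_subset (subset_refl s)

variable {X₁ X₂ : SmoothFan N}

/-- The variety of a subfan is an open subvariety. -/
theorem exists_subfan_immersion (h : X₁.cones ⊆ X₂.cones) :
    ∃ j : X₁.variety ⟶ X₂.variety, IsToricMorphism X₁ X₂ LinearMap.id j ∧
      (∀ s (hs : s ∈ X₁.cones), X₁.ι s hs ≫ j = X₂.ι s (h hs)) ∧ IsOpenImmersion j.left ∧
      ∀ x, x ∈ Set.range j.left ↔ ∃ s ∈ X₁.cones, x ∈ X₂.chartSet s := by
  obtain ⟨j, hj⟩ := exists_toricMorphism (X := X₁) (Y := X₂) (φ := LinearMap.id)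
    fun s hs => ⟨s, h hs, mapsCone_id⟩
  have hι : ∀ s (hs : s ∈ X₁.cones), X₁.ι s hs ≫ j = X₂.ι s (h hs) := fun s hs => by
    rw [hj.comp_eq s hs s (h hs) mapsCone_id, chartMap_id, Category.id_comp]
  have hιx : ∀ s (hs : s ∈ X₁.cones) y, j.left ((X₁.ι s hs).left y) = (X₂.ι s (h hs)).left y :=
    fun s hs y => congrArg (fun q => q.left y) (hι s hs)
  refine ⟨j, hj, hι, ?_, fun x => ⟨?_, ?_⟩⟩
  · refine IsOpenImmersion.of_forall_source_exists j.left ?_ fun x => ?_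
    · intro a b hab
      obtain ⟨s, hs, y, rfl⟩ := SmoothFan.exists_ι_eq a
      obtain ⟨t, ht, z, rfl⟩ := SmoothFan.exists_ι_eq b
      rw [hιx, hιx] at hab
      obtain ⟨u, hu, hus, hut, w, rfl, rfl⟩ := SmoothFan.ι_eq_ι _ _ hab
      have hu1 := X₁.face_mem hs hus
      rw [SmoothFan.faceMap_ι_apply hs hu1, SmoothFan.faceMap_ι_apply ht hu1]
    · obtain ⟨s, hs, y, rfl⟩ := SmoothFan.exists_ι_eq x
      refine ⟨_, (X₁.ι s hs).left, inferInstance, ⟨y, rfl⟩, ?_⟩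
      have : (X₁.ι s hs).left ≫ j.left = (X₂.ι s (h hs)).left := by
        rw [← Over.comp_left, hι]
      rw [this]
      infer_instance
  · rintro ⟨a, rfl⟩
    obtain ⟨s, hs, y, rfl⟩ := SmoothFan.exists_ι_eq a
    exact ⟨s, hs, h hs, y, (hιx s hs y).symm⟩
  · rintro ⟨s, hs, _, y, rfl⟩
    exact ⟨(X₁.ι s hs).left y, hιx s hs y⟩

end Geometry
end Toric

namespace Toric

/-! ### Gluing morphisms over a base scheme -/

section Gluing

variable {S : Scheme.{0}}

lemma exists_lift_openImmersion {T U Y : Over S} (a : U ⟶ Y) [IsOpenImmersion a.left] (f : T ⟶ Y)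
    (h : Set.range f.left ⊆ Set.range a.left) : ∃ g : T ⟶ U, g ≫ a = f := by
  have hf := IsOpenImmersion.lift_fac a.left f.left h
  refine ⟨Over.homMk (IsOpenImmersion.lift a.left f.left h) ?_, ?_⟩
  · rw [← Over.w a, ← Category.assoc, hf, Over.w f]
  · ext1
    exact hf

lemma cancel_openImmersion {T U Y : Over S} (a : U ⟶ Y) [IsOpenImmersion a.left] {f g : T ⟶ U}
    (h : f ≫ a = g ≫ a) : f = g := by
  ext1
  rw [← cancel_mono a.left]
  exact congrArg (fun q => q.left) h

/-- An open subset of `T` as a scheme over `S`. -/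
noncomputable def openOver {T : Over S} (U : T.left.Opens) : Over S := Over.mk (U.ι ≫ T.hom)

/-- The inclusion of an open subset. -/
noncomputable def openOverι {T : Over S} (U : T.left.Opens) : openOver U ⟶ T := Over.homMk U.ι rfl

instance {T : Over S} (U : T.left.Opens) : IsOpenImmersion (openOverι U).left :=
  inferInstanceAs (IsOpenImmersion U.ι)

lemma range_openOverι {T : Over S} (U : T.left.Opens) : Set.range (openOverι U).left = U :=
  Scheme.Opens.range_ι U

/-- The open cover given by a neighbourhood of each point. -/
noncomputable def coverOfNhds {T : Over S} (U : T.left → Over S) (a : ∀ t, U t ⟶ T)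
    [∀ t, IsOpenImmersion (a t).left] (ht : ∀ t, t ∈ Set.range (a t).left) : T.left.OpenCover where
  I₀ := T.left
  X t := (U t).left
  f t := (a t).left
  mem₀ := by
    rw [Scheme.presieve₀_mem_precoverage_iff]
    exact ⟨fun x => ⟨x, ht x⟩, inferInstance⟩

lemma exists_glue {T Y : Over S} (U : T.left → Over S) (a : ∀ t, U t ⟶ T)
    [∀ t, IsOpenImmersion (a t).left] (ht : ∀ t, t ∈ Set.range (a t).left) (h : ∀ t, U t ⟶ Y)
    (hc : ∀ t t' (V : Over S) (b : V ⟶ U t) (b' : V ⟶ U t'),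
      b ≫ a t = b' ≫ a t' → b ≫ h t = b' ≫ h t') :
    ∃ f : T ⟶ Y, ∀ t, a t ≫ f = h t := by
  let 𝒰 := coverOfNhds U a ht
  have hf : ∀ x y : 𝒰.I₀, pullback.fst (𝒰.f x) (𝒰.f y) ≫ (h x).left =
      pullback.snd (𝒰.f x) (𝒰.f y) ≫ (h y).left := by
    intro x y
    let V : Over S := Over.mk (pullback.fst (𝒰.f x) (𝒰.f y) ≫ (U x).hom)
    have hcond : pullback.fst (𝒰.f x) (𝒰.f y) ≫ (a x).left =
      pullback.snd (𝒰.f x) (𝒰.f y) ≫ (a y).left := pullback.condition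
    let b : V ⟶ U x := Over.homMk (pullback.fst (𝒰.f x) (𝒰.f y)) rfl
    let b' : V ⟶ U y := Over.homMk (pullback.snd (𝒰.f x) (𝒰.f y)) (by
      refine (congrArg (pullback.snd (𝒰.f x) (𝒰.f y) ≫ ·) (Over.w (a y)).symm).trans ?_
      refine Eq.trans ?_ (congrArg (pullback.fst (𝒰.f x) (𝒰.f y) ≫ ·) (Over.w (a x)))
      exact ((Category.assoc _ _ _).symm.trans
        (congrArg (· ≫ T.hom) hcond.symm)).trans (Category.assoc _ _ _))
    exact congrArg (fun q => q.left) (hc x y V b b' (by ext1; exact hcond))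
  let g := 𝒰.glueMorphisms (fun t => (h t).left) hf
  have hg : ∀ t : 𝒰.I₀, (a t).left ≫ g = (h t).left := 𝒰.ι_glueMorphisms _ hf
  refine ⟨Over.homMk g ?_, fun t => by ext1; exact hg t⟩
  refine 𝒰.hom_ext _ _ fun t => ?_
  change (a t).left ≫ g ≫ Y.hom = (a t).left ≫ T.hom
  rw [← Category.assoc, hg, Over.w, Over.w]

lemma hom_ext_local {T Y : Over S} {f g : T ⟶ Y}
    (h : ∀ t : T.left, ∃ (U : Over S) (a : U ⟶ T), IsOpenImmersion a.left ∧
      t ∈ Set.range a.left ∧ a ≫ f = a ≫ g) : f = g := by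
  choose U a ha ht he using h
  ext1
  refine (coverOfNhds U a ht).hom_ext _ _ fun t => ?_
  exact congrArg (fun q => q.left) (he t)

end Gluing

/-! ### Products over a base scheme -/

section Products

variable {S : Scheme.{0}} {I : Type}

/-- The morphisms `p i` make `X` the product of the `Y i`. -/
def IsProd {X : Over S} {Y : I → Over S} (p : ∀ i, X ⟶ Y i) : Prop :=
  ∀ (T : Over S) (g : ∀ i, T ⟶ Y i), ∃! h : T ⟶ X, ∀ i, h ≫ p i = g i

/-- Being a product is local. -/
theorem isProd_of_local [Finite I] {X : Over S} {Y : I → Over S} (p : ∀ i, X ⟶ Y i) {J : Type}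
    {X' : J → Over S} (a : ∀ j, X' j ⟶ X) {Y' : J → I → Over S} (b : ∀ j i, Y' j i ⟶ Y i)
    (q : ∀ j i, X' j ⟶ Y' j i) (ha : ∀ j, IsOpenImmersion (a j).left)
    (hb : ∀ j i, IsOpenImmersion (b j i).left) (hw : ∀ j i, q j i ≫ b j i = a j ≫ p i)
    (hq : ∀ j, IsProd (q j))
    (hex : ∀ j x, (∀ i, (p i).left x ∈ Set.range (b j i).left) → x ∈ Set.range (a j).left)
    (hcov : ∀ y : ∀ i, (Y i).left, ∃ j, ∀ i, y i ∈ Set.range (b j i).left) : IsProd p := by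
  -- Uniqueness comes first, as it also provides the compatibility needed to glue local solutions.
  -- By `hex`, maps that agree after every `p i` factor locally through the same chart.
  have hmono : ∀ (T : Over S) (h h' : T ⟶ X), (∀ i, h ≫ p i = h' ≫ p i) → h = h' := by
    intro T h h' hh
    refine hom_ext_local fun t => ?_
    obtain ⟨j, hj⟩ := hcov fun i => (p i).left (h.left t)
    have h1 : h.left t ∈ (a j).left.opensRange := hex j _ hj
    have h2 : h'.left t ∈ (a j).left.opensRange := hex j _ fun i => by
      have := congrArg (fun q => q.left t) (hh i)
      change (p i).left (h.left t) = (p i).left (h'.left t) at this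
      rw [← this]
      exact hj i
    let V : T.left.Opens := h.left ⁻¹ᵁ (a j).left.opensRange ⊓ h'.left ⁻¹ᵁ (a j).left.opensRange
    have hV : ∀ x ∈ Set.range (openOverι V).left, x ∈ V := fun x hx => by
      rw [range_openOverι] at hx; exact hx
    obtain ⟨g, hg⟩ := exists_lift_openImmersion (a j) (openOverι V ≫ h) (by
      rintro _ ⟨x, rfl⟩
      exact (hV _ ⟨x, rfl⟩).1)
    obtain ⟨g', hg'⟩ := exists_lift_openImmersion (a j) (openOverι V ≫ h') (by
      rintro _ ⟨x, rfl⟩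
      exact (hV _ ⟨x, rfl⟩).2)
    refine ⟨_, openOverι V, inferInstance, by rw [range_openOverι]; exact ⟨h1, h2⟩, ?_⟩
    rw [← hg, ← hg', (hq j _ fun i => g ≫ q j i).unique (fun i => rfl) fun i => ?_]
    refine cancel_openImmersion (b j i) ?_
    rw [Category.assoc, Category.assoc, hw, ← Category.assoc, ← Category.assoc, hg, hg',
      Category.assoc, Category.assoc, hh]
  intro T g
  have hloc : ∀ t : T.left, ∃ (U : Over S) (c : U ⟶ T) (h : U ⟶ X), IsOpenImmersion c.left ∧
      t ∈ Set.range c.left ∧ ∀ i, h ≫ p i = c ≫ g i := by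
    intro t
    obtain ⟨j, hj⟩ := hcov fun i => (g i).left t
    have hopen : IsOpen {x : T.left | ∀ i, (g i).left x ∈ Set.range (b j i).left} := by
      have : {x : T.left | ∀ i, (g i).left x ∈ Set.range (b j i).left} =
          ⋂ i, (g i).left ⁻¹' Set.range (b j i).left := by ext; simp
      rw [this]
      exact isOpen_iInter_of_finite fun i =>
        ((b j i).left.isOpenEmbedding.isOpen_range).preimage (g i).left.continuous
    let V : T.left.Opens := ⟨_, hopen⟩
    have hlift : ∀ i, ∃ k : openOver V ⟶ Y' j i, k ≫ b j i = openOverι V ≫ g i := fun i =>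
      exists_lift_openImmersion (b j i) (openOverι V ≫ g i) (by
        rintro _ ⟨x, rfl⟩
        have hx : (openOverι V).left x ∈ (V : Set T.left) := by
          rw [← range_openOverι]; exact ⟨x, rfl⟩
        exact hx i)
    choose k hk using hlift
    obtain ⟨h, hh, -⟩ := hq j _ k
    refine ⟨_, openOverι V, h ≫ a j, inferInstance, by rw [range_openOverι]; exact hj, fun i => ?_⟩
    rw [Category.assoc, ← hw, ← Category.assoc, hh, hk]
  choose U c h hc ht hh using hloc
  obtain ⟨f, hf⟩ := exists_glue U c ht h fun t t' V d d' hd => hmono _ _ _ fun i => by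
    rw [Category.assoc, Category.assoc, hh, hh, ← Category.assoc, ← Category.assoc, hd]
  refine ⟨f, fun i => ?_, fun f' hf' => hmono _ _ _ fun i => ?_⟩
  · refine hom_ext_local fun t => ⟨U t, c t, hc t, ht t, ?_⟩
    rw [← Category.assoc, hf, hh]
  · rw [hf' i]
    symm
    refine hom_ext_local fun t => ⟨U t, c t, hc t, ht t, ?_⟩
    rw [← Category.assoc, hf, hh]

lemma IsProd.nonempty_isLimit {X : Over S} {Y : I → Over S} {p : ∀ i, X ⟶ Y i} (hp : IsProd p) :
    Nonempty (IsLimit (Limits.Fan.mk X p)) := by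
  choose h hh hu using hp
  exact ⟨Limits.Fan.IsLimit.mk _ (fun s => h s.pt fun i => s.proj i) (fun s i => hh _ _ i)
    fun s m hm => hu _ _ m hm⟩

lemma IsProd.nonempty_isLimit_binary {X Y₁ Y₂ : Over S} {q : X ⟶ Y₁} {r : X ⟶ Y₂}
    (h : ∀ (T : Over S) (f : T ⟶ Y₁) (g : T ⟶ Y₂), ∃! h : T ⟶ X, h ≫ q = f ∧ h ≫ r = g) :
    Nonempty (IsLimit (BinaryFan.mk q r)) := by
  choose k hk hu using h
  exact ⟨BinaryFan.isLimitMk (fun s => k s.pt s.fst s.snd) (fun s => (hk _ _ _).1)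
    (fun s => (hk _ _ _).2) fun s m h1 h2 => hu _ _ _ m ⟨h1, h2⟩⟩

end Products

/-! ### Lattice maps and cones -/

section MapsCone

variable {N N' : Type} [AddCommGroup N] [AddCommGroup N']

lemma MapsCone.map_mem {φ : N →ₗ[ℤ] N'} {s : Finset N} {s' : Finset N'} (h : MapsCone φ s s')
    {v : N} (hv : toNQ N v ∈ cone (s : Set N)) : toNQ N' (φ v) ∈ cone (s' : Set N') := by
  have hφ : ∀ x, LinearMap.baseChange ℚ φ (toNQ N x) = toNQ N' (φ x) := fun x => by
    change LinearMap.baseChange ℚ φ ((1 : ℚ) ⊗ₜ[ℤ] x) = _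
    rw [LinearMap.baseChange_tmul]
    rfl
  obtain ⟨c, hc, hcv⟩ := mem_cone_iff.1 hv
  rw [← hφ, hcv, map_sum]
  refine Submodule.sum_mem _ fun x hx => ?_
  rw [map_smul, hφ]
  exact Submodule.smul_mem _ (⟨c x, hc x⟩ : {r : ℚ // 0 ≤ r}) (h x hx)

/-- A generator of a cone that lies in another cone is a generator of it. -/
lemma SmoothFan.mem_of_mem_cone (X : SmoothFan N) {s t : Finset N} (hs : s ∈ X.cones)
    (ht : t ∈ X.cones) {v : N} (hv : v ∈ s) (h : toNQ N v ∈ cone (t : Set N)) : v ∈ t := by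
  classical
  have h2 : toNQ N v ∈ cone ((s ∩ t : Finset N) : Set N) := by
    rw [Finset.coe_inter, ← X.inter hs ht]
    exact ⟨Submodule.subset_span ⟨v, hv, rfl⟩, h⟩
  obtain ⟨d, d1, d0⟩ := X.exists_dual hs
  obtain ⟨c, -, hcv⟩ := mem_cone_iff.1 h2
  by_contra hvt
  have h3 := congrArg (extendForm (ratForm (d v))) hcv
  rw [extendForm_toNQ, ratForm_apply, d1 v hv, map_sum, Finset.sum_eq_zero] at h3
  · simp at h3
  · intro x hx
    rw [Finset.mem_inter] at hx
    rw [map_smul, extendForm_toNQ, ratForm_apply, d0 v hv x hx.1 fun e => hvt (e ▸ hx.2)]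
    simp

end MapsCone

/-! ### Morphisms into charts -/

section Charts

lemma hom_Spec_eq {T : Scheme.{0}} {R : CommRingCat.{0}} (f : T ⟶ Spec R) :
    ∃ φ : R ⟶ Γ(T, ⊤), f = T.toSpecΓ ≫ Spec.map φ := by
  refine ⟨(Scheme.ΓSpecIso R).inv ≫ f.appTop, ?_⟩
  rw [Spec.map_comp, ← Category.assoc, ← Scheme.toSpecΓ_naturality, Category.assoc,
    toSpecΓ_SpecMap_ΓSpecIso_inv, Category.comp_id]

lemma toSpecΓ_injective {T : Scheme.{0}} {R : CommRingCat.{0}} {φ ψ : R ⟶ Γ(T, ⊤)}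
    (h : T.toSpecΓ ≫ Spec.map φ = T.toSpecΓ ≫ Spec.map ψ) : φ = ψ := by
  have key : ∀ χ : R ⟶ Γ(T, ⊤), (Scheme.ΓSpecIso R).inv ≫ (T.toSpecΓ ≫ Spec.map χ).appTop = χ := by
    intro χ
    rw [Scheme.Hom.comp_appTop, Scheme.toSpecΓ_appTop]
    simp
  rw [← key φ, h, key]

variable {N : Type} [AddCommGroup N] {I : Type} [Fintype I] {NI : I → Type}
  [∀ i, AddCommGroup (NI i)]

/-- A decomposition of a lattice as a direct sum, given by projections and inclusions, compatible
with finite sets of lattice vectors. -/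
structure IsConeSum (π : ∀ i, N →ₗ[ℤ] NI i) (l : ∀ i, NI i →ₗ[ℤ] N) (s : Finset N)
    (t : ∀ i, Finset (NI i)) : Prop where
  proj_incl : ∀ i x, π i (l i x) = x
  proj_incl_ne : ∀ i j x, i ≠ j → π i (l j x) = 0
  sum_incl : ∀ v, ∑ i, l i (π i v) = v
  mapsCone : ∀ i, MapsCone (π i) s (t i)
  mapsCone_incl : ∀ i, MapsCone (l i) (t i) s

namespace IsConeSum

variable {π : ∀ i, N →ₗ[ℤ] NI i} {l : ∀ i, NI i →ₗ[ℤ] N} {s : Finset N} {t : ∀ i, Finset (NI i)}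
  (H : IsConeSum π l s t)
include H

lemma sum_dualMap (u : dualMonoid s) :
    ∑ i, dualMap (π i) (H.mapsCone i) (dualMap (l i) (H.mapsCone_incl i) u) = u := by
  refine Subtype.ext (LinearMap.ext fun v => ?_)
  rw [AddSubmonoid.coe_finsetSum, LinearMap.sum_apply]
  conv_rhs => rw [← H.sum_incl v, map_sum]
  rfl

lemma dualMap_dualMap (i : I) (u : dualMonoid (t i)) :
    dualMap (l i) (H.mapsCone_incl i) (dualMap (π i) (H.mapsCone i) u) = u :=
  Subtype.ext (LinearMap.ext fun v => congrArg u.1 (H.proj_incl i v))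

lemma dualMap_dualMap_ne {i j : I} (hij : i ≠ j) (u : dualMonoid (t i)) :
    dualMap (l j) (H.mapsCone_incl j) (dualMap (π i) (H.mapsCone i) u) = 0 := by
  refine Subtype.ext (LinearMap.ext fun v => ?_)
  change u.1 (π i (l j v)) = 0
  rw [H.proj_incl_ne i j v hij, map_zero]

/-- The monoid algebra of a sum of cones is the coproduct of the monoid algebras of the summands.
Every `u` is the sum of the pull-backs of its restrictions `u ∘ l i`, so `ψ` must send `χ^u` to `∏ φ
i (χ^(u ∘ l i))`. -/
lemma existsUnique_ringHom {A : Type} [CommRing A] (σ : ℂ →+* A)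
    (φ : ∀ i, AddMonoidAlgebra ℂ (dualMonoid (t i)) →+* A)
    (hφ : ∀ i, (φ i).comp (algebraMap ℂ _) = σ) :
    ∃! ψ : AddMonoidAlgebra ℂ (dualMonoid s) →+* A, ψ.comp (algebraMap ℂ _) = σ ∧
      ∀ i, ψ.comp (AddMonoidAlgebra.mapDomainRingHom ℂ (dualMap (π i) (H.mapsCone i))) = φ i := by
  classical
  let _ : Algebra ℂ A := σ.toAlgebra
  let F : Multiplicative (dualMonoid s) →* A :=
    { toFun := fun u => ∏ i, φ i (.single (dualMap (l i) (H.mapsCone_incl i) u.toAdd) 1)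
      map_one' := Finset.prod_eq_one fun i _ => by
        rw [toAdd_one, map_zero]; exact map_one (φ i)
      map_mul' := fun u v => by
        rw [← Finset.prod_mul_distrib]
        refine Finset.prod_congr rfl fun i _ => ?_
        rw [toAdd_mul, map_add, ← map_mul, AddMonoidAlgebra.single_mul_single, mul_one] }
  have hF : ∀ i (u : dualMonoid (t i)),
      F (.ofAdd (dualMap (π i) (H.mapsCone i) u)) = φ i (.single u 1) := by
    intro i u
    refine (Finset.prod_eq_single i (fun j _ hj => ?_) (by simp)).trans ?_
    · rw [toAdd_ofAdd, H.dualMap_dualMap_ne hj.symm]; exact map_one (φ j)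
    · rw [toAdd_ofAdd, H.dualMap_dualMap]
  refine ⟨(AddMonoidAlgebra.lift ℂ A (dualMonoid s) F).toRingHom, ⟨?_, fun i => ?_⟩, ?_⟩
  · ext c
    exact (AddMonoidAlgebra.lift ℂ A (dualMonoid s) F).commutes c
  · refine AddMonoidAlgebra.ringHom_ext (fun c => ?_) fun u => ?_
    · have h1 := RingHom.congr_fun (hφ i) c
      rw [RingHom.comp_apply, AddMonoidAlgebra.coe_algebraMap] at h1
      refine Eq.trans ?_ h1.symm
      rw [RingHom.comp_apply, AddMonoidAlgebra.mapDomainRingHom_apply,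
        AddMonoidAlgebra.mapDomain_single, map_zero]
      exact (AddMonoidAlgebra.lift ℂ A (dualMonoid s) F).commutes c
    · rw [RingHom.comp_apply, AddMonoidAlgebra.mapDomainRingHom_apply,
        AddMonoidAlgebra.mapDomain_single, ← hF]
      refine (AddMonoidAlgebra.lift_single F _ _).trans ?_
      rw [one_smul]
  · rintro ψ ⟨h1, h2⟩
    refine AddMonoidAlgebra.ringHom_ext (fun c => ?_) fun u => ?_
    · refine (RingHom.congr_fun h1 c).trans ?_
      exact ((AddMonoidAlgebra.lift ℂ A (dualMonoid s) F).commutes c).symm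
    · refine Eq.trans ?_ (AddMonoidAlgebra.lift_single F _ _).symm
      rw [one_smul]
      conv_lhs => rw [← H.sum_dualMap u]
      have hprod : (AddMonoidAlgebra.single
          (∑ i, dualMap (π i) (H.mapsCone i) (dualMap (l i) (H.mapsCone_incl i) u)) (1 : ℂ)) =
          ∏ i, AddMonoidAlgebra.single
            (dualMap (π i) (H.mapsCone i) (dualMap (l i) (H.mapsCone_incl i) u)) (1 : ℂ) := by
        exact map_prod (AddMonoidAlgebra.of ℂ (dualMonoid s)) (fun i => Multiplicative.ofAdd
          (dualMap (π i) (H.mapsCone i) (dualMap (l i) (H.mapsCone_incl i) u))) Finset.univ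
      rw [hprod, map_prod]
      refine Finset.prod_congr rfl fun i _ => ?_
      rw [toAdd_ofAdd, ← h2 i, RingHom.comp_apply, AddMonoidAlgebra.mapDomainRingHom_apply,
        AddMonoidAlgebra.mapDomain_single]

/-- Morphisms into an affine scheme are ring maps into global sections, so this is the dual of
`existsUnique_ringHom`; `σ` records the structure map over `ℂ`. -/
lemma isProd_chartMap : IsProd fun i => chartMap (π i) (H.mapsCone i) := by
  intro T g
  obtain ⟨σ, hσ⟩ := hom_Spec_eq T.hom
  have hg : ∀ i, ∃ φ : chartRing (t i) ⟶ Γ(T.left, ⊤), (g i).left = T.left.toSpecΓ ≫ Spec.map φ :=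
    fun i => hom_Spec_eq (g i).left
  choose φ hφ using hg
  have hφσ : ∀ i, (φ i).hom.comp (algebraMap ℂ _) = σ.hom := by
    intro i
    have h1 := Over.w (g i)
    rw [hφ i, hσ, Category.assoc] at h1
    have h2 : Spec.map (φ i) ≫ (chart (t i)).hom =
        Spec.map (CommRingCat.ofHom (algebraMap ℂ _) ≫ φ i) := (Spec.map_comp _ _).symm
    rw [h2] at h1
    exact congrArg (fun q => q.hom) (toSpecΓ_injective h1)
  obtain ⟨ψ, ⟨h1, h2⟩, h3⟩ := H.existsUnique_ringHom σ.hom (fun i => (φ i).hom) hφσ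
  refine ⟨Over.homMk (T.left.toSpecΓ ≫ Spec.map (CommRingCat.ofHom ψ)) ?_, fun i => ?_, ?_⟩
  · change (_ ≫ _) ≫ Spec.map (CommRingCat.ofHom (algebraMap ℂ _)) = _
    rw [Category.assoc, ← Spec.map_comp, ← CommRingCat.ofHom_comp, h1, hσ]
    rfl
  · ext1
    rw [hφ i]
    change (_ ≫ _) ≫ Spec.map (chartRingMap (π i) (H.mapsCone i)) = _
    rw [Category.assoc, ← Spec.map_comp]
    congr 2
    ext1
    exact h2 i
  · intro h hh
    obtain ⟨χ, hχ⟩ := hom_Spec_eq h.left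
    have hχψ : χ.hom = ψ := by
      refine h3 χ.hom ⟨?_, fun i => ?_⟩
      · have h4 := Over.w h
        rw [hχ, hσ, Category.assoc] at h4
        have h5 : Spec.map χ ≫ (chart s).hom =
            Spec.map (CommRingCat.ofHom (algebraMap ℂ _) ≫ χ) := (Spec.map_comp _ _).symm
        rw [h5] at h4
        exact congrArg (fun q => q.hom) (toSpecΓ_injective h4)
      · have h4 := congrArg (fun q => q.left) (hh i)
        rw [hφ i] at h4
        change h.left ≫ Spec.map (chartRingMap (π i) (H.mapsCone i)) = _ at h4
        rw [hχ, Category.assoc, ← Spec.map_comp] at h4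
        exact congrArg (fun q => q.hom) (toSpecΓ_injective h4)
    ext1
    refine hχ.trans ?_
    exact congrArg (fun k => T.left.toSpecΓ ≫ Spec.map (CommRingCat.ofHom k)) hχψ

lemma mem_cone_of_mapsCone {v : N} (h : ∀ i, toNQ (NI i) (π i v) ∈ cone (t i : Set (NI i))) :
    toNQ N v ∈ cone (s : Set N) := by
  rw [← H.sum_incl v, map_sum]
  exact Submodule.sum_mem _ fun i _ => (H.mapsCone_incl i).map_mem (h i)

/-- A cone of a fan whose generators are mapped into the `⟨t i⟩` is a face of `⟨s⟩`. -/
lemma subset_of_mapsCone {X : SmoothFan N} (hs : s ∈ X.cones) {s' : Finset N}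
    (hs' : s' ∈ X.cones) (h : ∀ i, MapsCone (π i) s' (t i)) : s' ⊆ s := fun v hv =>
  X.mem_of_mem_cone hs' hs hv (H.mem_cone_of_mapsCone fun i => h i v hv)

end IsConeSum

end Charts

end Toric

namespace Toric

/-! ### Products of toric varieties -/

section ToricProduct

variable {N : Type} [AddCommGroup N] {X : SmoothFan N} {k : ℕ} {d : Fin k → ℕ}
  {F : ∀ i, SmoothFan (Fin (d i) → ℤ)}

lemma mapsCone_of_forall_mem {N' : Type} [AddCommGroup N'] {φ : N →ₗ[ℤ] N'} {s : Finset N}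
    {s' : Finset N'} (h : ∀ x ∈ s, φ x = 0 ∨ φ x ∈ s') : MapsCone φ s s' := by
  intro x hx
  rcases h x hx with h | h
  · rw [h, map_zero]; exact Submodule.zero_mem _
  · exact Submodule.subset_span ⟨_, h, rfl⟩

lemma isConeSum_pi (e : N ≃ₗ[ℤ] (∀ i, Fin (d i) → ℤ)) {s : Finset N}
    {t : ∀ i, Finset (Fin (d i) → ℤ)}
    (h : e '' (s : Set N) = ⋃ i, LinearMap.single ℤ (fun i => Fin (d i) → ℤ) i ''
      (t i : Set (Fin (d i) → ℤ))) :
    IsConeSum (NI := fun i => Fin (d i) → ℤ) (fun i => LinearMap.proj i ∘ₗ e.toLinearMap)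
      (fun i => e.symm.toLinearMap ∘ₗ LinearMap.single ℤ (fun i => Fin (d i) → ℤ) i) s t where
  proj_incl i x := by simp
  proj_incl_ne i j x hij := by simp [Pi.single_eq_of_ne hij]
  sum_incl v := by
    apply e.injective
    rw [map_sum]
    simp only [LinearMap.comp_apply, LinearEquiv.coe_coe, LinearEquiv.apply_symm_apply,
      LinearMap.coe_single, LinearMap.proj_apply]
    exact Finset.univ_sum_single (e v)
  mapsCone i := mapsCone_of_forall_mem fun x hx => by
    have h1 : e x ∈ e '' (s : Set N) := ⟨x, hx, rfl⟩
    rw [h, Set.mem_iUnion] at h1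
    obtain ⟨j, a, ha, hax⟩ := h1
    change e x i = 0 ∨ e x i ∈ t i
    rw [← hax]
    by_cases hij : i = j
    · subst hij
      right
      simpa using ha
    · left
      simp [Pi.single_eq_of_ne hij]
  mapsCone_incl i := mapsCone_of_forall_mem fun a ha => by
    right
    have h1 : LinearMap.single ℤ (fun i => Fin (d i) → ℤ) i a ∈ e '' (s : Set N) := by
      rw [h]
      exact Set.mem_iUnion.2 ⟨i, a, ha, rfl⟩
    obtain ⟨x, hx, hxa⟩ := h1
    change e.symm _ ∈ s
    rw [← hxa, e.symm_apply_apply]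
    exact hx

/-- A fan whose cones are the products of the cones of the factors gives the product variety. -/
theorem isToricProduct_of_cones (e : N ≃ₗ[ℤ] (∀ i, Fin (d i) → ℤ))
    (he : ∀ s : Finset N, s ∈ X.cones ↔
      ∃ t : ∀ i, Finset (Fin (d i) → ℤ), (∀ i, t i ∈ (F i).cones) ∧
        e '' (s : Set N) =
          ⋃ i, LinearMap.single ℤ (fun i => Fin (d i) → ℤ) i '' (t i : Set (Fin (d i) → ℤ))) :
    IsToricProduct X F := by
  classical
  have hmor : ∀ i, ∃ p : X.variety ⟶ (F i).variety,
      IsToricMorphism X (F i) (LinearMap.proj i ∘ₗ e.toLinearMap) p := by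
    intro i
    refine exists_toricMorphism fun s hs => ?_
    obtain ⟨t, ht, hst⟩ := (he s).1 hs
    exact ⟨t i, ht i, (isConeSum_pi e hst).mapsCone i⟩
  choose p hp using hmor
  refine ⟨e, he, p, hp, IsProd.nonempty_isLimit ?_⟩
  have hexs : ∀ t : {t : ∀ i, Finset (Fin (d i) → ℤ) // ∀ i, t i ∈ (F i).cones},
      ∃ s : Finset N, e '' (s : Set N) =
          ⋃ i, LinearMap.single ℤ (fun i => Fin (d i) → ℤ) i '' (t.1 i : Set (Fin (d i) → ℤ)) := by
    intro t
    refine ⟨(Finset.univ.biUnion fun i =>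
      (t.1 i).image (LinearMap.single ℤ (fun i => Fin (d i) → ℤ) i)).image e.symm, ?_⟩
    rw [Finset.coe_image, ← Set.image_comp]
    simp
  choose s hs using hexs
  have hsX : ∀ t, s t ∈ X.cones := fun t => (he _).2 ⟨t.1, t.2, hs t⟩
  have H := fun t => isConeSum_pi e (hs t)
  refine isProd_of_local p (fun t => X.ι (s t) (hsX t)) (fun t i => (F i).ι (t.1 i) (t.2 i))
    (fun t i => chartMap _ ((H t).mapsCone i)) (fun t => inferInstance) (fun t i => inferInstance)
    (fun t i => ((hp i).comp_eq _ _ _ _ _).symm) (fun t => (H t).isProd_chartMap) ?_ ?_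
  · intro t x hx
    obtain ⟨s', hs', hxs', hmin⟩ := X.exists_minimal_chart x
    -- The smallest cone around `x` maps into each `⟨t i⟩`, so it is a face of `s t`.
    have hsub := (H t).subset_of_mapsCone (hsX t) hs' fun i =>
      (hp i).mapsCone_of_minimal hs' hxs' hmin ((F i).chartSet_eq_range (t.2 i) ▸ hx i)
    rw [← X.chartSet_eq_range (hsX t)]
    exact X.chartSet_mono (hsX t) hsub hxs'
  · intro y
    choose t ht z hz using fun i => (F i).exists_ι_eq (y i)
    exact ⟨⟨t, ht⟩, fun i => ⟨z i, hz i⟩⟩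

/-- The fan of a smooth toric Fano variety is determined by its generators, compatibly with
products. -/
theorem SmoothFan.IsFano.isToricProduct [Module.Free ℤ N] (hX : X.IsFano)
    (hF : ∀ i, (F i).IsFano) (e : N ≃ₗ[ℤ] (∀ i, Fin (d i) → ℤ))
    (he : ∀ v, v ∈ X.gens ↔ ∃ i, ∃ a ∈ (F i).gens, e v = Pi.single i a) : IsToricProduct X F := by
  classical
  have hne : ∀ i, ∀ a ∈ (F i).gens, ∀ j b, (Pi.single i a : ∀ i, Fin (d i) → ℤ) = Pi.single j b →
      ∃ h : i = j, h ▸ a = b := by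
    intro i a ha j b hab
    by_cases h : i = j
    · subst h
      exact ⟨rfl, Pi.single_injective _ hab⟩
    · exfalso
      have := congrFun hab i
      rw [Pi.single_eq_same, Pi.single_eq_of_ne h] at this
      exact (F i).ne_zero_of_mem_gens ha this
  refine isToricProduct_of_cones e fun s => ⟨fun hs => ?_, ?_⟩
  · obtain ⟨f, f1, f2⟩ := (X.isFano_iff.1 hX).2 s hs
    let l := fun i => e.symm.toLinearMap ∘ₗ LinearMap.single ℤ (fun i => Fin (d i) → ℤ) i
    have hel : ∀ i a, e (l i a) = Pi.single i a := fun i a => by simp [l]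
    have hl : ∀ i a, a ∈ (F i).gens → l i a ∈ X.gens := fun i a ha =>
      (he _).2 ⟨i, a, ha, hel i a⟩
    -- The factor `t i` is the trace of `s` on the `i`-th summand; restricting `f` shows that it is
    -- a face.
    let t : ∀ i, Finset (Fin (d i) → ℤ) := fun i =>
      (F i).finite_gens.toFinset.filter fun a => l i a ∈ s
    have ht : ∀ i a, a ∈ t i ↔ a ∈ (F i).gens ∧ l i a ∈ s := fun i a => by simp [t]
    refine ⟨t, fun i => (hF i).mem_cones (fun a ha => ((ht i a).1 ha).1) (f ∘ₗ l i)
      (fun a ha => f1 _ ((ht i a).1 ha).2)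
      fun a ha hat => f2 _ (hl i a ha) fun h => hat ((ht i a).2 ⟨ha, h⟩), ?_⟩
    ext v
    rw [Set.mem_iUnion]
    constructor
    · rintro ⟨x, hx, rfl⟩
      obtain ⟨i, a, ha, hxa⟩ := (he x).1 (X.mem_gens_of_mem hs hx)
      refine ⟨i, a, (ht i a).2 ⟨ha, ?_⟩, hxa.symm⟩
      have : l i a = x := e.injective (by rw [hel, hxa])
      rw [this]
      exact hx
    · rintro ⟨i, a, ha, rfl⟩
      exact ⟨l i a, ((ht i a).1 ha).2, hel i a⟩
  · rintro ⟨t, ht, hst⟩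
    choose f f1 f2 using fun i => ((F i).isFano_iff.1 (hF i)).2 (t i) (ht i)
    -- Every generator lives in one summand, so the sum of the supporting forms supports the product
    -- cone.
    let g : N →ₗ[ℤ] ℚ := ∑ i, f i ∘ₗ LinearMap.proj i ∘ₗ e.toLinearMap
    have hg : ∀ x i a, e x = Pi.single i a → g x = f i a := by
      intro x i a hx
      rw [LinearMap.sum_apply, Finset.sum_eq_single i]
      · simp [hx]
      · intro j _ hj
        simp [hx, Pi.single_eq_of_ne hj]
      · simp
    have hs : ∀ x, x ∈ s ↔ ∃ i, ∃ a ∈ t i, e x = Pi.single i a := by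
      intro x
      have : x ∈ s ↔ e x ∈ e '' (s : Set N) := by
        rw [e.injective.mem_set_image]; rfl
      rw [this, hst, Set.mem_iUnion]
      exact exists_congr fun i => exists_congr fun a => and_congr Iff.rfl eq_comm
    refine hX.mem_cones (fun x hx => ?_) g (fun x hx => ?_) fun x hx hxs => ?_
    · obtain ⟨i, a, ha, hxa⟩ := (hs x).1 hx
      exact (he x).2 ⟨i, a, (F i).mem_gens_of_mem (ht i) ha, hxa⟩
    · obtain ⟨i, a, ha, hxa⟩ := (hs x).1 hx
      rw [hg x i a hxa, f1 i a ha]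
    · obtain ⟨i, a, ha, hxa⟩ := (he x).1 hx
      rw [hg x i a hxa]
      exact f2 i a ha fun h => hxs ((hs x).2 ⟨i, a, h, hxa⟩)

end ToricProduct

end Toric

namespace Toric

/-! ### Sums of two lattices -/

section Pairs

/-- The family of two types. -/
def PairFam (A B : Type) : Bool → Type
  | true => A
  | false => B

instance (A B : Type) [AddCommGroup A] [AddCommGroup B] : ∀ i, AddCommGroup (PairFam A B i)
  | true => inferInstanceAs (AddCommGroup A)
  | false => inferInstanceAs (AddCommGroup B)

variable {N A B : Type} [AddCommGroup N] [AddCommGroup A] [AddCommGroup B]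

/-- The projections of a lattice to two summands. -/
def pairProj (e : N ≃ₗ[ℤ] A × B) : ∀ i, N →ₗ[ℤ] PairFam A B i
  | true => LinearMap.fst ℤ A B ∘ₗ e.toLinearMap
  | false => LinearMap.snd ℤ A B ∘ₗ e.toLinearMap

/-- The inclusions of two summands of a lattice. -/
def pairIncl (e : N ≃ₗ[ℤ] A × B) : ∀ i, PairFam A B i →ₗ[ℤ] N
  | true => e.symm.toLinearMap ∘ₗ LinearMap.inl ℤ A B
  | false => e.symm.toLinearMap ∘ₗ LinearMap.inr ℤ A B

/-- Two finite sets of vectors in the two summands. -/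
def pairSet (t : Finset A) (τ : Finset B) : ∀ i, Finset (PairFam A B i)
  | true => t
  | false => τ

variable {e : N ≃ₗ[ℤ] A × B} {s : Finset N} {t : Finset A} {τ : Finset B}

lemma mem_of_image_eq (h : e '' (s : Set N) =
    LinearMap.inl ℤ A B '' (t : Set A) ∪ LinearMap.inr ℤ A B '' (τ : Set B)) (x : N) :
    x ∈ s ↔ (∃ a ∈ t, e x = (a, 0)) ∨ ∃ b ∈ τ, e x = (0, b) := by
  have : x ∈ s ↔ e x ∈ e '' (s : Set N) := by
    rw [e.injective.mem_set_image]; rfl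
  rw [this, h]
  exact or_congr (exists_congr fun a => and_congr Iff.rfl eq_comm)
    (exists_congr fun a => and_congr Iff.rfl eq_comm)

lemma isConeSum_pair (h : e '' (s : Set N) =
    LinearMap.inl ℤ A B '' (t : Set A) ∪ LinearMap.inr ℤ A B '' (τ : Set B)) :
    IsConeSum (pairProj e) (pairIncl e) s (pairSet t τ) where
  proj_incl i x := by
    cases i
    · exact congrArg Prod.snd (e.apply_symm_apply ((0 : A), (x : B)))
    · exact congrArg Prod.fst (e.apply_symm_apply ((x : A), (0 : B)))
  proj_incl_ne i j x hij := by
    cases i <;> cases j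
    · exact absurd rfl hij
    · change (e (e.symm (x, (0 : B)))).2 = 0
      simp
    · change (e (e.symm ((0 : A), x))).1 = 0
      simp
    · exact absurd rfl hij
  sum_incl v := by
    rw [Fintype.sum_bool]
    change e.symm ((e v).1, (0 : B)) + e.symm ((0 : A), (e v).2) = v
    rw [← map_add, Prod.mk_add_mk, add_zero, zero_add, Prod.mk.eta, e.symm_apply_apply]
  mapsCone i := by
    refine mapsCone_of_forall_mem fun x hx => ?_
    cases i
    · change (e x).2 = 0 ∨ (e x).2 ∈ τ
      rcases (mem_of_image_eq h x).1 hx with ⟨a, ha, hxa⟩ | ⟨b, hb, hxb⟩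
      · exact Or.inl (by rw [hxa])
      · exact Or.inr (by rwa [hxb])
    · change (e x).1 = 0 ∨ (e x).1 ∈ t
      rcases (mem_of_image_eq h x).1 hx with ⟨a, ha, hxa⟩ | ⟨b, hb, hxb⟩
      · exact Or.inr (by rwa [hxa])
      · exact Or.inl (by rw [hxb])
  mapsCone_incl i := by
    refine mapsCone_of_forall_mem fun x hx => Or.inr ((mem_of_image_eq h _).2 ?_)
    cases i
    · exact Or.inr ⟨x, hx, e.apply_symm_apply _⟩
    · exact Or.inl ⟨x, hx, e.apply_symm_apply _⟩

lemma mem_cone_pair_iff (h : e '' (s : Set N) =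
    LinearMap.inl ℤ A B '' (t : Set A) ∪ LinearMap.inr ℤ A B '' (τ : Set B)) (v : N) :
    toNQ N v ∈ cone (s : Set N) ↔
      toNQ A (e v).1 ∈ cone (t : Set A) ∧ toNQ B (e v).2 ∈ cone (τ : Set B) := by
  have H := isConeSum_pair h
  refine ⟨fun hv => ⟨(H.mapsCone true).map_mem hv, (H.mapsCone false).map_mem hv⟩, fun hv => ?_⟩
  exact H.mem_cone_of_mapsCone fun i => by
    cases i
    · exact hv.2
    · exact hv.1

end Pairs

/-! ### Toric bundles -/

section Bundle

variable {N NF NZ : Type} [AddCommGroup N] [AddCommGroup NF] [AddCommGroup NZ]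

/-- A fan all of whose subfans over cones of `Z` split gives a toric bundle. -/
theorem isToricBundle_of_cones {X : SmoothFan N} {Z : SmoothFan NZ} {F : SmoothFan NF}
    (π : N →ₗ[ℤ] NZ) (hπ : ∀ s ∈ X.cones, ∃ τ ∈ Z.cones, MapsCone π s τ)
    (he : ∀ τ ∈ Z.cones, ∃ e : N ≃ₗ[ℤ] NF × NZ, LinearMap.snd ℤ NF NZ ∘ₗ e.toLinearMap = π ∧
      ∀ s : Finset N, s ∈ (X.preimage π τ).cones ↔
        ∃ t ∈ F.cones, ∃ τ' ⊆ τ, e '' (s : Set N) =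
          LinearMap.inl ℤ NF NZ '' (t : Set NF) ∪ LinearMap.inr ℤ NF NZ '' (τ' : Set NZ)) :
    IsToricBundle X Z F := by
  classical
  obtain ⟨f, hf⟩ := exists_toricMorphism hπ
  refine ⟨π, f, hf, fun τ hτ => ?_⟩
  obtain ⟨e, hes, hc⟩ := he τ hτ
  refine ⟨e, hes, hc, ?_⟩
  let P := X.preimage π τ
  have hPX : P.cones ⊆ X.cones := fun s hs => hs.1
  obtain ⟨j, hj, hjι, hjo, hjr⟩ := exists_subfan_immersion hPX
  have hqc : ∀ s ∈ P.cones, ∃ t ∈ F.cones,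
      MapsCone (LinearMap.fst ℤ NF NZ ∘ₗ e.toLinearMap) s t := by
    intro s hs
    obtain ⟨t, ht, τ', hτ', hst⟩ := (hc s).1 hs
    exact ⟨t, ht, (isConeSum_pair hst).mapsCone true⟩
  obtain ⟨q, hq⟩ := exists_toricMorphism hqc
  let c : Cocone P.diagram :=
    { pt := chart τ
      ι :=
        { app := fun s => chartMap π s.2.2
          naturality := fun t s f => by
            change faceMap (leOfHom f) ≫ chartMap π s.2.2 = chartMap π t.2.2 ≫ 𝟙 _
            rw [Category.comp_id, faceMap_chartMap] } }
  let r : P.variety ⟶ chart τ := colimit.desc P.diagram c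
  have hr : ∀ s (hs : s ∈ P.cones), P.ι s hs ≫ r = chartMap π hs.2 := fun s hs =>
    colimit.ι_desc c ⟨s, hs⟩
  have hw : j ≫ f = r ≫ Z.ι τ hτ := P.variety_hom_ext fun s hs => by
    rw [← Category.assoc, ← Category.assoc, hjι, hr, hf.comp_eq s (hPX hs) τ hτ hs.2]
  refine ⟨j, q, r, hj, hq, ?_, ?_⟩
  · have hlift : ∀ (T : Over base) (a : T ⟶ X.variety) (b : T ⟶ chart τ), a ≫ f = b ≫ Z.ι τ hτ →
        ∃ g : T ⟶ P.variety, g ≫ j = a := by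
      intro T a b hab
      -- A point mapped into `U_τ` has a smallest cone that `π` maps into `⟨τ⟩`, so it lies in the
      -- preimage subfan.
      refine exists_lift_openImmersion j a ?_
      rintro _ ⟨t, rfl⟩
      rw [hjr]
      obtain ⟨s, hs, hxs, hmin⟩ := X.exists_minimal_chart (a.left t)
      refine ⟨s, ⟨hs, hf.mapsCone_of_minimal hs hxs hmin ⟨hτ, b.left t, ?_⟩⟩, hxs⟩
      exact (congrArg (fun q => q.left t) hab).symm
    choose g hg using hlift
    refine ⟨⟨hw⟩, ⟨PullbackCone.IsLimit.mk hw (fun s => g s.pt s.fst s.snd s.condition)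
      (fun s => hg _ _ _ _) (fun s => ?_) fun s m hm _ => ?_⟩⟩
    · refine cancel_openImmersion (Z.ι τ hτ) ?_
      rw [Category.assoc, ← hw, ← Category.assoc, hg, s.condition]
    · exact cancel_openImmersion j (hm.trans (hg _ _ _ _).symm)
  · let Y : Bool → Over base := fun i => match i with
      | true => F.variety
      | false => chart τ
    let p : ∀ i, P.variety ⟶ Y i := fun i => match i with
      | true => q
      | false => r
    -- As the second factor is the single chart `U_τ`, the joins of cones of the fibre with all of
    -- `τ` give enough charts.
    have hexs : ∀ t : {t : Finset NF // t ∈ F.cones}, ∃ s : Finset N, e '' (s : Set N) =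
        LinearMap.inl ℤ NF NZ '' (t.1 : Set NF) ∪ LinearMap.inr ℤ NF NZ '' (τ : Set NZ) := by
      intro t
      refine ⟨(t.1.image (LinearMap.inl ℤ NF NZ) ∪ τ.image (LinearMap.inr ℤ NF NZ)).image e.symm, ?_⟩
      rw [Finset.coe_image, ← Set.image_comp]
      simp
    choose s hs using hexs
    have hsP : ∀ t, s t ∈ P.cones := fun t => (hc _).2 ⟨t.1, t.2, τ, subset_rfl, hs t⟩
    have H := fun t => isConeSum_pair (hs t)
    let b : ∀ t : {t : Finset NF // t ∈ F.cones}, ∀ i, chart (pairSet t.1 τ i) ⟶ Y i :=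
      fun t i => match i with
        | true => F.ι t.1 t.2
        | false => 𝟙 _
    have hp : IsProd p := by
      refine isProd_of_local p (fun t => P.ι (s t) (hsP t)) b
        (fun t i => chartMap _ ((H t).mapsCone i)) (fun t => inferInstance) (fun t i => ?_)
        (fun t i => ?_) (fun t => (H t).isProd_chartMap) ?_ ?_
      · cases i
        · exact inferInstanceAs (IsOpenImmersion (𝟙 (chart τ).left))
        · exact inferInstanceAs (IsOpenImmersion (F.ι t.1 t.2).left)
      · cases i
        · refine (Category.comp_id _).trans ?_
          have h1 := hr (s t) (hsP t)
          refine Eq.trans ?_ h1.symm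
          have : pairProj e false = π := hes
          congr 1
        · exact (hq.comp_eq _ _ _ _ _).symm
      · intro t x hx
        obtain ⟨s', hs', hxs', hmin⟩ := P.exists_minimal_chart x
        have hsub := (H t).subset_of_mapsCone (hsP t) hs' fun i => by
          cases i
          · have h1 : MapsCone π s' τ := hs'.2
            rw [← hes] at h1
            exact h1
          · refine hq.mapsCone_of_minimal hs' hxs' hmin (t := t.1) ?_
            rw [F.chartSet_eq_range t.2]
            exact hx true
        rw [← P.chartSet_eq_range (hsP t)]
        exact P.chartSet_mono (hsP t) hsub hxs'
      · intro y
        obtain ⟨t, ht, z, hz⟩ := F.exists_ι_eq (y true)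
        refine ⟨⟨t, ht⟩, fun i => ?_⟩
        cases i
        · exact ⟨y false, rfl⟩
        · exact ⟨z, hz⟩
    refine IsProd.nonempty_isLimit_binary fun T a b => ?_
    obtain ⟨h, hh, hu⟩ := hp T fun i => match i with
      | true => a
      | false => b
    refine ⟨h, ⟨hh true, hh false⟩, fun h' hh' => hu h' fun i => ?_⟩
    cases i
    · exact hh'.2
    · exact hh'.1

/-- The lattice data of a toric bundle: an exact sequence of lattices and a lift of the generators
of the base that extends linearly over each cone of the base. -/
structure BundleData (N : Type) [AddCommGroup N] (F : SmoothFan NF) (Z : SmoothFan NZ) where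
  /-- the inclusion of the lattice of the fibre -/
  incl : NF →ₗ[ℤ] N
  /-- the projection to the lattice of the base -/
  proj : N →ₗ[ℤ] NZ
  /-- the lifts of the generators of the base -/
  lift : NZ → N
  incl_injective : Function.Injective incl
  exact : ∀ v, proj v = 0 ↔ ∃ a, incl a = v
  exists_section : ∀ τ ∈ Z.cones, ∃ k : NZ →ₗ[ℤ] N, (∀ c, proj (k c) = c) ∧ ∀ x ∈ τ, k x = lift x

namespace BundleData

variable {F : SmoothFan NF} {Z : SmoothFan NZ} (D : BundleData N F Z)

lemma proj_incl (a : NF) : D.proj (D.incl a) = 0 := (D.exact _).2 ⟨a, rfl⟩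

/-- A section that realizes the lifts over `τ` splits the exact sequence. The splitting depends on
`τ`, which allows a nontrivial bundle. -/
lemma exists_split {τ : Finset NZ} (hτ : τ ∈ Z.cones) : ∃ (k : NZ →ₗ[ℤ] N) (e : N ≃ₗ[ℤ] NF × NZ),
    (∀ x ∈ τ, k x = D.lift x) ∧ (∀ v, (e v).2 = D.proj v) ∧ (∀ a, e (D.incl a) = (a, 0)) ∧
      (∀ b, e (k b) = (0, b)) ∧ ∀ v, D.incl (e v).1 + k (e v).2 = v := by
  obtain ⟨k, hk, hkl⟩ := D.exists_section τ hτ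
  have hproj : ∀ a b, D.proj ((D.incl.coprod k) (a, b)) = b := fun a b => by
    rw [LinearMap.coprod_apply, map_add, D.proj_incl, hk, zero_add]
  have hbij : Function.Bijective (D.incl.coprod k) := by
    constructor
    · rintro ⟨a, b⟩ ⟨a', b'⟩ h
      have hb : b = b' := by rw [← hproj a b, h, hproj]
      subst hb
      rw [LinearMap.coprod_apply, LinearMap.coprod_apply] at h
      exact congrArg (·, b) (D.incl_injective (add_right_cancel h))
    · intro v
      obtain ⟨a, ha⟩ := (D.exact (v - k (D.proj v))).1 (by rw [map_sub, hk, sub_self])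
      exact ⟨(a, D.proj v), by rw [LinearMap.coprod_apply, ha, sub_add_cancel]⟩
  let E := LinearEquiv.ofBijective _ hbij
  have hE : ∀ a b, E (a, b) = D.incl a + k b := fun a b => LinearMap.coprod_apply _ _ _
  refine ⟨k, E.symm, hkl, fun v => ?_, fun a => ?_, fun b => ?_, fun v => ?_⟩
  · obtain ⟨⟨a, b⟩, rfl⟩ := E.surjective v
    rw [E.symm_apply_apply]
    exact (hproj a b).symm
  · rw [E.symm_apply_eq, hE, map_zero, add_zero]
  · rw [E.symm_apply_eq, hE, map_zero, zero_add]
  · rw [← hE, Prod.mk.eta, E.apply_symm_apply]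

open Classical in
/-- The cone over a cone of the fibre and a cone of the base. -/
noncomputable def join (t : Finset NF) (τ : Finset NZ) : Finset N :=
  t.image D.incl ∪ τ.image D.lift

lemma mem_join {t : Finset NF} {τ : Finset NZ} {x : N} :
    x ∈ D.join t τ ↔ (∃ a ∈ t, D.incl a = x) ∨ ∃ b ∈ τ, D.lift b = x := by
  simp [join]

lemma join_mono {t t' : Finset NF} {τ τ' : Finset NZ} (h : t ⊆ t') (h' : τ ⊆ τ') :
    D.join t τ ⊆ D.join t' τ' := fun x hx => by
  rw [mem_join] at hx ⊢
  exact hx.imp (fun ⟨a, ha, h1⟩ => ⟨a, h ha, h1⟩) fun ⟨a, ha, h1⟩ => ⟨a, h' ha, h1⟩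

lemma image_join {k : NZ →ₗ[ℤ] N} {e : N ≃ₗ[ℤ] NF × NZ} {τ : Finset NZ}
    (hk : ∀ x ∈ τ, k x = D.lift x) (h1 : ∀ a, e (D.incl a) = (a, 0)) (h2 : ∀ b, e (k b) = (0, b))
    {t : Finset NF} {τ' : Finset NZ} (hτ' : τ' ⊆ τ) : e '' (D.join t τ' : Set N) =
      LinearMap.inl ℤ NF NZ '' (t : Set NF) ∪ LinearMap.inr ℤ NF NZ '' (τ' : Set NZ) := by
  ext y
  constructor
  · rintro ⟨x, hx, rfl⟩
    rcases D.mem_join.1 hx with ⟨a, ha, rfl⟩ | ⟨b, hb, rfl⟩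
    · exact Or.inl ⟨a, ha, (h1 a).symm⟩
    · exact Or.inr ⟨b, hb, by rw [← hk b (hτ' hb), h2]; rfl⟩
  · rintro (⟨a, ha, rfl⟩ | ⟨b, hb, rfl⟩)
    · exact ⟨D.incl a, D.mem_join.2 (Or.inl ⟨a, ha, rfl⟩), h1 a⟩
    · exact ⟨D.lift b, D.mem_join.2 (Or.inr ⟨b, hb, rfl⟩), by rw [← hk b (hτ' hb), h2]; rfl⟩

/-- The fan of the bundle. -/
noncomputable def fan [Module.Free ℤ N] : SmoothFan N where
  cones := {s | ∃ t ∈ F.cones, ∃ τ ∈ Z.cones, s = D.join t τ}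
  finite_cones := by
    refine ((F.finite_cones.prod Z.finite_cones).image fun p => D.join p.1 p.2).subset ?_
    rintro s ⟨t, ht, τ, hτ, rfl⟩
    exact ⟨(t, τ), ⟨ht, hτ⟩, rfl⟩
  empty_mem := ⟨∅, F.empty_mem, ∅, Z.empty_mem, by simp [join]⟩
  face_mem := by
    classical
    rintro s s' ⟨t, ht, τ, hτ, rfl⟩ hs'
    refine ⟨t.filter fun a => D.incl a ∈ s', F.face_mem ht (Finset.filter_subset _ _),
      τ.filter fun b => D.lift b ∈ s', Z.face_mem hτ (Finset.filter_subset _ _), ?_⟩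
    ext x
    rw [mem_join]
    constructor
    · intro hx
      refine (D.mem_join.1 (hs' hx)).imp ?_ ?_
      · rintro ⟨a, ha, rfl⟩
        exact ⟨a, Finset.mem_filter.2 ⟨ha, hx⟩, rfl⟩
      · rintro ⟨a, ha, rfl⟩
        exact ⟨a, Finset.mem_filter.2 ⟨ha, hx⟩, rfl⟩
    · rintro (⟨a, ha, rfl⟩ | ⟨a, ha, rfl⟩)
      · exact (Finset.mem_filter.1 ha).2
      · exact (Finset.mem_filter.1 ha).2
  unimodular := by
    rintro s ⟨t, ht, τ, hτ, rfl⟩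
    obtain ⟨k, e, hk, -, h1, h2, -⟩ := D.exists_split hτ
    obtain ⟨ι, b, hb⟩ := F.unimodular ht
    obtain ⟨κ, c, hc⟩ := Z.unimodular hτ
    refine ⟨ι ⊕ κ, (b.prod c).map e.symm, ?_⟩
    intro x hx
    rcases D.mem_join.1 hx with ⟨a, ha, rfl⟩ | ⟨a, ha, rfl⟩
    · obtain ⟨i, rfl⟩ := hb ha
      refine ⟨Sum.inl i, ?_⟩
      rw [Module.Basis.map_apply, LinearEquiv.symm_apply_eq, h1]
      simp
    · obtain ⟨i, rfl⟩ := hc ha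
      refine ⟨Sum.inr i, ?_⟩
      rw [Module.Basis.map_apply, LinearEquiv.symm_apply_eq, ← hk _ ha, h2]
      simp
  inter := by
    classical
    rintro _ _ ⟨t₁, ht₁, τ₁, hτ₁, rfl⟩ ⟨t₂, ht₂, τ₂, hτ₂, rfl⟩
    obtain ⟨k₁, e₁, hk₁, hp₁, h1₁, h2₁, h3₁⟩ := D.exists_split hτ₁
    obtain ⟨k₂, e₂, hk₂, hp₂, h1₂, h2₂, h3₂⟩ := D.exists_split hτ₂
    refine le_antisymm ?_ (le_inf (Submodule.span_mono (Set.image_mono Set.inter_subset_left))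
      (Submodule.span_mono (Set.image_mono Set.inter_subset_right)))
    rintro w ⟨hw₁, hw₂⟩
    obtain ⟨n, hn, v, hv⟩ := exists_nsmul_eq_toNQ w
    refine mem_cone_of_smul hn ?_
    have hmem : ∀ {s : Set N}, w ∈ cone s → toNQ N v ∈ cone s := fun {s} h => by
      rw [← hv]
      exact Submodule.smul_mem (cone s) (⟨(n : ℚ), by positivity⟩ : {r : ℚ // 0 ≤ r}) h
    have hv₁ := (mem_cone_pair_iff (D.image_join hk₁ h1₁ h2₁ subset_rfl) v).1 (hmem hw₁)
    have hv₂ := (mem_cone_pair_iff (D.image_join hk₂ h1₂ h2₂ subset_rfl) v).1 (hmem hw₂)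
    rw [hp₁] at hv₁
    rw [hp₂] at hv₂
    have hτ : toNQ NZ (D.proj v) ∈ cone ((τ₁ ∩ τ₂ : Finset NZ) : Set NZ) := by
      rw [Finset.coe_inter, ← Z.inter hτ₁ hτ₂]
      exact ⟨hv₁.2, hv₂.2⟩
    -- The two sections agree on `τ₁ ∩ τ₂`, and the cone over it contains the projection of `v`. So
    -- the fibre components of `v` in the two splittings agree as well.
    have hkk : k₁ (D.proj v) = k₂ (D.proj v) := by
      obtain ⟨c, -, hc⟩ := mem_cone_iff.1 hτ
      have hbc : ∀ (k : NZ →ₗ[ℤ] N) x, LinearMap.baseChange ℚ k (toNQ NZ x) = toNQ N (k x) :=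
        fun k x => by
          change LinearMap.baseChange ℚ k ((1 : ℚ) ⊗ₜ[ℤ] x) = _
          rw [LinearMap.baseChange_tmul]
          rfl
      apply toNQ_injective
      rw [← hbc, ← hbc, hc, map_sum, map_sum]
      refine Finset.sum_congr rfl fun x hx => ?_
      rw [map_smul, map_smul, hbc, hbc, hk₁ x (Finset.mem_inter.1 hx).1,
        hk₂ x (Finset.mem_inter.1 hx).2]
    have hee : (e₁ v).1 = (e₂ v).1 := by
      apply D.incl_injective
      have a1 := h3₁ v
      have a2 := h3₂ v
      rw [hp₁, hkk] at a1
      rw [hp₂] at a2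
      exact add_right_cancel (a1.trans a2.symm)
    have ht : toNQ NF (e₁ v).1 ∈ cone ((t₁ ∩ t₂ : Finset NF) : Set NF) := by
      rw [Finset.coe_inter, ← F.inter ht₁ ht₂]
      exact ⟨hv₁.1, hee ▸ hv₂.1⟩
    have hj := (mem_cone_pair_iff (D.image_join hk₁ h1₁ h2₁ (t := t₁ ∩ t₂)
      (Finset.inter_subset_left (s₂ := τ₂))) v).2 ⟨ht, by rw [hp₁]; exact hτ⟩
    rw [hv]
    refine Submodule.span_mono (Set.image_mono ?_) hj
    exact fun x hx => ⟨D.join_mono Finset.inter_subset_left Finset.inter_subset_left hx,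
      D.join_mono Finset.inter_subset_right Finset.inter_subset_right hx⟩

variable [Module.Free ℤ N]

lemma isComplete_fan (hF : F.IsComplete) (hZ : Z.IsComplete) : D.fan.IsComplete := by
  refine SmoothFan.isComplete_iff.2 fun v => ?_
  obtain ⟨τ, hτ, hv⟩ := hZ (toNQ NZ (D.proj v))
  obtain ⟨k, e, hk, hp, h1, h2, -⟩ := D.exists_split hτ
  obtain ⟨t, ht, hv'⟩ := hF (toNQ NF (e v).1)
  refine ⟨D.join t τ, ⟨t, ht, τ, hτ, rfl⟩, ?_⟩
  rw [mem_cone_pair_iff (D.image_join hk h1 h2 subset_rfl), hp]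
  exact ⟨hv', hv⟩

lemma gens_fan : D.fan.gens = D.incl '' F.gens ∪ D.lift '' Z.gens := by
  ext x
  constructor
  · rintro ⟨t, ht, τ, hτ, hx⟩
    have : x ∈ D.join t τ := by rw [← hx]; exact Finset.mem_singleton_self x
    rcases D.mem_join.1 this with ⟨a, ha, rfl⟩ | ⟨a, ha, rfl⟩
    · exact Or.inl ⟨a, F.mem_gens_of_mem ht ha, rfl⟩
    · exact Or.inr ⟨a, Z.mem_gens_of_mem hτ ha, rfl⟩
  · rintro (⟨a, ha, rfl⟩ | ⟨a, ha, rfl⟩)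
    · exact ⟨{a}, ha, ∅, Z.empty_mem, by simp [join]⟩
    · exact ⟨∅, F.empty_mem, {a}, ha, by simp [join]⟩

theorem isToricBundle_fan : IsToricBundle D.fan Z F := by
  have hproj : ∀ {τ}, τ ∈ Z.cones → ∀ x ∈ τ, D.proj (D.lift x) = x := by
    intro τ hτ x hx
    obtain ⟨k, hk, hkl⟩ := D.exists_section τ hτ
    rw [← hkl x hx, hk]
  refine isToricBundle_of_cones D.proj ?_ fun τ hτ => ?_
  · rintro _ ⟨t, ht, τ, hτ, rfl⟩
    refine ⟨τ, hτ, mapsCone_of_forall_mem fun x hx => ?_⟩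
    rcases D.mem_join.1 hx with ⟨a, ha, rfl⟩ | ⟨a, ha, rfl⟩
    · exact Or.inl (D.proj_incl a)
    · exact Or.inr (by rwa [hproj hτ a ha])
  · obtain ⟨k, e, hk, hp, h1, h2, -⟩ := D.exists_split hτ
    refine ⟨e, LinearMap.ext hp, fun s => ⟨?_, ?_⟩⟩
    · rintro ⟨⟨t, ht, τ', hτ', rfl⟩, hm⟩
      have hsub : τ' ⊆ τ := fun x hx => Z.mem_of_mem_cone hτ' hτ hx (by
        have := hm _ (D.mem_join.2 (Or.inr ⟨x, hx, rfl⟩))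
        rwa [hproj hτ' x hx] at this)
      exact ⟨t, ht, τ', hsub, D.image_join hk h1 h2 hsub⟩
    · rintro ⟨t, ht, τ', hsub, hs⟩
      have hsj : s = D.join t τ' := by
        rw [← D.image_join hk h1 h2 hsub] at hs
        exact_mod_cast e.injective.image_injective hs
      have hτ' := Z.face_mem hτ hsub
      refine ⟨⟨t, ht, τ', hτ', hsj⟩, ?_⟩
      rw [hsj]
      refine mapsCone_of_forall_mem fun x hx => ?_
      rcases D.mem_join.1 hx with ⟨a, ha, rfl⟩ | ⟨a, ha, rfl⟩
      · exact Or.inl (D.proj_incl a)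
      · exact Or.inr (by rw [hproj hτ' a ha]; exact hsub ha)

end BundleData

end Bundle

end Toric

namespace Toric

/-! ### Codimension -/

section Codimension

variable {N : Type} [AddCommGroup N] [Module.Free ℤ N]

/-- Characters embed into a power of `ℤ`. This makes the chart rings domains, as the prime ideals in
`two_le_height` require. -/
instance (s : Finset N) : TwoUniqueSums (dualMonoid s) := by
  let b := Module.Free.chooseBasis ℤ N
  let f : dualMonoid s →ₙ+ (Module.Free.ChooseBasisIndex ℤ N → ℤ) :=
    { toFun := fun u i => u.1 (b i)
      map_add' := fun _ _ => rfl }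
  refine TwoUniqueSums.of_injective_addHom f (fun u v h => ?_) inferInstance
  exact Subtype.ext (b.ext fun i => congrFun h i)

open Classical in
/-- The projection of `ℂ[U_s]` to the functions on the invariant divisor given by `v ∈ s`. -/
noncomputable def divisorMap (s : Finset N) (v : N) (hv : v ∈ s) :
    AddMonoidAlgebra ℂ (dualMonoid s) →ₐ[ℂ] AddMonoidAlgebra ℂ (dualMonoid s) :=
  AddMonoidAlgebra.lift ℂ _ (dualMonoid s)
    { toFun := fun u => if u.toAdd.1 v = 0 then .single u.toAdd 1 else 0
      map_one' := if_pos rfl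
      map_mul' := fun a b => by
        have ha := a.toAdd.2 v hv
        have hb := b.toAdd.2 v hv
        have hab : (a * b).toAdd.1 v = a.toAdd.1 v + b.toAdd.1 v := rfl
        by_cases h1 : a.toAdd.1 v = 0
        · by_cases h2 : b.toAdd.1 v = 0
          · rw [if_pos h1, if_pos h2, if_pos (by rw [hab, h1, h2, add_zero]),
              AddMonoidAlgebra.single_mul_single, mul_one]
            rfl
          · rw [if_neg h2, if_neg (by rw [hab]; omega), mul_zero]
        · rw [if_neg h1, if_neg (by rw [hab]; omega), zero_mul] }

omit [Module.Free ℤ N] in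
lemma divisorMap_single_of_eq {s : Finset N} {v : N} (hv : v ∈ s) {u : dualMonoid s}
    (hu : u.1 v = 0) (c : ℂ) : divisorMap s v hv (.single u c) = .single u c := by
  refine (AddMonoidAlgebra.lift_single _ _ _).trans ?_
  refine (congrArg (c • ·) (if_pos hu)).trans ?_
  simp

omit [Module.Free ℤ N] in
lemma divisorMap_single_of_ne {s : Finset N} {v : N} (hv : v ∈ s) {u : dualMonoid s}
    (hu : u.1 v ≠ 0) (c : ℂ) : divisorMap s v hv (.single u c) = 0 := by
  refine (AddMonoidAlgebra.lift_single _ _ _).trans ?_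
  refine (congrArg (c • ·) (if_neg hu)).trans ?_
  simp

-- The map deletes exactly the monomials with `u v > 0`, and these lie in `p`.
omit [Module.Free ℤ N] in
lemma mem_of_divisorMap_eq_zero {s : Finset N} {v : N} (hv : v ∈ s)
    {p : Ideal (AddMonoidAlgebra ℂ (dualMonoid s))}
    (hp : ∀ u : dualMonoid s, 0 < u.1 v → .single u 1 ∈ p) {f : AddMonoidAlgebra ℂ (dualMonoid s)}
    (hf : divisorMap s v hv f = 0) : f ∈ p := by
  have key : ∀ f, f - divisorMap s v hv f ∈ p := by
    intro f
    induction f using AddMonoidAlgebra.induction_linear with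
    | zero => simp
    | add f g hf hg =>
      rw [map_add, add_sub_add_comm]
      exact p.add_mem hf hg
    | single u c =>
      by_cases hu : u.1 v = 0
      · rw [divisorMap_single_of_eq hv hu, sub_self]
        exact p.zero_mem
      · rw [divisorMap_single_of_ne hv hu, sub_zero]
        have h1 := p.mul_mem_left (.single 0 c) (hp u (lt_of_le_of_ne (u.2 v hv) (Ne.symm hu)))
        rwa [AddMonoidAlgebra.single_mul_single, zero_add, mul_one] at h1
  have := key f
  rwa [hf, sub_zero] at this

/-- A prime containing the equations of two invariant divisors has height at least two. -/
lemma two_le_height {s : Finset N} {v : N} (hv : v ∈ s)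
    {p : Ideal (AddMonoidAlgebra ℂ (dualMonoid s))} [p.IsPrime] (hp : ∀ u : dualMonoid s, 0 < u.1 v → .single u 1 ∈ p)
    {a b : dualMonoid s} (ha : 0 < a.1 v) (hb : b.1 v = 0) (hbw : .single b 1 ∈ p) :
    2 ≤ p.height := by
  -- The chain is `⊥ < q < p`, with `q` the ideal of the divisor of `v`: the character of `a`
  -- separates `⊥` from `q`, and that of `b` separates `q` from `p`.
  let q : Ideal (AddMonoidAlgebra ℂ (dualMonoid s)) := RingHom.ker (divisorMap s v hv)
  have : q.IsPrime := RingHom.ker_isPrime _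
  have hsingle : ∀ u : dualMonoid s, (AddMonoidAlgebra.single u (1 : ℂ)) ≠ 0 := fun u h => by
    rw [AddMonoidAlgebra.single_eq_zero] at h
    exact one_ne_zero h
  have haq : .single a 1 ∈ q := divisorMap_single_of_ne hv ha.ne' 1
  have hbq : .single b 1 ∉ q := fun h => by
    have h1 : divisorMap s v hv (.single b 1) = 0 := h
    rw [divisorMap_single_of_eq hv hb] at h1
    exact hsingle b h1
  have hqp : q < p := lt_of_le_of_ne (fun f hf => mem_of_divisorMap_eq_zero hv hp hf)
    fun h => hbq (h ▸ hbw)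
  have h0q : (⊥ : Ideal (AddMonoidAlgebra ℂ (dualMonoid s))) < q := by
    refine lt_of_le_of_ne bot_le fun h => hsingle a ?_
    rw [← h] at haq
    exact haq
  have h1 := Ideal.height_add_one_le_of_lt_of_isPrime h0q
  have h2 := Ideal.height_add_one_le_of_lt_of_isPrime hqp
  calc (2 : ℕ∞) = 0 + 1 + 1 := by norm_num
    _ ≤ (⊥ : Ideal (AddMonoidAlgebra ℂ (dualMonoid s))).height + 1 + 1 := by
      gcongr; exact zero_le
    _ ≤ q.height + 1 := by gcongr
    _ ≤ p.height := h2

/-- The points outside of the charts of the rays have codimension at least two. -/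
theorem SmoothFan.two_le_ringKrullDim {X : SmoothFan N} {x : X.variety.left} {s : Finset N}
    (hs : s ∈ X.cones) (hx : x ∈ X.chartSet s) (hmin : ∀ t, x ∈ X.chartSet t → s ⊆ t) {v w : N}
    (hv : v ∈ s) (hw : w ∈ s) (hvw : v ≠ w) :
    2 ≤ ringKrullDim (X.variety.left.presheaf.stalk x) := by
  classical
  obtain ⟨_, y, rfl⟩ := hx
  rw [ringKrullDim_stalk_eq_coheight]
  have h1 : Order.coheight ((X.ι s hs).left y) = Order.coheight y :=
    coheight_eq_of_isOpenImmersion (X.ι s hs).left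
  rw [h1]
  have h2 : (PrimeSpectrum.asIdeal y).height = Order.coheight y := idealHeight_eq_coheight _ y
  rw [← h2]
  -- If such a character did not vanish at `y`, then `y` would lie in the chart of a face without
  -- `z`, against minimality of `s`.
  have hmem : ∀ u : dualMonoid s, ∀ z ∈ s, 0 < u.1 z →
      AddMonoidAlgebra.single u (1 : ℂ) ∈ PrimeSpectrum.asIdeal y := by
    intro u z hz huz
    by_contra hu
    obtain ⟨-, hr⟩ := isOpenImmersion_face (s := s) (t := s.filter fun x => u.1 x = 0)
      (Finset.filter_subset _ _) u (fun x hx => (Finset.mem_filter.1 hx).2)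
      (fun x hx hx' => lt_of_le_of_ne (u.2 x hx)
        fun h => hx' (Finset.mem_filter.2 ⟨hx, h.symm⟩))
    have hy : y ∈ (PrimeSpectrum.basicOpen
        (AddMonoidAlgebra.single u (1 : ℂ)) : Set (PrimeSpectrum _)) := hu
    rw [← hr] at hy
    obtain ⟨y', hy'⟩ := hy
    have hsf : s.filter (fun x => u.1 x = 0) ∈ X.cones := X.face_mem hs (Finset.filter_subset _ _)
    have hsub := hmin _ ⟨hsf, y', by rw [← hy', SmoothFan.faceMap_ι_apply hs hsf]⟩
    exact huz.ne' (Finset.mem_filter.1 (hsub hz)).2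
  obtain ⟨d, d1, d0⟩ := X.exists_dual hs
  have hd : ∀ z ∈ s, d z ∈ dualMonoid s := fun z hz x hx => by
    by_cases h : z = x
    · subst h; rw [d1 z hz]; exact zero_le_one
    · rw [d0 z hz x hx h]
  have hprime : (PrimeSpectrum.asIdeal y).IsPrime := PrimeSpectrum.isPrime y
  have := two_le_height hv (p := PrimeSpectrum.asIdeal y) (fun u hu => hmem u v hv hu)
    (a := ⟨d v, hd v hv⟩) (b := ⟨d w, hd w hw⟩) (by rw [d1 v hv]; exact zero_lt_one)
    (d0 w hw v hv hvw.symm) (hmem _ w hw (by rw [d1 w hw]; exact zero_lt_one))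
  exact WithBot.coe_le_coe.2 this

/-- The fan of the common cones of two fans. -/
def SmoothFan.common {N : Type} [AddCommGroup N] (X X' : SmoothFan N) : SmoothFan N where
  cones := X.cones ∩ X'.cones
  finite_cones := X.finite_cones.inter_of_left _
  empty_mem := ⟨X.empty_mem, X'.empty_mem⟩
  face_mem := fun hs ht => ⟨X.face_mem hs.1 ht, X'.face_mem hs.2 ht⟩
  unimodular := fun hs => X.unimodular hs.1
  inter := fun hs ht => X.inter hs.1 ht.1

/-- The smallest cone around `x` is neither zero nor a ray, as those belong to `Y`. So it has two
generators. -/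
lemma SmoothFan.two_le_ringKrullDim_of_gens_subset {X Y : SmoothFan N}
    (hg : X.gens ⊆ Y.gens) {x : X.variety.left} (hx : ∀ s ∈ Y.cones, x ∉ X.chartSet s) :
    2 ≤ ringKrullDim (X.variety.left.presheaf.stalk x) := by
  obtain ⟨s, hs, hxs, hmin⟩ := X.exists_minimal_chart x
  rcases lt_or_ge 1 s.card with h | h
  · obtain ⟨v, hv, w, hw, hvw⟩ := Finset.one_lt_card.1 h
    exact X.two_le_ringKrullDim hs hxs hmin hv hw hvw
  · exfalso
    refine hx s ?_ hxs
    rcases Finset.card_le_one_iff_subset_singleton.1 h with ⟨v, hv⟩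
    rcases Finset.subset_singleton_iff.1 hv with rfl | rfl
    · exact Y.empty_mem
    · exact hg hs

/-- Toric varieties whose fans have the same generators are isomorphic in codimension one. -/
theorem isoInCodimOne_of_gens_eq {X X' : SmoothFan N} (h : X.gens = X'.gens) :
    IsoInCodimOne X X' := by
  let U := X.common X'
  have hU : U.cones ⊆ X.cones := fun s hs => hs.1
  have hU' : U.cones ⊆ X'.cones := fun s hs => hs.2
  have hg : X.gens ⊆ U.gens := fun v hv => ⟨hv, h.subset hv⟩
  have hg' : X'.gens ⊆ U.gens := h.symm.subset.trans hg
  obtain ⟨i, -, hi, hio, hir⟩ := exists_subfan_immersion hU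
  obtain ⟨i', -, hi', hio', hir'⟩ := exists_subfan_immersion hU'
  refine ⟨U.variety, i, i', U.ι ∅ U.empty_mem, hio, hio', hi _ _, hi' _ _, fun x hx => ?_,
    fun x hx => ?_⟩
  · exact SmoothFan.two_le_ringKrullDim_of_gens_subset hg
      fun s hs hxs => hx ((hir x).2 ⟨s, hs, hxs⟩)
  · exact SmoothFan.two_le_ringKrullDim_of_gens_subset hg'
      fun s hs hxs => hx ((hir' x).2 ⟨s, hs, hxs⟩)

end Codimension

end Toric

namespace Toric

/-! ### The two cases of the classification. -/

section Classification

variable {N : Type} [AddCommGroup N] [Module.Free ℤ N] {X : SmoothFan N}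

/-- A smooth toric Fano variety whose symmetric generators span is a product of standard factors. -/
theorem SmoothFan.IsFano.isProductOfStandardFactors [Module.Finite ℤ N] (hX : X.IsFano)
    (hH : Module.finrank ℚ X.symmSpan = Module.finrank ℤ N) : IsProductOfStandardFactors X := by
  classical
  obtain ⟨s, hs⟩ := hX.exists_adapted
  have hall : s.filter X.IsSym = s := by
    refine Finset.eq_of_subset_of_card_le (Finset.filter_subset _ _) ?_
    rw [hs.facet.card_eq, ← hH, hs.finrank_symmSpan]
  have htop : ∀ v, v ∈ X.symLattice := fun v => hs.mem_symLattice_iff.2 fun x hx hxs =>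
    absurd (Finset.mem_filter.1 (hall.symm ▸ hx)).2 hxs
  obtain ⟨k, d, l, hl, hrange, hstd, hgens⟩ := hs.exists_blocks hX
  have hbij : Function.Bijective l := ⟨hl, fun v => by
    have := htop v
    rwa [← hrange] at this⟩
  let e := LinearEquiv.ofBijective l hbij
  have he : ∀ a, e a = l a := fun _ => rfl
  refine ⟨k, d, fun i => (hstd i).isFanoConfig.fan, fun i => (hstd i).isStandardFactor, ?_⟩
  refine hX.isToricProduct (fun i => (hstd i).isFanoConfig.isFano_fan) e.symm fun v => ?_
  simp only [IsFanoConfig.gens_fan, LinearEquiv.symm_apply_eq, he]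
  constructor
  · intro hv
    obtain ⟨i, a, rfl⟩ := hgens v hv (htop v)
    exact ⟨i, a, hv, rfl⟩
  · rintro ⟨i, a, ha, rfl⟩
    exact ha

/-- If the symmetric generators span a hyperplane, the other generators are one on each side. -/
lemma SmoothFan.IsAdapted.exists_isSymEquation {s : Finset N} (hX : X.IsFano)
    (hs : X.IsAdapted s) (hH : Module.finrank ℚ X.symmSpan + 1 = Module.finrank ℤ N) :
    ∃ (u : N →ₗ[ℤ] ℤ) (z z' : N), X.IsSymEquation u ∧ u z = 1 ∧ u z' = -1 ∧
      ∀ v, v ∈ X.gens ↔ (v ∈ X.gens ∧ v ∈ X.symLattice) ∨ v = z ∨ v = z' := by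
  classical
  have hcard : (s.filter fun x => ¬ X.IsSym x).card = 1 := by
    have h1 := Finset.card_filter_add_card_filter_not (s := s) X.IsSym
    have h2 := hs.finrank_symmSpan
    have h3 := hs.facet.card_eq
    omega
  obtain ⟨z, hz⟩ := Finset.card_eq_one.1 hcard
  have hz' : ∀ x, x ∈ s ∧ ¬ X.IsSym x ↔ x = z := fun x => by
    rw [← Finset.mem_singleton, ← hz, Finset.mem_filter]
  have hzs := (hz' z).2 rfl
  have huz : co s z z = 1 := hs.facet.co_self hzs.1
  -- The adapted cone has a single non-symmetric element `z`, and its coordinate is an equation of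
  -- `H`. The generator on the other side is the one across the wall opposite to `z`.
  have hu : X.IsSymEquation (co s z) := by
    refine ⟨fun v => ?_, z, huz⟩
    rw [hs.mem_symLattice_iff]
    exact ⟨fun h => h z hzs.1 hzs.2, fun h x hx hxs => by rw [(hz' x).1 ⟨hx, hxs⟩, h]⟩
  obtain ⟨w, huw, hsw⟩ := hX.1.exists_neighbor hs.facet hzs.1
  have hzg := X.mem_gens_of_mem hs.facet.1 hzs.1
  have hwg := X.mem_gens_of_mem hsw.1 (Finset.mem_insert_self w _)
  refine ⟨co s z, z, w, hu, huz, huw, fun v => ⟨fun hv => ?_, ?_⟩⟩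
  · by_cases h0 : co s z v = 0
    · exact Or.inl ⟨hv, (hu.1 v).2 h0⟩
    · right
      rcases hu.eq_one_or hX hv h0 with h | h
      · exact Or.inl (hu.eq_of_opposite hX hv h hzg huz hwg huw)
      · exact Or.inr (hu.neg.eq_of_opposite hX hv (by simp [h]) hwg (by simp [huw]) hzg
          (by simp [huz]))
  · rintro (h | rfl | rfl)
    · exact h.1
    · exact hzg
    · exact hwg

/-- The fan of the projective line. -/
lemma isProjectiveLine_fan : IsProjectiveLine isFanoConfig_line.fan :=
  ⟨rfl, isFanoConfig_line.isFano_fan.1, isFanoConfig_line.gens_fan⟩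

-- A cone of the fan of `ℙ¹` contains at most one of `1` and `-1`, so a section only has to hit one
-- prescribed lift.
omit [Module.Free ℤ N] in
lemma line_exists_section {u : N →ₗ[ℤ] ℤ} {z z' : N} (hz : u z = 1) (hz' : u z' = -1)
    {τ : Finset (Fin 1 → ℤ)} (hτ : τ ∈ isFanoConfig_line.fan.cones) :
    ∃ k : (Fin 1 → ℤ) →ₗ[ℤ] N, (∀ c, (LinearMap.pi fun _ : Fin 1 => u) (k c) = c) ∧
      ∀ x ∈ τ, k x = if x 0 = 1 then z else z' := by
  have hval : ∀ x ∈ τ, x = 1 ∨ x = -1 := fun x hx => by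
    have := isFanoConfig_line.fan.mem_gens_of_mem hτ hx
    rw [isFanoConfig_line.gens_fan] at this
    exact this
  have hne : (1 : Fin 1 → ℤ) ≠ -1 := fun h => by
    have := congrFun h 0
    simp at this
  by_cases h1 : (-1 : Fin 1 → ℤ) ∈ τ
  · refine ⟨-(LinearMap.toSpanSingleton ℤ N z' ∘ₗ LinearMap.proj 0), fun c => ?_, fun x hx => ?_⟩
    · ext i
      fin_cases i
      simp [hz']
    · rcases hval x hx with rfl | rfl
      · exfalso
        obtain ⟨d, d1, d0⟩ := isFanoConfig_line.fan.exists_dual hτ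
        have h2 := d1 1 hx
        have h3 := d0 1 hx (-1) h1 hne
        rw [map_neg, h2] at h3
        omega
      · have : ¬ ((-1 : Fin 1 → ℤ) 0 = 1) := by simp
        rw [if_neg this]
        simp
  · refine ⟨LinearMap.toSpanSingleton ℤ N z ∘ₗ LinearMap.proj 0, fun c => ?_, fun x hx => ?_⟩
    · ext i
      fin_cases i
      simp [hz]
    · rcases hval x hx with rfl | rfl
      · simp
      · exact absurd hx h1

/-- The fibre lattice is `H ∩ N` with the Fano fan of the blocks, and the base lattice is reached
through `u`. Lifting `1` and `-1` to the two generators off `H` makes the generators of the bundle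
fan those of `X`. -/
theorem SmoothFan.IsFano.exists_bundle [Module.Finite ℤ N] (hX : X.IsFano)
    (hH : Module.finrank ℚ X.symmSpan + 1 = Module.finrank ℤ N) :
    ∃ X' : SmoothFan N, X'.IsComplete ∧ X'.gens = X.gens ∧ IsoInCodimOne X X' ∧
      ∃ (Z : SmoothFan (Fin 1 → ℤ)) (m : ℕ) (F : SmoothFan (Fin m → ℤ)),
        IsProjectiveLine Z ∧ IsProductOfStandardFactors F ∧ IsToricBundle X' Z F := by
  classical
  obtain ⟨s, hs⟩ := hX.exists_adapted
  obtain ⟨u, z, z', hu, hz, hz', hgens⟩ := hs.exists_isSymEquation hX hH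
  obtain ⟨k, d, l, hl, hrange, hstd, hblock⟩ := hs.exists_blocks hX
  -- The fibre fan has to live in some `ℤ^m`, so the product of the block lattices is given
  -- coordinates.
  let φ := (Module.finBasis ℤ (∀ i, Fin (d i) → ℤ)).equivFun
  have hF := (IsFanoConfig.pi fun i => (hstd i).isFanoConfig).map φ
  have hprod : IsProductOfStandardFactors hF.fan := by
    refine ⟨k, d, fun i => (hstd i).isFanoConfig.fan, fun i => (hstd i).isStandardFactor, ?_⟩
    refine hF.isFano_fan.isToricProduct (fun i => (hstd i).isFanoConfig.isFano_fan) φ.symm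
      fun v => ?_
    rw [hF.gens_fan]
    simp only [IsFanoConfig.gens_fan]
    constructor
    · rintro ⟨_, ⟨i, a, ha, rfl⟩, rfl⟩
      exact ⟨i, a, ha, φ.symm_apply_apply _⟩
    · rintro ⟨i, a, ha, hv⟩
      exact ⟨_, ⟨i, a, ha, rfl⟩, by rw [← hv, φ.apply_symm_apply]⟩
  let D : BundleData N hF.fan isFanoConfig_line.fan :=
    { incl := l ∘ₗ φ.symm.toLinearMap
      proj := LinearMap.pi fun _ => u
      lift := fun c => if c 0 = 1 then z else z'
      incl_injective := hl.comp φ.symm.injective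
      exact := fun v => by
        have h1 : (LinearMap.pi fun _ : Fin 1 => u) v = 0 ↔ u v = 0 :=
          ⟨fun h => congrFun h 0, fun h => funext fun _ => h⟩
        rw [h1, ← hu.1, ← hrange]
        constructor
        · rintro ⟨a, rfl⟩
          exact ⟨φ a, by simp⟩
        · rintro ⟨a, rfl⟩
          exact ⟨φ.symm a, rfl⟩
      exists_section := fun τ hτ => line_exists_section hz hz' hτ }
  have hD : ∀ c, D.lift c = if c 0 = 1 then z else z' := fun _ => rfl
  have hlift : D.lift 1 = z := by rw [hD, if_pos (Pi.one_apply 0)]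
  have hlift' : D.lift (-1) = z' := by
    rw [hD, if_neg (by simp : ¬ ((-1 : Fin 1 → ℤ) 0 = 1))]
  have hg : D.fan.gens = X.gens := by
    rw [D.gens_fan, hF.gens_fan, isFanoConfig_line.gens_fan]
    ext v
    rw [hgens v, Set.mem_union]
    refine or_congr ⟨?_, ?_⟩ ⟨?_, ?_⟩
    · rintro ⟨_, ⟨_, ⟨i, a, ha, rfl⟩, rfl⟩, rfl⟩
      have : D.incl (φ (Pi.single i a)) = l (Pi.single i a) := congrArg l (φ.symm_apply_apply _)
      rw [this]
      exact ⟨ha, hrange ▸ ⟨_, rfl⟩⟩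
    · rintro ⟨hv, hvH⟩
      obtain ⟨i, a, rfl⟩ := hblock v hv hvH
      exact ⟨_, ⟨_, ⟨i, a, hv, rfl⟩, rfl⟩, congrArg l (φ.symm_apply_apply _)⟩
    · rintro ⟨c, rfl | rfl, rfl⟩
      · exact Or.inl hlift
      · exact Or.inr hlift'
    · rintro (rfl | rfl)
      · exact ⟨1, Or.inl rfl, hlift⟩
      · exact ⟨-1, Or.inr rfl, hlift'⟩
  exact ⟨D.fan, D.isComplete_fan hF.isFano_fan.1 isFanoConfig_line.isFano_fan.1, hg,
    isoInCodimOne_of_gens_eq hg.symm, _, _, _, isProjectiveLine_fan, hprod, D.isToricBundle_fan⟩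

end Classification

end Toric

theorem proposition4 {N : Type} [AddCommGroup N] [Module.Free ℤ N] [Module.Finite ℤ N]
    (X : Toric.SmoothFan N) (hX : X.IsFano) :
    (Module.finrank ℚ X.symmSpan = Module.finrank ℤ N →
      Toric.IsProductOfStandardFactors X) ∧
    (Module.finrank ℚ X.symmSpan + 1 = Module.finrank ℤ N →
      ∃ X' : Toric.SmoothFan N, X'.IsComplete ∧ X'.gens = X.gens ∧ Toric.IsoInCodimOne X X' ∧
        ∃ (Z : Toric.SmoothFan (Fin 1 → ℤ)) (m : ℕ) (F : Toric.SmoothFan (Fin m → ℤ)),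
          Toric.IsProjectiveLine Z ∧ Toric.IsProductOfStandardFactors F ∧
            Toric.IsToricBundle X' Z F) :=
  ⟨hX.isProductOfStandardFactors, hX.exists_bundle⟩
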